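/- **Conventions.** $\mathbb P^3,\mathbb P^2$ are complex projective spaces. A camera is a real $3\times4$ matrix $P$ of rank $3$; its center is its kernel, a point of $\mathbb P^3$. The cameras of a tuple always have distinct centers. A point $x\in\mathbb P^3$ has image $z\in\mathbb P^2$ under $P$ if $(x,z)$ lies in the closure of the graph of $x\mapsto P(x)$; so $z=P(x)$ unless $x$ is the center, and the center has every $z$ as an image. A configuration $(P_1,\dots,P_n,X)$, $X\subseteq\mathbb P^3$, is a reconstruction of $S\subseteq(\mathbb P^2)^n$ if every $x\in X$ has an image tuple in $S$ and every tuple in $S$ is an image tuple of some $x\in X$. The fundamental matrix $F_P^{ij}$ is defined up to scale by $$\mathbf x^TF_P^{ij}\mathbf y=\det\begin{bmatrix}P_i&\mathbf x&0\\P_j&0&\mathbf y\end{bmatrix}.$$ Two configurations $(P,X)$, $(Q,Y)$ are conjugate if they are reconstructions of the same set, there is no $H\in \mathrm{PGL}(4)$ with $H(X)=Y$ and $P_iH^{-1}=Q_i$ for all $i$, and $F_P^{ij}\ne F_Q^{ij}$ for all $i\neq j$. A configuration is critical if it has a conjugate. The set of critical points of $P$ with respect to $Q$ is the set of $x\in\mathbb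 P^3$ for which there is $y\in\mathbb P^3$ such that, for every $i$, some $z_i\in\mathbb P^2$ is an image of $x$ under $P_i$ and of $y$ under $Q_i$. The quadric $S_P^{ij}$ is $\{x: x^TP_i^TF_Q^{ij}P_jx=0\}$, and $S_Q^{ij}$ is obtained by exchanging $P$ and $Q$. A conic in a plane is the zero set in that plane of a nonzero quadratic form; it is smooth if the form is nondegenerate. **Proposition.** (1) Let $P=(P_1,P_2,P_3)$ and $Q=(Q_1,Q_2,Q_3)$ be triples of cameras such that the centers of $Q_1,Q_2,Q_3$ are not collinear, and suppose that the three quadrics $S_P^{12},S_P^{13},S_P^{23}$ are all equal to the same union $A\cup B$ of two distinct planes. Then the planes are real and, for a suitable labelling $\{A,B\}=\{\Pi,\Pi_C\}$, the set of critical points of $P$ with respect to $Q$ is $\Pi\cup C$, where $C\subset\Pi_C$ is a real conic passing through the three centers of $P$; $C$ is smooth if these centers are not collinear. The conjugate side is of the same type: the three quadrics $S_Q^{ij}$ are all equal to the same two distinct real planes $\Pi'\cup\Pi'_{C}$, and the set of critical points of $Q$ with respect to $P$ is $\Pi'\cup C'$, where $C'\subset\Pi'_C$ is a smooth real conic passing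 through the three centers of $Q$. (2) Conversely, let $n\ge2$ (in particular $n=3$), let $\Pi$ be a real plane, let $C$ be a smooth real conic in a real plane, and let $P=(P_1,\dots,P_n)$ be cameras with distinct centers, all lying on $C$. Then $(P,X)$ is a critical configuration for every $X\subseteq\Pi\cup C$. Moreover, there are cameras $Q=(Q_1,\dots,Q_n)$ with distinct centers, a real plane $\Pi'$ and a smooth real conic $C'$ through all centers of $Q$, with $C'\subset\Pi'$ if and only if $C\subset\Pi$, such that $(Q,\Pi'\cup C')$ is conjugate to $(P,\Pi\cup C)$, and for every $X\subseteq\Pi\cup C$ there is $Y\subseteq\Pi'\cup C'$ such that $(Q,Y)$ is conjugate to $(P,X)$. -/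

import Mathlib

open scoped LinearAlgebra.Projectivization Matrix

noncomputable section

/-- Projective space `ℙ³` over the complex numbers (the space points). -/
abbrev P3 : Type := ℙ ℂ (Fin 4 → ℂ)

/-- The projective plane `ℙ²` over the complex numbers (the image points). -/
abbrev P2 : Type := ℙ ℂ (Fin 3 → ℂ)

/-- A camera, given by its camera matrix: a real `3 × 4` matrix of full rank. -/
structure Camera where
  mat : Matrix (Fin 3) (Fin 4) ℝ
  rank_eq : mat.rank = 3

/-- The linear map `ℂ⁴ → ℂ³` given by the camera matrix. -/
def Camera.toLin (P : Camera) : (Fin 4 → ℂ) →ₗ[ℂ] (Fin 3 → ℂ) :=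
  (P.mat.map (algebraMap ℝ ℂ)).mulVecLin

theorem Camera.toLin_surjective (P : Camera) : Function.Surjective P.toLin := by
  have h1 : Function.Surjective P.mat.mulVecLin := by
    rw [← LinearMap.range_eq_top]
    apply Submodule.eq_top_of_finrank_eq
    have := P.rank_eq
    rw [Matrix.rank] at this
    rw [this]
    simp
  obtain ⟨B, hB⟩ := Matrix.mulVec_surjective_iff_exists_right_inverse.1 h1
  refine Matrix.mulVec_surjective_iff_exists_right_inverse.2
    ⟨B.map (algebraMap ℝ ℂ), ?_⟩
  rw [← Matrix.map_mul, hB]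
  exact Matrix.map_one _ (map_zero _) (map_one _)

theorem Camera.finrank_ker (P : Camera) :
    Module.finrank ℂ (LinearMap.ker P.toLin) = 1 := by
  have h := LinearMap.finrank_range_add_finrank_ker P.toLin
  rw [LinearMap.range_eq_top.2 P.toLin_surjective, finrank_top] at h
  simp only [Module.finrank_fintype_fun_eq_card, Fintype.card_fin] at h
  omega

/-- The camera center: the kernel of the camera matrix, as a point of `ℙ³`. -/
def Camera.center (P : Camera) : P3 :=
  Projectivization.mk'' (LinearMap.ker P.toLin) P.finrank_ker

/-- `z` is an image of `x` under the camera `P`. For `x` different from the camera center this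
says `z = P(x)`; the center has every `z` as an image, so that the relation is the closure of the
graph of `P : ℙ³ ⇢ ℙ²`. -/
def Camera.Sees (P : Camera) (x : P3) (z : P2) : Prop :=
  Submodule.map P.toLin x.submodule ≤ z.submodule

variable {n : ℕ}

/-- The camera centers of a tuple of cameras. -/
def centers (P : Fin n → Camera) : Fin n → P3 := fun i => (P i).center

/-- `(P₁, …, Pₙ, X)` is a reconstruction of the set `S ⊆ (ℙ²)ⁿ`: `S` is a set of images of the
points of `X`, each point of `X` having at least one image in `S`. -/
def IsReconstruction (P : Fin n → Camera) (X : Set P3) (S : Set (Fin n → P2)) : Prop :=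
  (∀ x ∈ X, ∃ s ∈ S, ∀ i, (P i).Sees x (s i)) ∧
  (∀ s ∈ S, ∃ x ∈ X, ∀ i, (P i).Sees x (s i))

/-- Equivalence of configurations: some `H ∈ PGL(4)` has `H(X) = Y` and `Pᵢ H⁻¹ = Qᵢ` for all `i`
(as projective maps). -/
def Equivalent (P : Fin n → Camera) (X : Set P3) (Q : Fin n → Camera) (Y : Set P3) : Prop :=
  ∃ H : (Fin 4 → ℂ) ≃ₗ[ℂ] (Fin 4 → ℂ),
    Projectivization.map H.toLinearMap H.injective '' X = Y ∧
    ∀ i, ∃ c : ℂ, c ≠ 0 ∧ (P i).toLin ∘ₗ H.symm.toLinearMap = c • (Q i).toLin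

/-- The `6 × 6` matrix with block rows `(P, x, 0)` and `(P', 0, y)`. -/
def fundamentalBlock (P P' : Camera) (x y : Fin 3 → ℝ) : Matrix (Fin 6) (Fin 6) ℝ :=
  (Matrix.fromBlocks P.mat (Matrix.of fun a => ![x a, 0])
    P'.mat (Matrix.of fun a => ![0, y a])).submatrix
    (finSumFinEquiv (m := 3) (n := 3)).symm (finSumFinEquiv (m := 4) (n := 2)).symm

/-- The fundamental matrix `F` of a pair of cameras: `xᵀ F y` is the determinant of the matrix with
block rows `(P, x, 0)` and `(P', 0, y)`, a bilinear form in `x` and `y`. -/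
def fundamentalMatrix (P P' : Camera) : Matrix (Fin 3) (Fin 3) ℝ :=
  Matrix.of fun a b => (fundamentalBlock P P' (Pi.single a 1) (Pi.single b 1)).det

/-- `F_P^{ij} ≠ F_Q^{ij}` for all `i ≠ j`, where fundamental matrices are taken up to scale. -/
def FundamentalMatricesDiffer (P Q : Fin n → Camera) : Prop :=
  ∀ i j, i ≠ j → ¬ ∃ c : ℝ, c ≠ 0 ∧
    fundamentalMatrix (Q i) (Q j) = c • fundamentalMatrix (P i) (P j)

/-- `(P, X)` and `(Q, Y)` are (non-trivially) conjugate configurations: inequivalent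
reconstructions of the same set of image points, with different fundamental matrices for every
pair of views. -/
def IsConjugate (P : Fin n → Camera) (X : Set P3) (Q : Fin n → Camera) (Y : Set P3) : Prop :=
  (∃ S : Set (Fin n → P2), IsReconstruction P X S ∧ IsReconstruction Q Y S) ∧
  ¬ Equivalent P X Q Y ∧ FundamentalMatricesDiffer P Q

/-- A (non-trivial) critical configuration: one that has a conjugate configuration. The centers of
the cameras of a configuration are always distinct. -/
def IsCritical (P : Fin n → Camera) (X : Set P3) : Prop :=
  ∃ (Q : Fin n → Camera) (Y : Set P3),
    Function.Injective (centers Q) ∧ IsConjugate P X Q Y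

/-- The set of critical points of `P` with respect to `Q`: the points `x` for which there is a `y`
with the same images in all views. -/
def criticalPoints (P Q : Fin n → Camera) : Set P3 :=
  {x | ∃ y : P3, ∃ z : Fin n → P2, ∀ i, (P i).Sees x (z i) ∧ (Q i).Sees y (z i)}

/-- The zero set in `ℙ³` of the linear form with coefficient vector `l`. -/
def planeLocus (l : Fin 4 → ℂ) : Set P3 := {x | ∀ u ∈ x.submodule, l ⬝ᵥ u = 0}

/-- The zero set in `ℙ³` of the quadratic form `u ↦ uᵀ N u`, for a real `4 × 4` matrix `N`. -/
def quadricLocus (N : Matrix (Fin 4) (Fin 4) ℝ) : Set P3 :=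
  {x | ∀ u ∈ x.submodule, u ⬝ᵥ (N.map (algebraMap ℝ ℂ) *ᵥ u) = 0}

/-- The quadric `S_P^{ij}` given by the matrix `Pᵢᵀ F_Q^{ij} Pⱼ`. -/
def viewQuadric (P Q : Fin n → Camera) (i j : Fin n) : Set P3 :=
  quadricLocus ((P i).matᵀ * fundamentalMatrix (Q i) (Q j) * (P j).mat)

/-- A real plane `m = 0` in `ℙ³` together with a real conic, the locus `K = 0` in a real plane
`l = 0`. The quadratic form `K` does not vanish identically on the plane `l = 0`. -/
structure PlaneConic where
  m : Fin 4 → ℝ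
  l : Fin 4 → ℝ
  K : Matrix (Fin 4) (Fin 4) ℝ
  m_ne : m ≠ 0
  l_ne : l ≠ 0
  K_symm : K.IsSymm
  K_ne : ∃ v, l ⬝ᵥ v = 0 ∧ v ⬝ᵥ (K *ᵥ v) ≠ 0

namespace PlaneConic

/-- The plane. -/
def plane (T : PlaneConic) : Set P3 := planeLocus fun k => (T.m k : ℂ)

/-- The plane of the conic. -/
def conicPlane (T : PlaneConic) : Set P3 := planeLocus fun k => (T.l k : ℂ)

/-- The conic. -/
def conic (T : PlaneConic) : Set P3 := T.conicPlane ∩ quadricLocus T.K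

/-- The union of the plane and the conic. -/
def carrier (T : PlaneConic) : Set P3 := T.plane ∪ T.conic

/-- The conic does not lie in the plane, i.e. the two planes are different. -/
def IsProper (T : PlaneConic) : Prop := LinearIndependent ℝ ![T.m, T.l]

/-- The conic is smooth (irreducible): `K` is nondegenerate on the plane `l = 0`. -/
def IsSmooth (T : PlaneConic) : Prop :=
  ∀ v, T.l ⬝ᵥ v = 0 → (∀ w, T.l ⬝ᵥ w = 0 → w ⬝ᵥ (T.K *ᵥ v) = 0) → v = 0

end PlaneConic

end

/-! Three views: since the centers of `Q` are not collinear, coordinates `y₁, …, y₄` exist in which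
they are the first three basis points, and the views of `Q` become the projections `(y₂,y₃,y₄)`,
`(y₃,y₁,y₄)`, `(y₁,y₂,y₄)`. In the matching image coordinates `Pᵢ` consists of three independent
linear forms `(fᵢ,gᵢ,hᵢ)`. Two consecutive views of `Q` share two coordinates, so the epipolar
quadric of views `i` and `j` is `gᵢhⱼ - hᵢfⱼ`. All three of these quadratic forms are multiples of
`ab`, where `a` and `b` are the equations of the two planes.

The decisive point (`trifocal_forms_proportional`) is that the `hᵢ` are all multiples of the same
plane equation. If one of them is, cyclic propagation reaches the others. If none is, unique
factorization on each plane `hᵢ = 0` places `a` and `b` in the two different pencils spanned by `hᵢ`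
and the other two forms. No pencil contains both planes, so the three edges of a triangle would be
2-coloured with adjacent edges differing, which is impossible. Cancelling the common factor and
rescaling leads to the normal form `P = (r₂,r₃+A,B), (r₃,r₁+A,B), (r₁,r₂+A,B)`. Here `A` and `B` are
real forms defining the two planes, which is why the planes are real.

In normal form the critical set is elementary algebra. If `A` vanishes at `x`, the point `y =
(r₁,r₂,r₃,B)(x)` matches it. If not, `y₄ = 0` and `B = 0`, and a 3×3 linear system for `(y₁,y₂,y₃)`
remains, whose determinant is `A` times the conic equation up to sign (`Matched.left`,
`exists_matched_of_conic`). On the conjugate side, the five forms `r₁,r₂,r₃,B,A` on a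
four-dimensional space satisfy a linear relation; its first four coefficients define the plane, and
eliminating `x` from the linear system leaves the conic `y₁y₂+y₂y₃+y₃y₁ = 0` in `y₄ = 0`
(`Matched.right`, `exists_matched_of_dual_conic`).

Converse: let `m` be the equation of the plane and `K` the matrix of the conic in coordinates of its
own plane. Take the tangent vector `wᵢ` at the center `cᵢ`, normalized by `cᵢ × wᵢ = K cᵢ`, and put
`Qᵢ = Pᵢ(1 + ε wᵢ mᵀ)`. On `m = 0` the two tuples agree. In the plane of the conic the relation `x ×
y = ε m(y) K x`, which involves no `i`, makes `cᵢ`, `x` and `y + ε m(y) wᵢ` dependent for every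
center, so `x` and `y` have common images in all views. It pairs the conic `xᵀKx = 0` with the conic
`yᵀKy + ε² det K · m(y)² = 0`. For all but finitely many `ε` the new cameras and the new conic are
nondegenerate. A point off both planes shows that the epipolar constraints differ for each pair of
views, which rules out both equal fundamental matrices and projective equivalence. -/

/-! ### Loci, images and centers in homogeneous coordinates -/

/-- The complex vector with the given real coordinates. -/
def complexify {k : ℕ} (r : Fin k → ℝ) : Fin k → ℂ := fun j => (r j : ℂ)

theorem complexify_eq_zero {k : ℕ} {r : Fin k → ℝ} : complexify r = 0 ↔ r = 0 := by
  simp [complexify, funext_iff]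

theorem complexify_add {k : ℕ} (r s : Fin k → ℝ) :
    complexify (r + s) = complexify r + complexify s := by
  ext j; simp [complexify]

theorem complexify_sub {k : ℕ} (r s : Fin k → ℝ) :
    complexify (r - s) = complexify r - complexify s := by
  ext j; simp [complexify]

theorem complexify_smul {k : ℕ} (c : ℝ) (r : Fin k → ℝ) :
    complexify (c • r) = (c : ℂ) • complexify r := by
  ext j; simp [complexify]

theorem complexify_dotProduct {k : ℕ} (r s : Fin k → ℝ) :
    complexify r ⬝ᵥ complexify s = ((r ⬝ᵥ s : ℝ) : ℂ) := by
  simp [complexify, dotProduct]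

theorem map_mulVec_complexify {k m : ℕ} (A : Matrix (Fin m) (Fin k) ℝ) (r : Fin k → ℝ) :
    A.map (algebraMap ℝ ℂ) *ᵥ complexify r = complexify (A *ᵥ r) := by
  ext j; simp [complexify, Matrix.mulVec, dotProduct]

theorem map_mulVec_apply {k m : ℕ} (A : Matrix (Fin m) (Fin k) ℝ) (u : Fin k → ℂ) (j : Fin m) :
    (A.map (algebraMap ℝ ℂ) *ᵥ u) j = complexify (A j) ⬝ᵥ u := by
  simp [complexify, Matrix.mulVec, dotProduct]

theorem Camera.toLin_apply (P : Camera) (u : Fin 4 → ℂ) :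
    P.toLin u = P.mat.map (algebraMap ℝ ℂ) *ᵥ u := rfl

theorem Camera.toLin_complexify (P : Camera) (r : Fin 4 → ℝ) :
    P.toLin (complexify r) = complexify (P.mat *ᵥ r) := by
  rw [P.toLin_apply, map_mulVec_complexify]

theorem mk_mem_planeLocus {l u : Fin 4 → ℂ} (hu : u ≠ 0) :
    Projectivization.mk ℂ u hu ∈ planeLocus l ↔ l ⬝ᵥ u = 0 := by
  simp only [planeLocus, Set.mem_ofPred_eq, Projectivization.submodule_mk]
  constructor
  · intro h
    exact h u (Submodule.mem_span_singleton_self u)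
  · intro h v hv
    obtain ⟨c, rfl⟩ := Submodule.mem_span_singleton.1 hv
    simp [h]

theorem mk_mem_quadricLocus {N : Matrix (Fin 4) (Fin 4) ℝ} {u : Fin 4 → ℂ} (hu : u ≠ 0) :
    Projectivization.mk ℂ u hu ∈ quadricLocus N ↔
      u ⬝ᵥ (N.map (algebraMap ℝ ℂ) *ᵥ u) = 0 := by
  simp only [quadricLocus, Set.mem_ofPred_eq, Projectivization.submodule_mk]
  constructor
  · intro h
    exact h u (Submodule.mem_span_singleton_self u)
  · intro h v hv
    obtain ⟨c, rfl⟩ := Submodule.mem_span_singleton.1 hv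
    rw [Matrix.mulVec_smul, smul_dotProduct, dotProduct_smul, h, smul_zero, smul_zero]

theorem Camera.sees_mk_iff (P : Camera) {u : Fin 4 → ℂ} (hu : u ≠ 0) {w : Fin 3 → ℂ}
    (hw : w ≠ 0) :
    P.Sees (Projectivization.mk ℂ u hu) (Projectivization.mk ℂ w hw) ↔
      ∃ c : ℂ, c • w = P.toLin u := by
  rw [Camera.Sees, Projectivization.submodule_mk, Projectivization.submodule_mk,
    Submodule.map_span, Set.image_singleton, Submodule.span_singleton_le_iff_mem,
    Submodule.mem_span_singleton]

/-- Two points have a common image in a view if and only if their images are linearly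
dependent. -/
theorem exists_common_image_iff (P Q : Camera) {u v : Fin 4 → ℂ} (hu : u ≠ 0) (hv : v ≠ 0) :
    (∃ z, P.Sees (Projectivization.mk ℂ u hu) z ∧ Q.Sees (Projectivization.mk ℂ v hv) z) ↔
      ∃ s t : ℂ, (s ≠ 0 ∨ t ≠ 0) ∧ s • P.toLin u = t • Q.toLin v := by
  constructor
  · rintro ⟨z, h1, h2⟩
    induction z using Projectivization.ind with
    | h w hw =>
      obtain ⟨c, hc⟩ := (P.sees_mk_iff hu hw).1 h1
      obtain ⟨d, hd⟩ := (Q.sees_mk_iff hv hw).1 h2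
      by_cases h : c = 0
      · refine ⟨1, 0, Or.inl one_ne_zero, ?_⟩
        simp [← hc, h]
      · refine ⟨d, c, Or.inr h, ?_⟩
        rw [← hc, ← hd, smul_smul, smul_smul, mul_comm]
  · rintro ⟨s, t, hst, h⟩
    have key : ∃ w : Fin 3 → ℂ, w ≠ 0 ∧ (∃ c : ℂ, c • w = P.toLin u) ∧
        ∃ c : ℂ, c • w = Q.toLin v := by
      by_cases hP : P.toLin u = 0
      · by_cases hQ : Q.toLin v = 0
        · exact ⟨1, one_ne_zero, ⟨0, by simp [hP]⟩, ⟨0, by simp [hQ]⟩⟩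
        · exact ⟨Q.toLin v, hQ, ⟨0, by simp [hP]⟩, ⟨1, by simp⟩⟩
      · by_cases ht : t = 0
        · have hs : s ≠ 0 := by simpa [ht] using hst
          rw [ht, zero_smul, smul_eq_zero] at h
          exact absurd h (by tauto)
        · refine ⟨P.toLin u, hP, ⟨1, by simp⟩, ⟨t⁻¹ * s, ?_⟩⟩
          rw [mul_smul, h, inv_smul_smul₀ ht]
    obtain ⟨w, hw, h1, h2⟩ := key
    exact ⟨_, (P.sees_mk_iff hu hw).2 h1, (Q.sees_mk_iff hv hw).2 h2⟩

theorem mk_mem_criticalPoints {n : ℕ} (P Q : Fin n → Camera) {u : Fin 4 → ℂ} (hu : u ≠ 0) :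
    Projectivization.mk ℂ u hu ∈ criticalPoints P Q ↔
      ∃ v : Fin 4 → ℂ, v ≠ 0 ∧ ∀ i, ∃ s t : ℂ, (s ≠ 0 ∨ t ≠ 0) ∧
        s • (P i).toLin u = t • (Q i).toLin v := by
  constructor
  · rintro ⟨y, z, h⟩
    induction y using Projectivization.ind with
    | h v hv => exact ⟨v, hv, fun i => (exists_common_image_iff _ _ hu hv).1 ⟨z i, h i⟩⟩
  · rintro ⟨v, hv, h⟩
    choose z hz using fun i => (exists_common_image_iff _ _ hu hv).2 (h i)
    exact ⟨_, z, hz⟩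

theorem Camera.center_eq_mk_iff (P : Camera) {u : Fin 4 → ℂ} (hu : u ≠ 0) :
    P.center = Projectivization.mk ℂ u hu ↔ P.toLin u = 0 := by
  rw [← Projectivization.submodule_injective.eq_iff, Camera.center,
    Projectivization.submodule_mk'', Projectivization.submodule_mk]
  constructor
  · intro h
    rw [← LinearMap.mem_ker, h]
    exact Submodule.mem_span_singleton_self u
  · intro h
    symm
    apply Submodule.eq_of_le_of_finrank_eq
    · rwa [Submodule.span_singleton_le_iff_mem, LinearMap.mem_ker]
    · rw [P.finrank_ker, finrank_span_singleton hu]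

theorem Camera.exists_smul_of_toLin_eq_zero (P : Camera) {u v : Fin 4 → ℂ} (hu : u ≠ 0)
    (h : P.toLin u = 0) (hv : P.toLin v = 0) : ∃ c : ℂ, v = c • u := by
  by_cases hv0 : v = 0
  · exact ⟨0, by simp [hv0]⟩
  · have := ((P.center_eq_mk_iff hv0).2 hv).symm.trans ((P.center_eq_mk_iff hu).2 h)
    rw [Projectivization.mk_eq_mk_iff'] at this
    obtain ⟨c, hc⟩ := this
    exact ⟨c, hc.symm⟩

/-- The center of a camera is a real point. -/
theorem Camera.exists_real_center (P : Camera) :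
    ∃ k : Fin 4 → ℝ, k ≠ 0 ∧ P.mat *ᵥ k = 0 := by
  have h := P.mat.mulVecLin.finrank_range_add_finrank_ker
  have h3 : Module.finrank ℝ (LinearMap.range P.mat.mulVecLin) = 3 := P.rank_eq
  simp only [h3, Module.finrank_fintype_fun_eq_card, Fintype.card_fin] at h
  have hne : LinearMap.ker P.mat.mulVecLin ≠ ⊥ := by
    intro h0
    rw [h0] at h
    simp at h
  obtain ⟨k, hk, hk0⟩ := Submodule.exists_mem_ne_zero_of_ne_bot hne
  exact ⟨k, hk0, by simpa using hk⟩

/-! ### Fundamental matrices and the epipolar constraint -/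

/-- The `6 × 6` matrix with block rows `(A, x, 0)` and `(B, 0, y)`. -/
def viewBlock {R : Type*} [CommRing R] (A B : Matrix (Fin 3) (Fin 4) R) (x y : Fin 3 → R) :
    Matrix (Fin 6) (Fin 6) R :=
  (Matrix.fromBlocks A (Matrix.of fun a => ![x a, 0])
    B (Matrix.of fun a => ![0, y a])).submatrix
    (finSumFinEquiv (m := 3) (n := 3)).symm (finSumFinEquiv (m := 4) (n := 2)).symm

section viewBlock
variable {R : Type*} [CommRing R] (A B : Matrix (Fin 3) (Fin 4) R)

/-- The vector `x` occupies a single column of the block matrix; this is what makes the determinant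
linear in `x`. -/
theorem viewBlock_eq_updateCol_left (x y : Fin 3 → R) :
    viewBlock A B x y = (viewBlock A B 0 y).updateCol
      (finSumFinEquiv (m := 4) (n := 2) (.inr 0))
      (fun i => Sum.elim x (fun _ => 0) ((finSumFinEquiv (m := 3) (n := 3)).symm i)) := by
  ext i j
  obtain ⟨i, rfl⟩ := (finSumFinEquiv (m := 3) (n := 3)).surjective i
  obtain ⟨j, rfl⟩ := (finSumFinEquiv (m := 4) (n := 2)).surjective j
  rcases i with i | i <;> rcases j with j | j <;> fin_cases j <;>
    simp [viewBlock]

theorem viewBlock_eq_updateCol_right (x y : Fin 3 → R) :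
    viewBlock A B x y = (viewBlock A B x 0).updateCol
      (finSumFinEquiv (m := 4) (n := 2) (.inr 1))
      (fun i => Sum.elim (fun _ => 0) y ((finSumFinEquiv (m := 3) (n := 3)).symm i)) := by
  ext i j
  obtain ⟨i, rfl⟩ := (finSumFinEquiv (m := 3) (n := 3)).surjective i
  obtain ⟨j, rfl⟩ := (finSumFinEquiv (m := 4) (n := 2)).surjective j
  rcases i with i | i <;> rcases j with j | j <;> fin_cases j <;>
    simp [viewBlock]

/-- The determinant of `viewBlock` as a bilinear form. -/
def viewForm : (Fin 3 → R) →ₗ[R] (Fin 3 → R) →ₗ[R] R :=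
  LinearMap.mk₂ R (fun x y => (viewBlock A B x y).det)
    (fun x x' y => by
      rw [viewBlock_eq_updateCol_left A B (x + x'), viewBlock_eq_updateCol_left A B x,
        viewBlock_eq_updateCol_left A B x', ← Matrix.det_updateCol_add]
      congr 2; ext i
      have h : ∀ j : Fin 3 ⊕ Fin 3, Sum.elim (x + x') (fun _ => 0) j =
          Sum.elim x (fun _ => 0) j + Sum.elim x' (fun _ => 0) j := by
        rintro (j | j) <;> simp
      exact h _)
    (fun c x y => by
      rw [viewBlock_eq_updateCol_left A B (c • x), viewBlock_eq_updateCol_left A B x,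
        smul_eq_mul, ← Matrix.det_updateCol_smul]
      congr 2; ext i
      have h : ∀ j : Fin 3 ⊕ Fin 3, Sum.elim (c • x) (fun _ => 0) j =
          c • Sum.elim x (fun _ => 0) j := by
        rintro (j | j) <;> simp
      exact h _)
    (fun x y y' => by
      rw [viewBlock_eq_updateCol_right A B x (y + y'), viewBlock_eq_updateCol_right A B x y,
        viewBlock_eq_updateCol_right A B x y', ← Matrix.det_updateCol_add]
      congr 2; ext i
      have h : ∀ j : Fin 3 ⊕ Fin 3, Sum.elim (fun _ => 0) (y + y') j =
          Sum.elim (fun _ => 0) y j + Sum.elim (fun _ => 0) y' j := by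
        rintro (j | j) <;> simp
      exact h _)
    (fun c x y => by
      rw [viewBlock_eq_updateCol_right A B x (c • y), viewBlock_eq_updateCol_right A B x y,
        smul_eq_mul, ← Matrix.det_updateCol_smul]
      congr 2; ext i
      have h : ∀ j : Fin 3 ⊕ Fin 3, Sum.elim (fun _ => 0) (c • y) j =
          c • Sum.elim (fun _ => 0) y j := by
        rintro (j | j) <;> simp
      exact h _)

theorem viewForm_apply (x y : Fin 3 → R) : viewForm A B x y = (viewBlock A B x y).det := rfl

theorem viewForm_eq_sum (x y : Fin 3 → R) :
    viewForm A B x y =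
      ∑ a, ∑ b, x a * y b * (viewBlock A B (Pi.single a 1) (Pi.single b 1)).det := by
  have hx : x = ∑ a, x a • (Pi.single a 1 : Fin 3 → R) := by
    simpa using (pi_eq_sum_univ' x)
  have hy : y = ∑ a, y a • (Pi.single a 1 : Fin 3 → R) := by
    simpa using (pi_eq_sum_univ' y)
  conv_lhs => rw [hx, hy]
  simp only [map_sum, LinearMap.sum_apply, map_smul, LinearMap.smul_apply, smul_eq_mul,
    viewForm_apply, Finset.mul_sum]
  rw [Finset.sum_comm]
  refine Finset.sum_congr rfl fun a _ => Finset.sum_congr rfl fun b _ => by ring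

/-- A kernel vector `(w, s, t)` is a space point `w` whose two images are `-s x` and `-t y`; hence
the determinant vanishes exactly when the rays meet. -/
theorem viewBlock_mulVec (x y : Fin 3 → R) (w : Fin 4 → R) (s t : R) :
    viewBlock A B x y *ᵥ (Sum.elim w ![s, t] ∘ (finSumFinEquiv (m := 4) (n := 2)).symm) =
      Sum.elim (A *ᵥ w + s • x) (B *ᵥ w + t • y) ∘ (finSumFinEquiv (m := 3) (n := 3)).symm := by
  rw [viewBlock, Matrix.submatrix_mulVec_equiv]
  congr 1
  rw [Equiv.symm_symm, Function.comp_assoc, Equiv.symm_comp_self, Function.comp_id,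
    Matrix.fromBlocks_mulVec]
  congr 1 <;> ext i <;> simp [Matrix.mulVec, dotProduct, Fin.sum_univ_succ, mul_comm s, mul_comm t]

end viewBlock

/-- The entries are real determinants at unit vectors; bilinearity carries the defining identity
over to complex image points. -/
theorem map_fundamentalMatrix_bilin (P P' : Camera) (x y : Fin 3 → ℂ) :
    x ⬝ᵥ ((fundamentalMatrix P P').map (algebraMap ℝ ℂ) *ᵥ y) =
      (viewBlock (P.mat.map (algebraMap ℝ ℂ)) (P'.mat.map (algebraMap ℝ ℂ)) x y).det := by
  rw [← viewForm_apply, viewForm_eq_sum]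
  simp only [dotProduct, Matrix.mulVec, Finset.mul_sum]
  refine Finset.sum_congr rfl fun a _ => Finset.sum_congr rfl fun b _ => ?_
  have : algebraMap ℝ ℂ (fundamentalMatrix P P' a b) =
      (viewBlock (P.mat.map (algebraMap ℝ ℂ)) (P'.mat.map (algebraMap ℝ ℂ))
        (Pi.single a 1) (Pi.single b 1)).det := by
    rw [fundamentalMatrix, Matrix.of_apply, RingHom.map_det]
    congr 1
    ext i j
    obtain ⟨i, rfl⟩ := (finSumFinEquiv (m := 3) (n := 3)).surjective i
    obtain ⟨j, rfl⟩ := (finSumFinEquiv (m := 4) (n := 2)).surjective j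
    rcases i with i | i <;> rcases j with j | j <;> fin_cases j <;>
      simp [viewBlock, fundamentalBlock, Pi.single_apply, apply_ite]
  rw [Matrix.map_apply, this]
  ring

/-- The epipolar constraint: `xᵀ F y = 0` if and only if the rays of `x` and `y` meet. -/
theorem fundamentalMatrix_bilin_eq_zero_iff (P P' : Camera) (x y : Fin 3 → ℂ) :
    x ⬝ᵥ ((fundamentalMatrix P P').map (algebraMap ℝ ℂ) *ᵥ y) = 0 ↔
      ∃ (w : Fin 4 → ℂ) (s t : ℂ), (w ≠ 0 ∨ s ≠ 0 ∨ t ≠ 0) ∧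
        P.toLin w = s • x ∧ P'.toLin w = t • y := by
  rw [map_fundamentalMatrix_bilin, ← Matrix.exists_mulVec_eq_zero_iff]
  constructor
  · rintro ⟨v, hv, h⟩
    obtain ⟨w, s, t, rfl⟩ : ∃ (w : Fin 4 → ℂ) (s t : ℂ),
        v = Sum.elim w ![s, t] ∘ (finSumFinEquiv (m := 4) (n := 2)).symm := by
      refine ⟨fun a => v (finSumFinEquiv (m := 4) (n := 2) (.inl a)), v (finSumFinEquiv (m := 4) (n := 2) (.inr 0)),
        v (finSumFinEquiv (m := 4) (n := 2) (.inr 1)), ?_⟩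
      ext j
      obtain ⟨j, rfl⟩ := (finSumFinEquiv (m := 4) (n := 2)).surjective j
      rcases j with j | j
      · simp
      · fin_cases j <;> simp
    rw [viewBlock_mulVec] at h
    have h1 : ∀ j, Sum.elim (P.mat.map (algebraMap ℝ ℂ) *ᵥ w + s • x)
        (P'.mat.map (algebraMap ℝ ℂ) *ᵥ w + t • y) j = 0 := fun j => by
      simpa using congrFun h (finSumFinEquiv (m := 3) (n := 3) j)
    refine ⟨w, -s, -t, ?_, ?_, ?_⟩
    · by_contra! hc
      obtain ⟨rfl, hs, ht⟩ := hc
      rw [neg_eq_zero] at hs ht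
      subst hs ht
      apply hv
      ext j
      obtain ⟨j, rfl⟩ := (finSumFinEquiv (m := 4) (n := 2)).surjective j
      rcases j with j | j
      · simp
      · fin_cases j <;> simp
    · rw [neg_smul, eq_neg_iff_add_eq_zero]
      exact funext fun a => h1 (.inl a)
    · rw [neg_smul, eq_neg_iff_add_eq_zero]
      exact funext fun a => h1 (.inr a)
  · rintro ⟨w, s, t, hne, h1, h2⟩
    refine ⟨Sum.elim w ![-s, -t] ∘ (finSumFinEquiv (m := 4) (n := 2)).symm, ?_, ?_⟩
    · intro h
      have h0 : ∀ j, Sum.elim w ![-s, -t] j = 0 := fun j => by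
        simpa using congrFun h (finSumFinEquiv (m := 4) (n := 2) j)
      rcases hne with hw | hs | ht
      · exact hw (funext fun a => h0 (.inl a))
      · exact hs (by simpa using h0 (.inr 0))
      · exact ht (by simpa using h0 (.inr 1))
    · rw [viewBlock_mulVec, ← P.toLin_apply, ← P'.toLin_apply, h1, h2]
      ext j
      simp only [Function.comp]
      rcases (finSumFinEquiv (m := 3) (n := 3)).symm j with j | j <;> simp

theorem mk_mem_viewQuadric {n : ℕ} (P Q : Fin n → Camera) (i j : Fin n) {u : Fin 4 → ℂ}
    (hu : u ≠ 0) :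
    Projectivization.mk ℂ u hu ∈ viewQuadric P Q i j ↔
      ∃ (w : Fin 4 → ℂ) (s t : ℂ), (w ≠ 0 ∨ s ≠ 0 ∨ t ≠ 0) ∧
        (Q i).toLin w = s • (P i).toLin u ∧ (Q j).toLin w = t • (P j).toLin u := by
  rw [viewQuadric, mk_mem_quadricLocus, ← fundamentalMatrix_bilin_eq_zero_iff]
  rw [Matrix.map_mul, Matrix.map_mul, ← Matrix.mulVec_mulVec, ← Matrix.mulVec_mulVec,
    Matrix.transpose_map, Matrix.dotProduct_mulVec, Matrix.vecMul_transpose]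
  rfl

/-! ### The cross product relation between two conics -/

section crossProduct
variable {F : Type*} [Field F]

theorem exists_eq_smul_of_crossProduct_eq_zero {x y : Fin 3 → F} (hx : x ≠ 0)
    (h : x ⨯₃ y = 0) : ∃ c : F, y = c • x := by
  have h0 := congrFun h 0
  have h1 := congrFun h 1
  have h2 := congrFun h 2
  simp only [cross_apply, Matrix.cons_val, Pi.zero_apply] at h0 h1 h2
  obtain ⟨j, hj⟩ := Function.ne_iff.1 hx
  refine ⟨y j / x j, ?_⟩
  ext k
  simp only [Pi.smul_apply, smul_eq_mul, Pi.zero_apply] at hj ⊢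
  rw [div_mul_eq_mul_div, eq_div_iff hj]
  fin_cases j <;> fin_cases k <;> simp only [Fin.zero_eta, Fin.mk_one, Fin.reduceFinMk] <;>
    first | ring1 | linear_combination h0 | linear_combination -h0 | linear_combination h1 |
      linear_combination -h1 | linear_combination h2 | linear_combination -h2

/-- The relation `x × y = ε m(y) K x` pairs the points `x` of the conic `xᵀ K x = 0` with points
`y`. -/
theorem exists_crossProduct_eq_left (K : Matrix (Fin 3) (Fin 3) F) (m x : Fin 3 → F) (ε : F)
    (hx : x ⬝ᵥ (K *ᵥ x) = 0) :
    ∃ y : Fin 3 → F, y ≠ 0 ∧ x ⨯₃ y = (ε * (m ⬝ᵥ y)) • (K *ᵥ x) := by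
  -- For fixed `x` the relation is linear in `y`; its determinant is `-ε (m·x)(xᵀKx)`.
  obtain ⟨y, hy, h⟩ := Matrix.exists_mulVec_eq_zero_iff.2
    (show (!![0, -x 2, x 1; x 2, 0, -x 0; -x 1, x 0, 0] -
      ε • Matrix.vecMulVec (K *ᵥ x) m).det = 0 by
      generalize K *ᵥ x = k at hx
      simp only [Matrix.vec3_dotProduct] at hx
      simp [Matrix.det_fin_three, Matrix.vecMulVec_apply]
      linear_combination (-ε * (m 0 * x 0 + m 1 * x 1 + m 2 * x 2)) * hx)
  refine ⟨y, hy, ?_⟩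
  rw [Matrix.sub_mulVec, Matrix.smul_mulVec, Matrix.vecMulVec_mulVec, sub_eq_zero] at h
  rw [mul_smul]
  convert h using 1
  · ext j
    fin_cases j <;> simp [cross_apply, Matrix.mulVec, dotProduct, Fin.sum_univ_three] <;> ring
  · simp

theorem exists_crossProduct_eq_right (K : Matrix (Fin 3) (Fin 3) F) (hK : K.IsSymm)
    (m y : Fin 3 → F) (ε : F)
    (hy : y ⬝ᵥ (K *ᵥ y) + ε ^ 2 * K.det * (m ⬝ᵥ y) ^ 2 = 0) :
    ∃ x : Fin 3 → F, x ≠ 0 ∧ x ⨯₃ y = (ε * (m ⬝ᵥ y)) • (K *ᵥ x) := by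
  -- For fixed `y` the relation is linear in `x`: a skew matrix minus `ε m(y) K`. Its determinant is
  -- `-ε m(y)` times the equation of the second conic.
  obtain ⟨x, hx, h⟩ := Matrix.exists_mulVec_eq_zero_iff.2
    (show (!![0, y 2, -y 1; -y 2, 0, y 0; y 1, -y 0, 0] - (ε * (m ⬝ᵥ y)) • K).det = 0 by
      generalize m ⬝ᵥ y = μ at hy ⊢
      simp only [Matrix.vec3_dotProduct, Matrix.mulVec, Matrix.det_fin_three, hK.apply 0 1,
        hK.apply 0 2, hK.apply 1 2] at hy
      simp [Matrix.det_fin_three, hK.apply 0 1, hK.apply 0 2, hK.apply 1 2]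
      linear_combination (-ε * μ) * hy)
  refine ⟨x, hx, ?_⟩
  rw [Matrix.sub_mulVec, Matrix.smul_mulVec, sub_eq_zero] at h
  convert h using 1
  ext j
  fin_cases j <;> simp [cross_apply, Matrix.mulVec, dotProduct, Fin.sum_univ_three] <;> ring

/-- The nonzero vector `x` makes the determinant of the linear system vanish, and for `m(y) ≠ 0`
that determinant is a nonzero multiple of the second conic. If `m(y) = 0`, then `y` is a multiple of
`x`, where both conics agree. -/
theorem conic_of_crossProduct_eq_left (K : Matrix (Fin 3) (Fin 3) F) (hK : K.IsSymm)
    {m x y : Fin 3 → F} {ε : F} (hε : ε ≠ 0) (hx : x ≠ 0) (hxK : x ⬝ᵥ (K *ᵥ x) = 0)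
    (h : x ⨯₃ y = (ε * (m ⬝ᵥ y)) • (K *ᵥ x)) :
    y ⬝ᵥ (K *ᵥ y) + ε ^ 2 * K.det * (m ⬝ᵥ y) ^ 2 = 0 := by
  by_cases hm : m ⬝ᵥ y = 0
  · rw [hm, mul_zero, zero_smul] at h
    obtain ⟨c, rfl⟩ := exists_eq_smul_of_crossProduct_eq_zero hx h
    rw [hm, Matrix.mulVec_smul, smul_dotProduct, dotProduct_smul, hxK]
    simp
  · have hdet : (!![0, y 2, -y 1; -y 2, 0, y 0; y 1, -y 0, 0] - (ε * (m ⬝ᵥ y)) • K).det = 0 := by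
      refine Matrix.exists_mulVec_eq_zero_iff.1 ⟨x, hx, ?_⟩
      rw [Matrix.sub_mulVec, Matrix.smul_mulVec, sub_eq_zero, ← h]
      ext j
      fin_cases j <;> simp [cross_apply, Matrix.mulVec, dotProduct, Fin.sum_univ_three] <;> ring
    have h2 : -(ε * (m ⬝ᵥ y)) *
        (y ⬝ᵥ (K *ᵥ y) + ε ^ 2 * K.det * (m ⬝ᵥ y) ^ 2) = 0 := by
      rw [← hdet]
      generalize m ⬝ᵥ y = μ
      simp [Matrix.vec3_dotProduct, Matrix.mulVec, Matrix.det_fin_three, hK.apply 0 1,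
        hK.apply 0 2, hK.apply 1 2]
      ring
    exact (mul_eq_zero.1 h2).resolve_left (neg_ne_zero.2 (mul_ne_zero hε hm))

theorem conic_of_crossProduct_eq_right (K : Matrix (Fin 3) (Fin 3) F)
    {m x y : Fin 3 → F} {ε : F} (hε : ε ≠ 0) (hy : y ≠ 0)
    (hyK : y ⬝ᵥ (K *ᵥ y) + ε ^ 2 * K.det * (m ⬝ᵥ y) ^ 2 = 0)
    (h : x ⨯₃ y = (ε * (m ⬝ᵥ y)) • (K *ᵥ x)) :
    x ⬝ᵥ (K *ᵥ x) = 0 := by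
  by_cases hm : m ⬝ᵥ y = 0
  · rw [hm, mul_zero, zero_smul, ← cross_anticomm, neg_eq_zero] at h
    obtain ⟨c, rfl⟩ := exists_eq_smul_of_crossProduct_eq_zero hy h
    rw [hm] at hyK
    rw [Matrix.mulVec_smul, smul_dotProduct, dotProduct_smul]
    simp_all
  · have h2 := congrArg (x ⬝ᵥ ·) h
    simp only [dot_self_cross, dotProduct_smul, smul_eq_mul] at h2
    simpa [hm, hε] using h2.symm

theorem dotProduct_mulVec_comm {K : Matrix (Fin 3) (Fin 3) F} (hK : K.IsSymm)
    (x y : Fin 3 → F) : x ⬝ᵥ (K *ᵥ y) = y ⬝ᵥ (K *ᵥ x) := by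
  rw [Matrix.dotProduct_mulVec, ← Matrix.mulVec_transpose, hK.eq, dotProduct_comm]

/-- The determinant of the three vectors is `ε m(y) (cᵀKx - xᵀKc)`, which is zero by symmetry of
`K`. Geometrically, projection from `c` identifies `x` with the twisted point `y + ε m(y) w`. -/
theorem exists_dependence_of_crossProduct_eq (K : Matrix (Fin 3) (Fin 3) F) (hK : K.IsSymm)
    {m c w x y : Fin 3 → F} {ε : F} (hcw : c ⨯₃ w = K *ᵥ c)
    (h : x ⨯₃ y = (ε * (m ⬝ᵥ y)) • (K *ᵥ x)) :
    ∃ α β γ : F, (α ≠ 0 ∨ β ≠ 0 ∨ γ ≠ 0) ∧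
      α • c + β • x + γ • (y + (ε * (m ⬝ᵥ y)) • w) = 0 := by
  have hdet : (Matrix.of ![c, x, y + (ε * (m ⬝ᵥ y)) • w]).det = 0 := by
    have h1 : c ⬝ᵥ (x ⨯₃ (y + (ε * (m ⬝ᵥ y)) • w)) = 0 := by
      rw [map_add, map_smul, h, dotProduct_add, dotProduct_smul, dotProduct_smul,
        triple_product_permutation, ← cross_anticomm, dotProduct_neg, hcw,
        dotProduct_mulVec_comm hK c x]
      simp
    rw [triple_product_eq_det] at h1
    exact h1
  obtain ⟨v, hv, h0⟩ := Matrix.exists_vecMul_eq_zero_iff.2 hdet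
  refine ⟨v 0, v 1, v 2, ?_, ?_⟩
  · by_contra! hc
    exact hv (by ext j; fin_cases j <;> simp [hc])
  · rw [Matrix.vecMul_eq_sum, Fin.sum_univ_three] at h0
    exact h0

/-- A nondegenerate conic contains no line. For any `z` the Gram matrix of `z, c, d` has a zero 2×2
block, hence determinant zero; as it equals `det(z,c,d)² det K`, the vectors `z, c, d` are
dependent. -/
theorem crossProduct_eq_zero_of_isotropic {K : Matrix (Fin 3) (Fin 3) F} (hK : K.IsSymm)
    (hdet : K.det ≠ 0) {c d : Fin 3 → F} (hc : c ⬝ᵥ (K *ᵥ c) = 0) (hd : d ⬝ᵥ (K *ᵥ d) = 0)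
    (hcd : c ⬝ᵥ (K *ᵥ d) = 0) : c ⨯₃ d = 0 := by
  have hdc : d ⬝ᵥ (K *ᵥ c) = 0 := by rw [dotProduct_mulVec_comm hK, hcd]
  have key : ∀ z : Fin 3 → F, z ⬝ᵥ (c ⨯₃ d) = 0 := fun z => by
    have h1 : (Matrix.of ![z, c, d] * K * (Matrix.of ![z, c, d])ᵀ).det = 0 := by
      have h2 : ∀ i j, (Matrix.of ![z, c, d] * K * (Matrix.of ![z, c, d])ᵀ) i j =
          (![z, c, d] i) ⬝ᵥ (K *ᵥ (![z, c, d] j)) := fun i j => by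
        rw [Matrix.mul_assoc, Matrix.mul_apply_eq_vecMul, Matrix.dotProduct_mulVec]
        rw [← Matrix.vecMul_vecMul]
        rfl
      rw [Matrix.det_fin_three]
      simp only [h2]
      simp [hc, hd, hcd, hdc]
    rw [Matrix.det_mul, Matrix.det_mul, Matrix.det_transpose] at h1
    rw [triple_product_eq_det]
    have h3 : (Matrix.of ![z, c, d]).det = 0 := by
      by_contra h
      exact mul_ne_zero (mul_ne_zero h hdet) h h1
    exact h3
  ext j
  simpa using key (Pi.single j 1)

end crossProduct

/-! ### Tangents, plane coordinates and twisted cameras -/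

/-- On a real conic, the tangent vector `w` at a point `c`, normalized by `c × w = K c`. -/
theorem exists_crossProduct_eq_mulVec (K : Matrix (Fin 3) (Fin 3) ℝ) {c : Fin 3 → ℝ} (hc : c ≠ 0)
    (h : c ⬝ᵥ (K *ᵥ c) = 0) : ∃ w : Fin 3 → ℝ, c ⨯₃ w = K *ᵥ c := by
  have hcc : c ⬝ᵥ c ≠ 0 := fun h0 => hc (dotProduct_self_eq_zero.1 h0)
  -- Since `K c` is orthogonal to `c`, the double product `c × (Kc × c)` is `(c·c) K c`. Reality of
  -- `c` is what makes `c·c` nonzero.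
  refine ⟨(c ⬝ᵥ c)⁻¹ • ((K *ᵥ c) ⨯₃ c), ?_⟩
  rw [map_smul, inv_smul_eq_iff₀ hcc]
  generalize K *ᵥ c = k at h
  simp only [Matrix.vec3_dotProduct] at h
  ext j
  fin_cases j <;> simp [cross_apply, Matrix.vec3_dotProduct]
  · linear_combination (-c 0) * h
  · linear_combination (-c 1) * h
  · linear_combination (-c 2) * h

/-- Coordinates on the plane `l = 0`. -/
theorem exists_plane_coordinates {l : Fin 4 → ℝ} (hl : l ≠ 0) :
    ∃ (E : Matrix (Fin 4) (Fin 3) ℝ) (L : Matrix (Fin 3) (Fin 4) ℝ) (z : Fin 4 → ℝ),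
      E * L + Matrix.vecMulVec z l = 1 ∧ L * E = 1 ∧ l ᵥ* E = 0 := by
  obtain ⟨k, hk⟩ := Function.ne_iff.1 hl
  simp only [Pi.zero_apply] at hk
  set z : Fin 4 → ℝ := Pi.single k (l k)⁻¹ with hz
  have hlz : l ⬝ᵥ z = 1 := by simp [hz, hk]
  set L : Matrix (Fin 3) (Fin 4) ℝ := (1 : Matrix (Fin 4) (Fin 4) ℝ).submatrix k.succAbove id
    with hL
  have hLz : L *ᵥ z = 0 := by
    ext j
    simp [hL, hz, Matrix.mulVec, Matrix.one_apply]
  have hLL : L * Lᵀ = 1 := by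
    ext i j
    simp [hL, Matrix.mul_apply, Matrix.one_apply]
  have hLL' : Lᵀ * L + Matrix.vecMulVec z (Pi.single k (l k)) = 1 := by
    ext i j
    rw [Matrix.add_apply, Matrix.mul_apply, Matrix.vecMulVec_apply]
    rcases Fin.eq_self_or_eq_succAbove k i with rfl | ⟨i, rfl⟩
    · by_cases hij : i = j
      · subst hij
        simp [hL, hz, hk]
      · simp [hL, hz, Matrix.one_apply, hij, Ne.symm hij]
    · rcases Fin.eq_self_or_eq_succAbove k j with rfl | ⟨j, rfl⟩ <;>
        simp [hL, hz, Matrix.one_apply, eq_comm]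
  refine ⟨(1 - Matrix.vecMulVec z l) * Lᵀ, L, z, ?_, ?_, ?_⟩
  · rw [Matrix.mul_assoc, eq_sub_of_add_eq hLL', Matrix.sub_mul, Matrix.mul_sub,
      Matrix.mul_sub, Matrix.vecMulVec_mul_vecMulVec]
    simp [hlz]
  · rw [← Matrix.mul_assoc, Matrix.mul_sub, Matrix.mul_one, Matrix.mul_vecMulVec, hLz]
    simp [hLL]
  · rw [← Matrix.vecMul_vecMul, Matrix.vecMul_sub, Matrix.vecMul_one, Matrix.vecMul_vecMulVec]
    simp [hlz]

/-- The camera `P (1 + w mᵀ)`, which agrees with `P` on the plane `m = 0`. -/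
def Camera.twist (P : Camera) (w m : Fin 4 → ℝ) (h : 1 + m ⬝ᵥ w ≠ 0) : Camera where
  mat := P.mat * (1 + Matrix.vecMulVec w m)
  rank_eq := by
    rw [Matrix.rank_mul_eq_left_of_isUnit_det, P.rank_eq]
    rw [isUnit_iff_ne_zero]
    intro h0
    obtain ⟨v, hv, hv0⟩ := Matrix.exists_mulVec_eq_zero_iff.2 h0
    rw [Matrix.add_mulVec, Matrix.one_mulVec, Matrix.vecMulVec_mulVec, op_smul_eq_smul] at hv0
    have h1 : (1 + m ⬝ᵥ w) * (m ⬝ᵥ v) = 0 := by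
      have := congrArg (m ⬝ᵥ ·) hv0
      simp only [dotProduct_add, dotProduct_smul, smul_eq_mul, dotProduct_zero] at this
      linear_combination this
    rw [(mul_eq_zero.1 h1).resolve_left h, zero_smul, add_zero] at hv0
    exact hv hv0

theorem Camera.twist_toLin (P : Camera) (w m : Fin 4 → ℝ) (h : 1 + m ⬝ᵥ w ≠ 0)
    (v : Fin 4 → ℂ) : (P.twist w m h).toLin v =
      P.toLin (v + (complexify m ⬝ᵥ v) • complexify w) := by
  rw [Camera.toLin_apply, Camera.toLin_apply]
  have h1 : (1 + Matrix.vecMulVec w m).map (algebraMap ℝ ℂ) =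
      1 + Matrix.vecMulVec (complexify w) (complexify m) := by
    ext i j
    simp [Matrix.vecMulVec_apply, complexify, Matrix.one_apply, apply_ite]
  simp only [Camera.twist]
  rw [Matrix.map_mul, h1, ← Matrix.mulVec_mulVec, Matrix.add_mulVec, Matrix.one_mulVec,
    Matrix.vecMulVec_mulVec, op_smul_eq_smul]

/-! ### Criteria for conjugacy -/

theorem fundamentalMatrix_not_proportional {P P' Q Q' : Camera} {x y : Fin 3 → ℂ}
    (hP : ∃ (w : Fin 4 → ℂ) (s t : ℂ), (w ≠ 0 ∨ s ≠ 0 ∨ t ≠ 0) ∧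
        P.toLin w = s • x ∧ P'.toLin w = t • y)
    (hQ : ¬ ∃ (w : Fin 4 → ℂ) (s t : ℂ), (w ≠ 0 ∨ s ≠ 0 ∨ t ≠ 0) ∧
        Q.toLin w = s • x ∧ Q'.toLin w = t • y) :
    ¬ ∃ c : ℝ, c ≠ 0 ∧ fundamentalMatrix Q Q' = c • fundamentalMatrix P P' := by
  rintro ⟨c, -, h⟩
  rw [← fundamentalMatrix_bilin_eq_zero_iff] at hP hQ
  apply hQ
  have : (fundamentalMatrix Q Q').map (algebraMap ℝ ℂ) =
      (c : ℂ) • (fundamentalMatrix P P').map (algebraMap ℝ ℂ) := by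
    ext i j
    simp [h]
  rw [this, Matrix.smul_mulVec, dotProduct_smul, hP, smul_zero]

/-- Equivalent tuples of cameras have the same epipolar constraints. -/
theorem not_equivalent_of_epipolar {n : ℕ} {P Q : Fin n → Camera} (i j : Fin n)
    {x y : Fin 3 → ℂ}
    (hP : ∃ (w : Fin 4 → ℂ) (s t : ℂ), (w ≠ 0 ∨ s ≠ 0 ∨ t ≠ 0) ∧
        (P i).toLin w = s • x ∧ (P j).toLin w = t • y)
    (hQ : ¬ ∃ (w : Fin 4 → ℂ) (s t : ℂ), (w ≠ 0 ∨ s ≠ 0 ∨ t ≠ 0) ∧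
        (Q i).toLin w = s • x ∧ (Q j).toLin w = t • y) (X Y : Set P3) :
    ¬ Equivalent P X Q Y := by
  rintro ⟨H, -, h⟩
  obtain ⟨c, hc, hi⟩ := h i
  obtain ⟨d, hd, hj⟩ := h j
  obtain ⟨w, s, t, hne, h1, h2⟩ := hP
  refine hQ ⟨H w, c⁻¹ * s, d⁻¹ * t, ?_, ?_, ?_⟩
  · simpa [hc, hd] using hne
  · rw [mul_smul, eq_inv_smul_iff₀ hc, ← LinearMap.smul_apply, ← hi, ← h1]
    simp
  · rw [mul_smul, eq_inv_smul_iff₀ hd, ← LinearMap.smul_apply, ← hj, ← h2]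
    simp

/-- One pair of image points that corresponds under `P` but not under `Q` excludes both proportional
fundamental matrices and a projective equivalence. The bound `2 ≤ n` supplies a pair of views for
the latter. -/
theorem isConjugate_of_epipolar {n : ℕ} (hn : 2 ≤ n) {P Q : Fin n → Camera}
    (h : ∀ i j, i ≠ j → ∃ x y : Fin 3 → ℂ,
      (∃ (w : Fin 4 → ℂ) (s t : ℂ), (w ≠ 0 ∨ s ≠ 0 ∨ t ≠ 0) ∧
        (P i).toLin w = s • x ∧ (P j).toLin w = t • y) ∧
      ¬ ∃ (w : Fin 4 → ℂ) (s t : ℂ), (w ≠ 0 ∨ s ≠ 0 ∨ t ≠ 0) ∧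
        (Q i).toLin w = s • x ∧ (Q j).toLin w = t • y) {X Y : Set P3}
    (hS : ∃ S, IsReconstruction P X S ∧ IsReconstruction Q Y S) :
    IsConjugate P X Q Y := by
  refine ⟨hS, ?_, fun i j hij => ?_⟩
  · obtain ⟨x, y, h1, h2⟩ := h ⟨0, by omega⟩ ⟨1, by omega⟩ (by simp)
    exact not_equivalent_of_epipolar _ _ h1 h2 X Y
  · obtain ⟨x, y, h1, h2⟩ := h i j hij
    exact fundamentalMatrix_not_proportional h1 h2

/-- The reconstructed set consists of all tuples that are simultaneously images of a point of `X`
and of a point of `Y`. -/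
theorem exists_common_reconstruction {n : ℕ} {P Q : Fin n → Camera} {X Y : Set P3}
    (h1 : ∀ x ∈ X, ∃ y ∈ Y, ∃ z : Fin n → P2, ∀ i, (P i).Sees x (z i) ∧ (Q i).Sees y (z i))
    (h2 : ∀ y ∈ Y, ∃ x ∈ X, ∃ z : Fin n → P2, ∀ i, (P i).Sees x (z i) ∧ (Q i).Sees y (z i)) :
    ∃ S, IsReconstruction P X S ∧ IsReconstruction Q Y S := by
  refine ⟨{z | ∃ x ∈ X, ∃ y ∈ Y, ∀ i, (P i).Sees x (z i) ∧ (Q i).Sees y (z i)},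
    ⟨fun x hx => ?_, ?_⟩, ⟨fun y hy => ?_, ?_⟩⟩
  · obtain ⟨y, hy, z, hz⟩ := h1 x hx
    exact ⟨z, ⟨x, hx, y, hy, hz⟩, fun i => (hz i).1⟩
  · rintro z ⟨x, hx, y, hy, hz⟩
    exact ⟨x, hx, fun i => (hz i).1⟩
  · obtain ⟨x, hx, z, hz⟩ := h2 y hy
    exact ⟨z, ⟨x, hx, y, hy, hz⟩, fun i => (hz i).2⟩
  · rintro z ⟨x, hx, y, hy, hz⟩
    exact ⟨y, hy, fun i => (hz i).2⟩

theorem exists_subset_common_reconstruction {n : ℕ} {P Q : Fin n → Camera} {X Y : Set P3}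
    (h1 : ∀ x ∈ X, ∃ y ∈ Y, ∃ z : Fin n → P2, ∀ i, (P i).Sees x (z i) ∧ (Q i).Sees y (z i)) :
    ∃ Y' ⊆ Y, ∃ S, IsReconstruction P X S ∧ IsReconstruction Q Y' S := by
  refine ⟨{y | y ∈ Y ∧ ∃ x ∈ X, ∃ z : Fin n → P2, ∀ i, (P i).Sees x (z i) ∧ (Q i).Sees y (z i)},
    fun y hy => hy.1, exists_common_reconstruction ?_ ?_⟩
  · intro x hx
    obtain ⟨y, hy, hz⟩ := h1 x hx
    exact ⟨y, ⟨hy, x, hx, hz⟩, hz⟩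
  · rintro y ⟨-, hy⟩
    exact hy

/-! ### Plane conics in coordinates and the choice of parameter -/

theorem mk_mem_carrier (T : PlaneConic) {u : Fin 4 → ℂ} (hu : u ≠ 0) :
    Projectivization.mk ℂ u hu ∈ T.carrier ↔ complexify T.m ⬝ᵥ u = 0 ∨
      (complexify T.l ⬝ᵥ u = 0 ∧ u ⬝ᵥ (T.K.map (algebraMap ℝ ℂ) *ᵥ u) = 0) := by
  rw [← mk_mem_quadricLocus hu, ← mk_mem_planeLocus hu, ← mk_mem_planeLocus hu]
  rfl

theorem mk_mem_conic (T : PlaneConic) {u : Fin 4 → ℂ} (hu : u ≠ 0) :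
    Projectivization.mk ℂ u hu ∈ T.conic ↔
      complexify T.l ⬝ᵥ u = 0 ∧ u ⬝ᵥ (T.K.map (algebraMap ℝ ℂ) *ᵥ u) = 0 := by
  rw [← mk_mem_quadricLocus hu, ← mk_mem_planeLocus hu]
  rfl

/-- A quadratic form that is nondegenerate on a plane does not vanish on it. -/
theorem exists_dotProduct_mulVec_ne_zero {K : Matrix (Fin 4) (Fin 4) ℝ} (hK : K.IsSymm)
    {l : Fin 4 → ℝ} {v : Fin 4 → ℝ} (hv : l ⬝ᵥ v = 0) {w : Fin 4 → ℝ} (hw : l ⬝ᵥ w = 0)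
    (h : w ⬝ᵥ (K *ᵥ v) ≠ 0) : ∃ v, l ⬝ᵥ v = 0 ∧ v ⬝ᵥ (K *ᵥ v) ≠ 0 := by
  by_contra! hc
  have h1 := hc (v + w) (by rw [dotProduct_add, hv, hw, add_zero])
  have h2 : v ⬝ᵥ (K *ᵥ w) = w ⬝ᵥ (K *ᵥ v) := by
    rw [Matrix.dotProduct_mulVec, ← Matrix.mulVec_transpose, hK.eq, dotProduct_comm]
  rw [Matrix.mulVec_add, dotProduct_add, add_dotProduct, add_dotProduct, hc v hv, hc w hw, h2] at h1
  apply h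
  linarith

/-- Two nonzero linear forms are nonzero at a common point. -/
theorem exists_dotProduct_ne_zero_and {l m : Fin 4 → ℝ} (hl : l ≠ 0) (hm : m ≠ 0) :
    ∃ x : Fin 4 → ℝ, l ⬝ᵥ x ≠ 0 ∧ m ⬝ᵥ x ≠ 0 := by
  have hll : l ⬝ᵥ l ≠ 0 := fun h0 => hl (dotProduct_self_eq_zero.1 h0)
  have hmm : m ⬝ᵥ m ≠ 0 := fun h0 => hm (dotProduct_self_eq_zero.1 h0)
  by_cases h1 : m ⬝ᵥ l = 0
  · exact ⟨l + m, by rw [dotProduct_add, dotProduct_comm l m, h1, add_zero]; exact hll,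
      by rw [dotProduct_add, h1, zero_add]; exact hmm⟩
  · exact ⟨l, hll, h1⟩

/-- A parameter for the twist that avoids finitely many degenerations. -/
theorem exists_generic_parameter {n : ℕ} (a : Fin n → ℝ) (b : ℝ) :
    ∃ ε : ℝ, ε ≠ 0 ∧ (∀ i, 1 + ε * a i ≠ 0) ∧ 1 + ε ^ 2 * b ≠ 0 := by
  -- Every condition holds at `ε = 0`, hence near it; the punctured neighbourhood filter adds `ε ≠
  -- 0`.
  have h1 : ∀ i, ∀ᶠ ε : ℝ in nhdsWithin 0 {0}ᶜ, 1 + ε * a i ≠ 0 := fun i => by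
    have hc : ContinuousAt (fun ε : ℝ => 1 + ε * a i) 0 := by fun_prop
    exact (hc.eventually_ne (by simp)).filter_mono nhdsWithin_le_nhds
  have h2 : ∀ᶠ ε : ℝ in nhdsWithin 0 {0}ᶜ, 1 + ε ^ 2 * b ≠ 0 := by
    have hc : ContinuousAt (fun ε : ℝ => 1 + ε ^ 2 * b) 0 := by fun_prop
    exact (hc.eventually_ne (by simp)).filter_mono nhdsWithin_le_nhds
  obtain ⟨ε, h⟩ := ((Filter.eventually_all.2 h1).and (h2.and self_mem_nhdsWithin)).exists
  exact ⟨ε, h.2.2, h.1, h.2.1⟩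

/-- The rank-one determinant formula, applied to the second conic: its determinant is a multiple of
`det K` that is nonzero for generic `ε`. -/
theorem det_add_smul_vecMulVec (K : Matrix (Fin 3) (Fin 3) ℝ) (c : ℝ) (m : Fin 3 → ℝ) :
    (K + (c * K.det) • Matrix.vecMulVec m m).det =
      K.det * (1 + c * (m ⬝ᵥ (K.adjugate *ᵥ m))) := by
  have h : ∀ d : ℝ, (K + d • Matrix.vecMulVec m m).det =
      K.det + d * (m ⬝ᵥ (K.adjugate *ᵥ m)) := fun d => by
    simp [Matrix.det_fin_three, Matrix.adjugate_fin_three, Matrix.vecMulVec_apply,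
      Matrix.mulVec, dotProduct, Fin.sum_univ_three]
    ring
  rw [h]
  ring

theorem map_isSymm {k : ℕ} {K : Matrix (Fin k) (Fin k) ℝ} (hK : K.IsSymm) :
    (K.map (algebraMap ℝ ℂ)).IsSymm := by
  ext i j
  simp [hK.apply i j]

theorem det_map_algebraMap {k : ℕ} (K : Matrix (Fin k) (Fin k) ℝ) :
    (K.map (algebraMap ℝ ℂ)).det = (K.det : ℂ) :=
  ((algebraMap ℝ ℂ).map_det K).symm

theorem complexify_dotProduct_map_mulVec {k m : ℕ} (r : Fin m → ℝ)
    (E : Matrix (Fin m) (Fin k) ℝ) (ξ : Fin k → ℂ) :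
    complexify r ⬝ᵥ (E.map (algebraMap ℝ ℂ) *ᵥ ξ) = complexify (r ᵥ* E) ⬝ᵥ ξ := by
  rw [Matrix.dotProduct_mulVec]
  congr 1
  ext j
  simp [complexify, Matrix.vecMul, dotProduct]

theorem dotProduct_map_mulVec_map_mulVec {k m : ℕ} (K : Matrix (Fin m) (Fin m) ℝ)
    (E : Matrix (Fin m) (Fin k) ℝ) (ξ η : Fin k → ℂ) :
    (E.map (algebraMap ℝ ℂ) *ᵥ ξ) ⬝ᵥ
        (K.map (algebraMap ℝ ℂ) *ᵥ (E.map (algebraMap ℝ ℂ) *ᵥ η)) =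
      ξ ⬝ᵥ ((Eᵀ * K * E).map (algebraMap ℝ ℂ) *ᵥ η) := by
  rw [Matrix.map_mul, Matrix.map_mul, Matrix.transpose_map, ← Matrix.mulVec_mulVec,
    ← Matrix.mulVec_mulVec, Matrix.dotProduct_mulVec ξ, Matrix.vecMul_transpose]

theorem dotProduct_mulVec_mulVec {k m : ℕ} (K : Matrix (Fin m) (Fin m) ℝ)
    (E : Matrix (Fin m) (Fin k) ℝ) (ξ η : Fin k → ℝ) :
    (E *ᵥ ξ) ⬝ᵥ (K *ᵥ (E *ᵥ η)) = ξ ⬝ᵥ ((Eᵀ * K * E) *ᵥ η) := by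
  rw [← Matrix.mulVec_mulVec, ← Matrix.mulVec_mulVec, Matrix.dotProduct_mulVec ξ,
    Matrix.vecMul_transpose]

theorem dotProduct_add_smul_vecMulVec_mulVec {k : ℕ} (K : Matrix (Fin k) (Fin k) ℝ) (c : ℝ)
    (m : Fin k → ℝ) (u : Fin k → ℂ) :
    u ⬝ᵥ ((K + c • Matrix.vecMulVec m m).map (algebraMap ℝ ℂ) *ᵥ u) =
      u ⬝ᵥ (K.map (algebraMap ℝ ℂ) *ᵥ u) + c * (complexify m ⬝ᵥ u) ^ 2 := by
  have : (K + c • Matrix.vecMulVec m m).map (algebraMap ℝ ℂ) =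
      K.map (algebraMap ℝ ℂ) + (c : ℂ) • Matrix.vecMulVec (complexify m) (complexify m) := by
    ext i j
    simp [Matrix.vecMulVec_apply, complexify]
  rw [this, Matrix.add_mulVec, Matrix.smul_mulVec, Matrix.vecMulVec_mulVec, op_smul_eq_smul,
    dotProduct_add, dotProduct_smul, dotProduct_smul, dotProduct_comm u (complexify m)]
  simp only [smul_eq_mul]
  ring

theorem exists_common_images {n : ℕ} {P Q : Fin n → Camera} {u v : Fin 4 → ℂ} (hu : u ≠ 0)
    (hv : v ≠ 0) (h : ∀ i, ∃ s t : ℂ, (s ≠ 0 ∨ t ≠ 0) ∧ s • (P i).toLin u = t • (Q i).toLin v) :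
    ∃ z : Fin n → P2, ∀ i, (P i).Sees (Projectivization.mk ℂ u hu) (z i) ∧
      (Q i).Sees (Projectivization.mk ℂ v hv) (z i) := by
  choose z hz using fun i => (exists_common_image_iff _ _ hu hv).2 (h i)
  exact ⟨z, hz⟩

theorem PlaneConic.isSmooth_of_det_ne_zero (T : PlaneConic) {E : Matrix (Fin 4) (Fin 3) ℝ}
    {L : Matrix (Fin 3) (Fin 4) ℝ} {z : Fin 4 → ℝ} (h1 : E * L + Matrix.vecMulVec z T.l = 1)
    (h3 : T.l ᵥ* E = 0) (hdet : (Eᵀ * T.K * E).det ≠ 0) : T.IsSmooth := by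
  intro v hv h
  have hv' : E *ᵥ (L *ᵥ v) = v := by
    have := congrArg (· *ᵥ v) h1
    simpa [Matrix.add_mulVec, Matrix.vecMulVec_mulVec, hv] using this
  have h0 : (Eᵀ * T.K * E) *ᵥ (L *ᵥ v) = 0 := by
    ext j
    have := h (E *ᵥ (Pi.single j 1)) (by rw [Matrix.dotProduct_mulVec, h3, zero_dotProduct])
    rw [← hv', dotProduct_mulVec_mulVec] at this
    simpa using this
  have : L *ᵥ v = 0 := by
    by_contra hne
    exact hdet (Matrix.exists_mulVec_eq_zero_iff.1 ⟨_, hne, h0⟩)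
  rw [← hv', this, Matrix.mulVec_zero]

theorem PlaneConic.det_ne_zero_of_isSmooth (T : PlaneConic) (hT : T.IsSmooth)
    {E : Matrix (Fin 4) (Fin 3) ℝ} {L : Matrix (Fin 3) (Fin 4) ℝ} {z : Fin 4 → ℝ}
    (h1 : E * L + Matrix.vecMulVec z T.l = 1) (h2 : L * E = 1)
    (h3 : T.l ᵥ* E = 0) : (Eᵀ * T.K * E).det ≠ 0 := by
  intro h0
  obtain ⟨ν, hν, hν0⟩ := Matrix.exists_mulVec_eq_zero_iff.2 h0
  have hl : ∀ ξ, T.l ⬝ᵥ (E *ᵥ ξ) = 0 := fun ξ => by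
    rw [Matrix.dotProduct_mulVec, h3, zero_dotProduct]
  have := hT (E *ᵥ ν) (hl ν) fun w hw => by
    have hw' : E *ᵥ (L *ᵥ w) = w := by
      have := congrArg (· *ᵥ w) h1
      simpa [Matrix.add_mulVec, Matrix.vecMulVec_mulVec, hw] using this
    rw [← hw', dotProduct_mulVec_mulVec, hν0, dotProduct_zero]
  apply hν
  rw [← Matrix.one_mulVec ν, ← h2, ← Matrix.mulVec_mulVec, this, Matrix.mulVec_zero]

/-! ### The conjugate of cameras on a smooth conic -/

/-- Cameras on a smooth conic and twists of them along the tangents of the conic. -/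
theorem exists_twisted_cameras {n : ℕ} (P : Fin n → Camera)
    (hP : Function.Injective (centers P)) (T : PlaneConic) (hT : T.IsSmooth)
    (hc : ∀ i, centers P i ∈ T.conic) :
    ∃ (Q : Fin n → Camera) (T' : PlaneConic), Function.Injective (centers Q) ∧ T'.IsSmooth ∧
      (T'.IsProper ↔ T.IsProper) ∧ (∀ i, centers Q i ∈ T'.conic) ∧
      (∀ i j, i ≠ j → ∃ x y : Fin 3 → ℂ,
        (∃ (w : Fin 4 → ℂ) (s t : ℂ), (w ≠ 0 ∨ s ≠ 0 ∨ t ≠ 0) ∧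
          (P i).toLin w = s • x ∧ (P j).toLin w = t • y) ∧
        ¬ ∃ (w : Fin 4 → ℂ) (s t : ℂ), (w ≠ 0 ∨ s ≠ 0 ∨ t ≠ 0) ∧
          (Q i).toLin w = s • x ∧ (Q j).toLin w = t • y) ∧
      (∀ x ∈ T.carrier, ∃ y ∈ T'.carrier, ∃ z : Fin n → P2, ∀ i,
        (P i).Sees x (z i) ∧ (Q i).Sees y (z i)) ∧
      (∀ y ∈ T'.carrier, ∃ x ∈ T.carrier, ∃ z : Fin n → P2, ∀ i,
        (P i).Sees x (z i) ∧ (Q i).Sees y (z i)) := by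
  obtain ⟨E, L, z, h1, h2, h3⟩ := exists_plane_coordinates T.l_ne
  set K3 := Eᵀ * T.K * E with hK3
  set m3 := T.m ᵥ* E with hm3
  set Ec := E.map (algebraMap ℝ ℂ) with hEc
  set Kc := K3.map (algebraMap ℝ ℂ) with hKc
  set mc := complexify m3 with hmc
  have hdet : K3.det ≠ 0 := T.det_ne_zero_of_isSmooth hT h1 h2 h3
  have hK3s : K3.IsSymm := by
    rw [Matrix.IsSymm, hK3, Matrix.transpose_mul, Matrix.transpose_mul, T.K_symm.eq,
      Matrix.transpose_transpose, Matrix.mul_assoc]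
  have hKcs : Kc.IsSymm := map_isSymm hK3s
  have hKcdet : Kc.det ≠ 0 := by
    rw [hKc, det_map_algebraMap]
    exact_mod_cast hdet
  have hE0 : ∀ ξ, Ec *ᵥ ξ = 0 → ξ = 0 := fun ξ h => by
    have : L.map (algebraMap ℝ ℂ) * Ec = 1 := by
      rw [hEc, ← Matrix.map_mul, h2]
      exact Matrix.map_one _ (map_zero _) (map_one _)
    rw [← Matrix.one_mulVec ξ, ← this, ← Matrix.mulVec_mulVec, h, Matrix.mulVec_zero]
  have hEl : ∀ ξ, complexify T.l ⬝ᵥ (Ec *ᵥ ξ) = 0 := fun ξ => by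
    rw [complexify_dotProduct_map_mulVec, h3, complexify_eq_zero.2 rfl, zero_dotProduct]
  have hEL : ∀ v, complexify T.l ⬝ᵥ v = 0 → ∃ ξ, v = Ec *ᵥ ξ := fun v hv => by
    refine ⟨L.map (algebraMap ℝ ℂ) *ᵥ v, ?_⟩
    have h1' : Ec * L.map (algebraMap ℝ ℂ) + Matrix.vecMulVec (complexify z) (complexify T.l)
        = 1 := by
      have := congrArg (Matrix.map · (algebraMap ℝ ℂ)) h1
      rw [Matrix.map_one _ (map_zero _) (map_one _)] at this
      rw [← this, Matrix.map_add _ (map_add _), Matrix.map_mul]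
      congr 1
      ext i j
      simp [Matrix.vecMulVec_apply, complexify]
    have := congrArg (· *ᵥ v) h1'
    simpa [Matrix.add_mulVec, Matrix.vecMulVec_mulVec, hv, eq_comm] using this
  have hEm : ∀ ξ, complexify T.m ⬝ᵥ (Ec *ᵥ ξ) = mc ⬝ᵥ ξ :=
    complexify_dotProduct_map_mulVec T.m E
  have hEK : ∀ ξ, (Ec *ᵥ ξ) ⬝ᵥ (T.K.map (algebraMap ℝ ℂ) *ᵥ (Ec *ᵥ ξ)) = ξ ⬝ᵥ (Kc *ᵥ ξ) :=
    fun ξ => dotProduct_map_mulVec_map_mulVec T.K E ξ ξ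
  -- the centers and the tangent vectors
  have hcen : ∀ i, ∃ γ : Fin 3 → ℝ, γ ≠ 0 ∧ (P i).toLin (Ec *ᵥ complexify γ) = 0 ∧
      γ ⬝ᵥ (K3 *ᵥ γ) = 0 := fun i => by
    obtain ⟨k, hk, hPk⟩ := (P i).exists_real_center
    have hk' : complexify k ≠ 0 := fun h => hk (complexify_eq_zero.1 h)
    have hPk' : (P i).toLin (complexify k) = 0 := by
      rw [Camera.toLin_complexify, hPk, complexify_eq_zero.2 rfl]
    have := hc i
    rw [centers, ((P i).center_eq_mk_iff hk').2 hPk', mk_mem_conic, complexify_dotProduct,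
      map_mulVec_complexify, complexify_dotProduct] at this
    norm_cast at this
    have hk2 : E *ᵥ (L *ᵥ k) = k := by
      have h := congrArg (· *ᵥ k) h1
      simpa [Matrix.add_mulVec, Matrix.vecMulVec_mulVec, this.1] using h
    refine ⟨L *ᵥ k, fun h => hk ?_, ?_, ?_⟩
    · rw [← hk2, h, Matrix.mulVec_zero]
    · rw [map_mulVec_complexify, hk2, hPk']
    · rw [← dotProduct_mulVec_mulVec, hk2, this.2]
  choose γ hγ hPγ hγK using hcen
  choose ω hω using fun i => exists_crossProduct_eq_mulVec K3 (hγ i) (hγK i)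
  -- The first condition makes every `1 + ε wᵢ mᵀ` invertible, so that the twisted matrices are
  -- cameras; the second makes the new conic smooth.
  obtain ⟨ε, hε, hεω, hεK⟩ := exists_generic_parameter (fun i => m3 ⬝ᵥ ω i)
    (m3 ⬝ᵥ (K3.adjugate *ᵥ m3))
  have hεc : (ε : ℂ) ≠ 0 := by exact_mod_cast hε
  have hγc : ∀ i, complexify (γ i) ≠ 0 := fun i h => hγ i (complexify_eq_zero.1 h)
  have hγKc : ∀ i, complexify (γ i) ⬝ᵥ (Kc *ᵥ complexify (γ i)) = 0 := fun i => by
    rw [map_mulVec_complexify, complexify_dotProduct, hγK i, Complex.ofReal_zero]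
  have hωc : ∀ i, complexify (γ i) ⨯₃ complexify (ω i) = Kc *ᵥ complexify (γ i) := fun i => by
    rw [map_mulVec_complexify, ← hω i]
    ext j
    fin_cases j <;> simp [cross_apply, complexify]
  have hPker : ∀ i v, (P i).toLin v = 0 → ∃ c : ℂ, v = c • (Ec *ᵥ complexify (γ i)) :=
    fun i v hv => (P i).exists_smul_of_toLin_eq_zero (fun h => hγc i (hE0 _ h)) (hPγ i) hv
  have hγγ : ∀ i j, i ≠ j → complexify (γ i) ⨯₃ complexify (γ j) ≠ 0 := fun i j hij h => by
    obtain ⟨c, hcj⟩ := exists_eq_smul_of_crossProduct_eq_zero (hγc i) h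
    apply hij
    apply hP
    have hn : Ec *ᵥ complexify (γ i) ≠ 0 := fun h => hγc i (hE0 _ h)
    rw [centers, centers, ((P i).center_eq_mk_iff hn).2 (hPγ i), eq_comm,
      Camera.center_eq_mk_iff]
    have := hPγ j
    rw [hcj, Matrix.mulVec_smul, map_smul, smul_eq_zero] at this
    refine this.resolve_left fun h0 => hγc j ?_
    rw [hcj, h0, zero_smul]
  have hγKγ : ∀ i j, i ≠ j → complexify (γ i) ⬝ᵥ (Kc *ᵥ complexify (γ j)) ≠ 0 :=
    fun i j hij h => hγγ i j hij
      (crossProduct_eq_zero_of_isotropic hKcs hKcdet (hγKc i) (hγKc j) h)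
  have hmw : ∀ i, 1 + T.m ⬝ᵥ (E *ᵥ (ε • ω i)) ≠ 0 := fun i => by
    rw [Matrix.dotProduct_mulVec, dotProduct_smul, smul_eq_mul]
    exact hεω i
  set Q : Fin n → Camera := fun i => (P i).twist (E *ᵥ (ε • ω i)) T.m (hmw i) with hQ
  have hQv : ∀ i v, (Q i).toLin v =
      (P i).toLin (v + (ε * (complexify T.m ⬝ᵥ v)) • (Ec *ᵥ complexify (ω i))) := fun i v => by
    rw [hQ]
    simp only
    rw [Camera.twist_toLin, ← map_mulVec_complexify, complexify_smul, Matrix.mulVec_smul,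
      smul_smul, mul_comm]
  -- the new conic
  have hK'det : (Eᵀ * (T.K + (ε ^ 2 * K3.det) • Matrix.vecMulVec T.m T.m) * E).det ≠ 0 := by
    have : Eᵀ * (T.K + (ε ^ 2 * K3.det) • Matrix.vecMulVec T.m T.m) * E =
        K3 + (ε ^ 2 * K3.det) • Matrix.vecMulVec m3 m3 := by
      rw [Matrix.mul_add, Matrix.add_mul, Matrix.mul_smul, Matrix.smul_mul,
        Matrix.mul_vecMulVec, Matrix.vecMulVec_mul, Matrix.mulVec_transpose]
    rw [this, det_add_smul_vecMulVec]
    exact mul_ne_zero hdet hεK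
  have hK's : (T.K + (ε ^ 2 * K3.det) • Matrix.vecMulVec T.m T.m).IsSymm := by
    ext i j
    simp [T.K_symm.apply i j, Matrix.vecMulVec_apply, mul_comm (T.m i)]
  have hK'ne : ∃ v, T.l ⬝ᵥ v = 0 ∧
      v ⬝ᵥ ((T.K + (ε ^ 2 * K3.det) • Matrix.vecMulVec T.m T.m) *ᵥ v) ≠ 0 := by
    by_contra! hc0
    apply hK'det
    refine Matrix.exists_mulVec_eq_zero_iff.1 ⟨Pi.single 0 1, by simp, ?_⟩
    ext j
    by_contra hne
    obtain ⟨v, hv, hv0⟩ := exists_dotProduct_mulVec_ne_zero (l := T.l) hK's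
      (v := E *ᵥ Pi.single 0 1) (w := E *ᵥ Pi.single j 1)
      (by rw [Matrix.dotProduct_mulVec, h3, zero_dotProduct])
      (by rw [Matrix.dotProduct_mulVec, h3, zero_dotProduct])
      (by rw [dotProduct_mulVec_mulVec]; simpa using hne)
    exact hv0 (hc0 v hv)
  -- Both planes are kept; only the quadratic form changes, and only by a multiple of `m²`.
  set T' : PlaneConic := ⟨T.m, T.l, _, T.m_ne, T.l_ne, hK's, hK'ne⟩ with hT'
  have hEK' : ∀ η, (Ec *ᵥ η) ⬝ᵥ (T'.K.map (algebraMap ℝ ℂ) *ᵥ (Ec *ᵥ η)) =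
      η ⬝ᵥ (Kc *ᵥ η) + (ε : ℂ) ^ 2 * Kc.det * (mc ⬝ᵥ η) ^ 2 := fun η => by
    rw [hT', dotProduct_add_smul_vecMulVec_mulVec, hEK, hEm, hKc, det_map_algebraMap]
    push_cast
    ring
  -- the relation between the conics
  have hrel : ∀ ξ η : Fin 3 → ℂ, ξ ⨯₃ η = (ε * (mc ⬝ᵥ η)) • (Kc *ᵥ ξ) →
      ∀ i, ∃ s t : ℂ, (s ≠ 0 ∨ t ≠ 0) ∧
        s • (P i).toLin (Ec *ᵥ ξ) = t • (Q i).toLin (Ec *ᵥ η) := fun ξ η h i => by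
    -- Applying `Pᵢ` to the dependence kills the center and leaves a relation between `Pᵢ x` and `Qᵢ
    -- y`.
    obtain ⟨α, β, δ, hne, h0⟩ := exists_dependence_of_crossProduct_eq Kc hKcs (hωc i) h
    refine ⟨β, -δ, ?_, ?_⟩
    · by_contra! hb
      obtain ⟨hb, hd⟩ := hb
      rw [neg_eq_zero] at hd
      rw [hb, hd, zero_smul, zero_smul, add_zero, add_zero, smul_eq_zero] at h0
      rcases h0 with h0 | h0
      · simp_all
      · exact hγc i h0
    · have := congrArg (fun v => (P i).toLin (Ec *ᵥ v)) h0
      simp only [Matrix.mulVec_add, Matrix.mulVec_smul, map_add, map_smul, hPγ, smul_zero,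
        Matrix.mulVec_zero, map_zero, zero_add] at this
      rw [hQv, hEm, neg_smul, map_add, map_smul]
      exact eq_neg_of_add_eq_zero_left this
  have hplane : ∀ u, complexify T.m ⬝ᵥ u = 0 → ∀ i, ∃ s t : ℂ, (s ≠ 0 ∨ t ≠ 0) ∧
        s • (P i).toLin u = t • (Q i).toLin u := fun u hu i => by
    refine ⟨1, 1, Or.inl one_ne_zero, ?_⟩
    rw [hQv, hu, mul_zero, zero_smul, add_zero]
  -- the new centers
  set q : Fin n → Fin 3 → ℂ := fun i => (1 + ε * (mc ⬝ᵥ complexify (ω i))) • complexify (γ i) -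
    (ε * (mc ⬝ᵥ complexify (γ i))) • complexify (ω i) with hq
  have hmq : ∀ i, mc ⬝ᵥ q i = mc ⬝ᵥ complexify (γ i) := fun i => by
    simp only [hq, dotProduct_sub, dotProduct_smul, smul_eq_mul]
    ring
  -- The new center is paired with the old one by the relation with `-ε` in place of `ε`. The second
  -- conic involves only `ε²`, so the new center lies on it.
  have hγq : ∀ i, complexify (γ i) ⨯₃ q i =
      ((-ε : ℂ) * (mc ⬝ᵥ q i)) • (Kc *ᵥ complexify (γ i)) := fun i => by
    rw [hmq, ← hωc]
    simp only [hq, map_sub, map_smul, cross_self, smul_zero, zero_sub, neg_mul, neg_smul]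
  have hq0 : ∀ i, q i ≠ 0 := fun i h => by
    have h4 := hmq i
    rw [h, dotProduct_zero] at h4
    have h5 : q i = (1 + ε * (mc ⬝ᵥ complexify (ω i))) • complexify (γ i) := by
      simp only [hq, ← h4, mul_zero, zero_smul, sub_zero]
    rw [h, eq_comm, smul_eq_zero] at h5
    refine h5.elim (fun h6 => hεω i ?_) (hγc i)
    rw [hmc, complexify_dotProduct] at h6
    exact_mod_cast h6
  have hEq0 : ∀ i, Ec *ᵥ q i ≠ 0 := fun i h => hq0 i (hE0 _ h)
  have hQq : ∀ i, (Q i).toLin (Ec *ᵥ q i) = 0 := fun i => by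
    rw [hQv, hEm, hmq, ← Matrix.mulVec_smul, ← Matrix.mulVec_add]
    simp only [hq, sub_add_cancel, Matrix.mulVec_smul, map_smul, hPγ, smul_zero]
  have hQc : ∀ i, centers Q i = Projectivization.mk ℂ (Ec *ᵥ q i) (hEq0 i) := fun i =>
    ((Q i).center_eq_mk_iff (hEq0 i)).2 (hQq i)
  refine ⟨Q, T', ?_, ?_, Iff.rfl, ?_, ?_, ?_, ?_⟩
  · intro i j hij
    by_contra hne
    rw [hQc, hQc, Projectivization.mk_eq_mk_iff'] at hij
    obtain ⟨c, hcq⟩ := hij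
    have hcq' : q i = c • q j := by
      rw [← sub_eq_zero]
      apply hE0
      rw [Matrix.mulVec_sub, Matrix.mulVec_smul, hcq, sub_self]
    have hc0 : c ≠ 0 := by
      rintro rfl
      exact hq0 i (by rw [hcq', zero_smul])
    have e1 := hγq i
    have e2 : complexify (γ j) ⨯₃ q i =
        ((-ε : ℂ) * (mc ⬝ᵥ q i)) • (Kc *ᵥ complexify (γ j)) := by
      rw [hcq', map_smul, hγq j, dotProduct_smul, smul_smul, smul_eq_mul]
      congr 1
      ring
    have e3 := congrArg (complexify (γ j) ⬝ᵥ ·) e1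
    have e4 := congrArg (complexify (γ i) ⬝ᵥ ·) e2
    simp only [dotProduct_smul, smul_eq_mul] at e3 e4
    rw [triple_product_permutation, ← cross_anticomm, dotProduct_neg, e4,
      dotProduct_mulVec_comm hKcs (complexify (γ j))] at e3
    have e5 : (2 * ε * (mc ⬝ᵥ q i)) * (complexify (γ i) ⬝ᵥ (Kc *ᵥ complexify (γ j))) = 0 := by
      linear_combination e3
    have hmq0 : mc ⬝ᵥ q i = 0 := by
      simpa [hεc] using (mul_eq_zero.1 e5).resolve_right (hγKγ i j hne)
    rw [hmq0, mul_zero, zero_smul] at e1 e2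
    obtain ⟨a, ha⟩ := exists_eq_smul_of_crossProduct_eq_zero (hγc i) e1
    rw [ha, map_smul, smul_eq_zero] at e2
    refine e2.elim (fun h => hq0 i ?_) (hγγ j i (Ne.symm hne))
    rw [ha, h, zero_smul]
  · exact T'.isSmooth_of_det_ne_zero h1 h3 hK'det
  · intro i
    rw [hQc, mk_mem_conic, hEK']
    refine ⟨hEl _, ?_⟩
    have := conic_of_crossProduct_eq_left Kc hKcs (neg_ne_zero.2 hεc) (hγc i) (hγKc i) (hγq i)
    rwa [neg_sq] at this
  · intro i j hij
    -- The images of a point off both planes correspond under `P`. If they corresponded under `Q`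
    -- through `v`, then `v + ε m(v) wᵢ - s x` would be a multiple of the `i`-th center, and
    -- similarly for `j` with `t`; applying `l` gives `s = t`.
    obtain ⟨x, hxl, hxm⟩ := exists_dotProduct_ne_zero_and T.l_ne T.m_ne
    have hxl' : complexify T.l ⬝ᵥ complexify x ≠ 0 := by
      rw [complexify_dotProduct]; exact_mod_cast hxl
    have hxm' : complexify T.m ⬝ᵥ complexify x ≠ 0 := by
      rw [complexify_dotProduct]; exact_mod_cast hxm
    generalize complexify x = x at hxl' hxm'
    refine ⟨(P i).toLin x, (P j).toLin x, ⟨x, 1, 1, by simp, by simp, by simp⟩, ?_⟩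
    rintro ⟨v, s, t, hne, hs, ht⟩
    rw [hQv, ← map_smul, ← sub_eq_zero, ← map_sub] at hs ht
    obtain ⟨α, hα⟩ := hPker _ _ hs
    obtain ⟨β, hβ⟩ := hPker _ _ ht
    have hls := congrArg (complexify T.l ⬝ᵥ ·) hα
    have hlt := congrArg (complexify T.l ⬝ᵥ ·) hβ
    simp only [dotProduct_sub, dotProduct_add, dotProduct_smul, hEl, smul_eq_mul, mul_zero, add_zero,
      sub_eq_zero] at hls hlt
    have hst : s = t := mul_right_cancel₀ hxl' (hls.symm.trans hlt)
    subst hst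
    have hdiff : (ε * (complexify T.m ⬝ᵥ v)) • (complexify (ω i) - complexify (ω j)) =
        α • complexify (γ i) - β • complexify (γ j) := by
      rw [← sub_eq_zero]
      apply hE0
      rw [Matrix.mulVec_sub, Matrix.mulVec_sub, Matrix.mulVec_smul, Matrix.mulVec_sub,
        Matrix.mulVec_smul, Matrix.mulVec_smul, ← hα, ← hβ]
      module
    -- Pairing with `γᵢ × γⱼ` removes the centers. The two tangent terms contribute with opposite
    -- signs and add up to a multiple of `γᵢᵀKγⱼ ≠ 0`.
    have hmv : complexify T.m ⬝ᵥ v = 0 := by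
      have h5 := congrArg (· ⬝ᵥ (complexify (γ i) ⨯₃ complexify (γ j))) hdiff
      simp only [smul_dotProduct, sub_dotProduct, dot_self_cross, dot_cross_self, smul_eq_mul,
        mul_zero, sub_zero] at h5
      have e1 : complexify (ω i) ⬝ᵥ (complexify (γ i) ⨯₃ complexify (γ j)) =
          -(complexify (γ i) ⬝ᵥ (Kc *ᵥ complexify (γ j))) := by
        rw [triple_product_permutation, triple_product_permutation, ← cross_anticomm,
          dotProduct_neg, hωc, dotProduct_mulVec_comm hKcs]
      have e2 : complexify (ω j) ⬝ᵥ (complexify (γ i) ⨯₃ complexify (γ j)) =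
          complexify (γ i) ⬝ᵥ (Kc *ᵥ complexify (γ j)) := by
        rw [triple_product_permutation, hωc]
      rw [e1, e2] at h5
      have h6 : (2 * ε * (complexify T.m ⬝ᵥ v)) *
          (complexify (γ i) ⬝ᵥ (Kc *ᵥ complexify (γ j))) = 0 := by
        linear_combination -h5
      simpa [hεc] using (mul_eq_zero.1 h6).resolve_right (hγKγ i j hij)
    rw [hmv, mul_zero, zero_smul, eq_comm, sub_eq_zero] at hdiff
    have hα0 : α = 0 := by
      have h7 := congrArg (complexify (γ j) ⨯₃ ·) hdiff
      simp only [map_smul, cross_self, smul_zero, smul_eq_zero] at h7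
      exact h7.resolve_right (hγγ j i (Ne.symm hij))
    rw [hmv, mul_zero, zero_smul, add_zero, hα0, zero_smul, sub_eq_zero] at hα
    rw [hα, dotProduct_smul, smul_eq_mul] at hmv
    have hs0 : s = 0 := (mul_eq_zero.1 hmv).resolve_right hxm'
    rw [hs0, zero_smul] at hα
    simp [hα, hs0] at hne
  · intro x hx
    induction x using Projectivization.ind with
    | h u hu =>
      rcases (mk_mem_carrier T hu).1 hx with hm | ⟨hl, hK⟩
      · exact ⟨_, (mk_mem_carrier T' hu).2 (Or.inl hm), exists_common_images hu hu (hplane u hm)⟩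
      · obtain ⟨ξ, rfl⟩ := hEL u hl
        rw [hEK] at hK
        have hξ : ξ ≠ 0 := by rintro rfl; exact hu (Matrix.mulVec_zero _)
        obtain ⟨η, hη, h⟩ := exists_crossProduct_eq_left Kc mc ξ (ε : ℂ) hK
        have hη' : Ec *ᵥ η ≠ 0 := fun h => hη (hE0 _ h)
        refine ⟨_, (mk_mem_carrier T' hη').2 (Or.inr ⟨hEl _, ?_⟩),
          exists_common_images hu hη' (hrel ξ η h)⟩
        rw [hEK']
        exact conic_of_crossProduct_eq_left Kc hKcs hεc hξ hK h
  · intro y hy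
    induction y using Projectivization.ind with
    | h v hv =>
      rcases (mk_mem_carrier T' hv).1 hy with hm | ⟨hl, hK⟩
      · exact ⟨_, (mk_mem_carrier T hv).2 (Or.inl hm), exists_common_images hv hv (hplane v hm)⟩
      · obtain ⟨η, rfl⟩ := hEL v hl
        rw [hEK'] at hK
        have hη : η ≠ 0 := by rintro rfl; exact hv (Matrix.mulVec_zero _)
        obtain ⟨ξ, hξ, h⟩ := exists_crossProduct_eq_right Kc hKcs mc η (ε : ℂ) hK
        have hξ' : Ec *ᵥ ξ ≠ 0 := fun h => hξ (hE0 _ h)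
        refine ⟨_, (mk_mem_carrier T hξ').2 (Or.inr ⟨hEl _, ?_⟩),
          exists_common_images hξ' hv (hrel ξ η h)⟩
        rw [hEK]
        exact conic_of_crossProduct_eq_right Kc hεc hη hK h

/-- Cameras with centers on a smooth conic have conjugates for any set of points on the union of
the conic and a plane. -/
theorem exists_conjugate_of_isSmooth {n : ℕ} (hn : 2 ≤ n) (P : Fin n → Camera)
    (hP : Function.Injective (centers P)) (T : PlaneConic) (hT : T.IsSmooth)
    (hc : ∀ i, centers P i ∈ T.conic) :
    ∃ (Q : Fin n → Camera) (T' : PlaneConic), Function.Injective (centers Q) ∧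
      T'.IsSmooth ∧ (T'.IsProper ↔ T.IsProper) ∧ (∀ i, centers Q i ∈ T'.conic) ∧
      IsConjugate P T.carrier Q T'.carrier ∧
      ∀ X : Set P3, X ⊆ T.carrier → ∃ Y : Set P3, Y ⊆ T'.carrier ∧ IsConjugate P X Q Y := by
  obtain ⟨Q, T', h1, h2, h3, h4, h5, h6, h7⟩ := exists_twisted_cameras P hP T hT hc
  refine ⟨Q, T', h1, h2, h3, h4,
    isConjugate_of_epipolar hn h5 (exists_common_reconstruction h6 h7), fun X hX => ?_⟩
  obtain ⟨Y, hY, hS⟩ := exists_subset_common_reconstruction fun x hx => h6 x (hX hx)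
  exact ⟨Y, hY, isConjugate_of_epipolar hn h5 hS⟩

/-! ### Linear forms and quadrics that split into two planes -/

section linearForms
variable {F V : Type*} [Field F] [AddCommGroup V] [Module F V]

theorem forall_eq_zero_or_of_mul_eq_zero (W : Submodule F V) (f g : V →ₗ[F] F)
    (h : ∀ u ∈ W, f u * g u = 0) : (∀ u ∈ W, f u = 0) ∨ ∀ u ∈ W, g u = 0 := by
  by_contra! hc
  obtain ⟨⟨u, hu, hfu⟩, w, hw, hgw⟩ := hc
  have h1 := (mul_eq_zero.1 (h u hu)).resolve_left hfu
  have h2 := (mul_eq_zero.1 (h w hw)).resolve_right hgw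
  have h3 := h (u + w) (W.add_mem hu hw)
  rw [map_add, map_add, h1, h2, add_zero, zero_add] at h3
  exact mul_ne_zero hfu hgw h3

theorem exists_eq_smul_of_ker_le {f a : V →ₗ[F] F} (h : ∀ u, a u = 0 → f u = 0) :
    ∃ c : F, f = c • a := by
  have := mem_span_of_iInf_ker_le_ker (L := fun _ : Unit => a) (K := f) (by
    intro u hu
    simpa using h u (by simpa using hu))
  rw [Set.range_const, Submodule.mem_span_singleton] at this
  obtain ⟨c, hc⟩ := this
  exact ⟨c, hc.symm⟩

/-- The form `f` is a linear combination of `g` and `h`. -/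
def IsCombination (f g h : V →ₗ[F] F) : Prop := ∃ c d : F, f = c • g + d • h

theorem IsCombination.symm {f g h : V →ₗ[F] F} (H : IsCombination f g h) :
    IsCombination f h g := by
  obtain ⟨c, d, rfl⟩ := H
  exact ⟨d, c, add_comm _ _⟩

theorem isCombination_of_ker_le {f g h : V →ₗ[F] F} (H : ∀ u, g u = 0 → h u = 0 → f u = 0) :
    IsCombination f g h := by
  have := mem_span_of_iInf_ker_le_ker (L := ![g, h]) (K := f) (by
    intro u hu
    rw [Submodule.mem_iInf] at hu
    simpa using H u (by simpa using hu 0) (by simpa using hu 1))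
  rw [Matrix.range_cons_cons_empty, Submodule.mem_span_pair] at this
  obtain ⟨c, d, hcd⟩ := this
  exact ⟨c, d, hcd.symm⟩

/-- The forms `f`, `g`, `h` take arbitrary values simultaneously. -/
def IsSurjectiveTriple (f g h : V →ₗ[F] F) : Prop :=
  ∀ x y z : F, ∃ u, f u = x ∧ g u = y ∧ h u = z

/-- Three independent forms do not fit into the span of `h` and `a`. -/
theorem IsSurjectiveTriple.not_both {f g h a : V →ₗ[F] F} (H : IsSurjectiveTriple f g h)
    (hf : IsCombination f h a) (hg : IsCombination g h a) : False := by
  obtain ⟨c, d, rfl⟩ := hf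
  obtain ⟨c', d', rfl⟩ := hg
  obtain ⟨u, h1, h2, h3⟩ := H 1 0 0
  obtain ⟨w, h4, h5, h6⟩ := H 0 1 0
  simp only [LinearMap.add_apply, LinearMap.smul_apply, smul_eq_mul, h3, h6, mul_zero,
    zero_add] at h1 h2 h4 h5
  have : (d * a u) * (d' * a w) = (d * a w) * (d' * a u) := by ring
  rw [h1, h2, h4, h5] at this
  simp at this

/-- If `h` were in the span of `a` and `b`, so would be `f` and `g`, which is too much for three
independent forms. -/
theorem IsSurjectiveTriple.not_isCombination {f g h a b : V →ₗ[F] F}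
    (H : IsSurjectiveTriple f g h) (hf : IsCombination f h a) (hg : IsCombination g h b) :
    ¬ IsCombination h a b := by
  rintro ⟨x, y, hxy⟩
  obtain ⟨c, d, rfl⟩ := hf
  obtain ⟨c', d', rfl⟩ := hg
  obtain ⟨u, h1, h2, h3⟩ := H 1 0 0
  obtain ⟨w, h4, h5, h6⟩ := H 0 1 0
  obtain ⟨v, -, -, h7⟩ := H 0 0 1
  simp only [LinearMap.add_apply, LinearMap.smul_apply, smul_eq_mul, h3, h6, mul_zero,
    zero_add] at h1 h2 h4 h5
  have hd' : d' ≠ 0 := left_ne_zero_of_mul_eq_one h5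
  have hd : d ≠ 0 := left_ne_zero_of_mul_eq_one h1
  have hbu : b u = 0 := (mul_eq_zero.1 h2).resolve_left hd'
  have haw : a w = 0 := (mul_eq_zero.1 h4).resolve_left hd
  have h8 := LinearMap.congr_fun hxy u
  have h9 := LinearMap.congr_fun hxy w
  simp only [LinearMap.add_apply, LinearMap.smul_apply, smul_eq_mul, h3, h6, hbu, haw, mul_zero,
    add_zero, zero_add] at h8 h9
  have hx : x = 0 := (mul_eq_zero.1 h8.symm).resolve_right (right_ne_zero_of_mul_eq_one h1)
  have hy : y = 0 := (mul_eq_zero.1 h9.symm).resolve_right (right_ne_zero_of_mul_eq_one h5)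
  rw [hxy, hx, hy] at h7
  simp at h7

/-- A quadratic form `f g - h k` whose zero set is a pair of planes is a multiple of the product of
their equations. -/
theorem exists_eq_mul_of_zero_iff {f g h k a b : V →ₗ[F] F} (hab : LinearIndependent F ![a, b])
    (H : ∀ u, f u * g u - h u * k u = 0 ↔ a u = 0 ∨ b u = 0) :
    ∃ κ : F, κ ≠ 0 ∧ ∀ u, f u * g u - h u * k u = κ * (a u * b u) := by
  rw [LinearIndependent.pair_iff] at hab
  have hva : ∃ v, a v = 1 ∧ b v = 0 := by
    by_contra! hc
    obtain ⟨c, hc⟩ := exists_eq_smul_of_ker_le (f := a) (a := b) fun u hu => by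
      by_contra h0
      exact hc ((a u)⁻¹ • u) (by simp [h0]) (by simp [hu])
    have := hab 1 (-c) (by rw [hc]; module)
    simp at this
  have hvb : ∃ v, b v = 1 ∧ a v = 0 := by
    by_contra! hc
    obtain ⟨c, hc⟩ := exists_eq_smul_of_ker_le (f := b) (a := a) fun u hu => by
      by_contra h0
      exact hc ((b u)⁻¹ • u) (by simp [h0]) (by simp [hu])
    have := hab (-c) 1 (by rw [hc]; module)
    simp at this
  obtain ⟨va, ha1, ha2⟩ := hva
  obtain ⟨vb, hb1, hb2⟩ := hvb
  have key : ∀ u, f u * g u - h u * k u =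
      (f va * g vb + f vb * g va - h va * k vb - h vb * k va) * (a u * b u) := fun u => by
    obtain ⟨w, hw⟩ : ∃ w, w = u - a u • va - b u • vb := ⟨_, rfl⟩
    have hu : u = w + a u • va + b u • vb := by rw [hw]; abel
    have haw : a w = 0 := by rw [hw]; simp [ha1, hb2]
    have hbw : b w = 0 := by rw [hw]; simp [ha2, hb1]
    -- The quadratic form is expanded along `w`, `va`, `vb`. Each term except the mixed one in `va`
    -- and `vb` is determined by values at points of one of the planes, and these vanish.
    have e1 := (H (w + a u • va)).2 (Or.inr (by simp [hbw, ha2]))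
    have e2 := (H vb).2 (Or.inl hb2)
    have e3 := (H (w + vb)).2 (Or.inl (by simp [haw, hb2]))
    have e4 := (H w).2 (Or.inl haw)
    generalize a u = s at *
    generalize b u = t at *
    rw [hu]
    simp only [map_add, map_smul, smul_eq_mul] at *
    linear_combination e1 + (t ^ 2 - t) * e2 + t * e3 - t * e4
  -- A zero constant would put `va + vb`, which lies on neither plane, on the quadric.
  refine ⟨_, fun h0 => ?_, key⟩
  have h1 := key (va + vb)
  rw [h0, zero_mul, H] at h1
  simp [ha1, ha2, hb1, hb2] at h1

theorem isCombination_of_mul_eq {f g h a b : V →ₗ[F] F} {κ : F} (hκ : κ ≠ 0)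
    (ha : ∃ u, h u = 0 ∧ a u ≠ 0) (hb : ∃ u, h u = 0 ∧ b u ≠ 0)
    (H : ∀ u, h u = 0 → f u * g u = κ * (a u * b u)) (hf : IsCombination f h a) :
    IsCombination g h b := by
  obtain ⟨c, d, rfl⟩ := hf
  have hd : d ≠ 0 := by
    rintro rfl
    rcases forall_eq_zero_or_of_mul_eq_zero (LinearMap.ker h) a b (fun u hu => by
      have := H u hu
      rw [LinearMap.mem_ker] at hu
      simpa [hu, hκ] using this) with h1 | h1
    · obtain ⟨u, hu, hau⟩ := ha
      exact hau (h1 u hu)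
    · obtain ⟨u, hu, hbu⟩ := hb
      exact hbu (h1 u hu)
  rcases forall_eq_zero_or_of_mul_eq_zero (LinearMap.ker h) a (d • g - κ • b) (fun u hu => by
      have := H u hu
      rw [LinearMap.mem_ker] at hu
      simp only [LinearMap.add_apply, LinearMap.smul_apply, hu, smul_eq_mul, mul_zero, zero_add,
        LinearMap.sub_apply] at this ⊢
      linear_combination this) with h1 | h1
  · obtain ⟨u, hu, hau⟩ := ha
    exact absurd (h1 u hu) hau
  · refine isCombination_of_ker_le fun u hu hbu => ?_
    simpa [hbu, hd] using h1 u hu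

/-- Unique factorization on the plane `h = 0`: if a product of two linear forms equals `κ ab` there,
the factors are `a` and `b` up to order and scalars. -/
theorem isCombination_or_of_mul_eq {f g h a b : V →ₗ[F] F} {κ : F} (hκ : κ ≠ 0)
    (ha : ∃ u, h u = 0 ∧ a u ≠ 0) (hb : ∃ u, h u = 0 ∧ b u ≠ 0)
    (H : ∀ u, h u = 0 → f u * g u = κ * (a u * b u)) :
    (IsCombination f h a ∧ IsCombination g h b) ∨
      (IsCombination f h b ∧ IsCombination g h a) := by
  rcases forall_eq_zero_or_of_mul_eq_zero (LinearMap.ker h ⊓ LinearMap.ker a) f g (fun u hu => by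
      rw [H u hu.1, LinearMap.mem_ker.1 hu.2]; simp) with h1 | h1
  · have h2 : IsCombination f h a := isCombination_of_ker_le fun u hu hau => h1 u ⟨hu, hau⟩
    exact Or.inl ⟨h2, isCombination_of_mul_eq hκ ha hb H h2⟩
  · have h2 : IsCombination g h a := isCombination_of_ker_le fun u hu hau => h1 u ⟨hu, hau⟩
    exact Or.inr ⟨isCombination_of_mul_eq hκ ha hb (fun u hu => by rw [mul_comm, H u hu]) h2, h2⟩

theorem exists_ker_ne_zero {h a : V →ₗ[F] F} (ha : a ≠ 0) (hh : ¬ ∃ c : F, h = c • a) :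
    ∃ u, h u = 0 ∧ a u ≠ 0 := by
  by_contra! hc
  obtain ⟨c, hc⟩ := exists_eq_smul_of_ker_le hc
  have hc0 : c ≠ 0 := by
    rintro rfl
    exact ha (by rw [hc, zero_smul])
  exact hh ⟨c⁻¹, by rw [hc, inv_smul_smul₀ hc0]⟩

/-- In the situation of the three equal quadrics, the form `h` of a view that is not an equation of
one of the planes is in general position to the planes, and the planes belong to the pencils that
`h` spans with the corresponding forms `h₂` and `h₃` of the other views. -/
theorem pencils_of_quadrics {f g h h₂ k₂ h₃ k₃ a b : V →ₗ[F] F} (S : IsSurjectiveTriple f g h)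
    {κ₂ κ₃ : F} (hκ₂ : κ₂ ≠ 0) (hκ₃ : κ₃ ≠ 0) (ha : ∃ u, h u = 0 ∧ a u ≠ 0)
    (hb : ∃ u, h u = 0 ∧ b u ≠ 0) (H₂ : ∀ u, g u * h₂ u - h u * k₂ u = κ₂ * (a u * b u))
    (H₃ : ∀ u, f u * h₃ u - h u * k₃ u = κ₃ * (a u * b u)) :
    ((IsCombination b h h₂ ∧ IsCombination a h h₃) ∨
      (IsCombination a h h₂ ∧ IsCombination b h h₃)) ∧ ¬ IsCombination h a b := by
  have H₂' : ∀ u, h u = 0 → g u * h₂ u = κ₂ * (a u * b u) := fun u hu => by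
    rw [← H₂ u, hu]; ring
  have H₃' : ∀ u, h u = 0 → f u * h₃ u = κ₃ * (a u * b u) := fun u hu => by
    rw [← H₃ u, hu]; ring
  have flip : ∀ {h' k c : V →ₗ[F] F} {κ : F}, κ ≠ 0 →
      (∀ u, h u = 0 → k u * h' u = κ * (a u * b u)) → IsCombination h' h c →
      IsCombination c h h' := by
    rintro h' k c κ hκ H ⟨x, y, rfl⟩
    have hy : y ≠ 0 := by
      rintro rfl
      rcases forall_eq_zero_or_of_mul_eq_zero (LinearMap.ker h) a b (fun u hu => by
        have := H u hu
        rw [LinearMap.mem_ker] at hu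
        simpa [hu, hκ] using this) with h1 | h1
      · obtain ⟨u, hu, hau⟩ := ha
        exact hau (h1 u hu)
      · obtain ⟨u, hu, hbu⟩ := hb
        exact hbu (h1 u hu)
    refine isCombination_of_ker_le fun u hu hu' => ?_
    simpa [hu, hy] using hu'
  -- Modulo `h`, each of `g` and `f` is one of the two planes. They cannot be the same plane by
  -- independence of `f, g, h`, so the complementary factors `h₂` and `h₃` are opposite as well.
  rcases isCombination_or_of_mul_eq hκ₂ ha hb H₂' with ⟨h1, h2⟩ | ⟨h1, h2⟩ <;>
    rcases isCombination_or_of_mul_eq hκ₃ ha hb H₃' with ⟨h3, h4⟩ | ⟨h3, h4⟩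
  · exact (S.not_both h3 h1).elim
  · exact ⟨Or.inl ⟨flip hκ₂ H₂' h2, flip hκ₃ H₃' h4⟩, fun hc => S.not_isCombination h3 h1 hc.symm⟩
  · exact ⟨Or.inr ⟨flip hκ₂ H₂' h2, flip hκ₃ H₃' h4⟩, S.not_isCombination h3 h1⟩
  · exact (S.not_both h3 h1).elim

/-- On the plane `a = 0` the quadric reduces to `g h₂ = 0`. Independence keeps `g` from vanishing
there, so `h₂` does: the property passes from one view to the next. -/
theorem exists_eq_smul_of_quadric {f g h h₂ k₂ a b : V →ₗ[F] F} (S : IsSurjectiveTriple f g h)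
    {κ : F} (H : ∀ u, g u * h₂ u - h u * k₂ u = κ * (a u * b u)) (hh : ∃ c : F, h = c • a) :
    ∃ c : F, h₂ = c • a := by
  obtain ⟨c, rfl⟩ := hh
  rcases forall_eq_zero_or_of_mul_eq_zero (LinearMap.ker a) g h₂ (fun u hu => by
    have := H u
    rw [LinearMap.mem_ker] at hu
    simpa [hu] using this) with h1 | h1
  · obtain ⟨u, -, h2, h3⟩ := S 0 1 0
    obtain ⟨w, -, -, h4⟩ := S 0 0 1
    have hc : c ≠ 0 := left_ne_zero_of_mul_eq_one h4
    have h5 : a u = 0 := (mul_eq_zero.1 h3).resolve_left hc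
    rw [h1 u h5] at h2
    exact absurd h2 zero_ne_one
  · exact exists_eq_smul_of_ker_le h1

/-- Two independent members of a pencil span it, so `h` is recovered from `a` and `b`. -/
theorem isCombination_of_pencil {h h' a b : V →ₗ[F] F} (hab : LinearIndependent F ![a, b])
    (ha : IsCombination a h h') (hb : IsCombination b h h') : IsCombination h a b := by
  rw [LinearIndependent.pair_iff] at hab
  obtain ⟨x, y, hxy⟩ := ha
  obtain ⟨z, w, hzw⟩ := hb
  have h1 : w • a + (-y) • b = (x * w - y * z) • h := by
    rw [hxy, hzw]; module
  have hD : x * w - y * z ≠ 0 := by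
    intro h0
    rw [h0, zero_smul] at h1
    obtain ⟨hw, hy⟩ := hab _ _ h1
    rw [neg_eq_zero] at hy
    have h2 : z • a + (-x) • b = 0 := by
      rw [hxy, hzw, hw, hy]; module
    obtain ⟨hz, hx⟩ := hab _ _ h2
    rw [neg_eq_zero] at hx
    have := hab 1 0 (by rw [hxy, hx, hy]; module)
    simp at this
  refine ⟨(x * w - y * z)⁻¹ * w, (x * w - y * z)⁻¹ * (-y), ?_⟩
  rw [mul_smul, mul_smul, ← smul_add, h1, inv_smul_smul₀ hD]

/-- The three forms `hᵢ` are equations of one and the same of the two planes. -/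
theorem trifocal_forms_proportional {f₁ g₁ h₁ f₂ g₂ h₂ f₃ g₃ h₃ a b : V →ₗ[F] F}
    (hab : LinearIndependent F ![a, b]) (S₁ : IsSurjectiveTriple f₁ g₁ h₁)
    (S₂ : IsSurjectiveTriple f₂ g₂ h₂) (S₃ : IsSurjectiveTriple f₃ g₃ h₃)
    {κ₁ κ₂ κ₃ : F} (hκ₁ : κ₁ ≠ 0) (hκ₂ : κ₂ ≠ 0) (hκ₃ : κ₃ ≠ 0)
    (H₃ : ∀ u, g₁ u * h₂ u - h₁ u * f₂ u = κ₃ * (a u * b u))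
    (H₁ : ∀ u, g₂ u * h₃ u - h₂ u * f₃ u = κ₁ * (a u * b u))
    (H₂ : ∀ u, g₃ u * h₁ u - h₃ u * f₁ u = κ₂ * (a u * b u)) :
    (∃ c₁ c₂ c₃ : F, h₁ = c₁ • a ∧ h₂ = c₂ • a ∧ h₃ = c₃ • a) ∨
      (∃ c₁ c₂ c₃ : F, h₁ = c₁ • b ∧ h₂ = c₂ • b ∧ h₃ = c₃ • b) := by
  have H₃' : ∀ u, f₂ u * h₁ u - h₂ u * g₁ u = (-κ₃) * (a u * b u) := fun u => by
    linear_combination -H₃ u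
  have H₁' : ∀ u, f₃ u * h₂ u - h₃ u * g₂ u = (-κ₁) * (a u * b u) := fun u => by
    linear_combination -H₁ u
  have H₂' : ∀ u, f₁ u * h₃ u - h₁ u * g₃ u = (-κ₂) * (a u * b u) := fun u => by
    linear_combination -H₂ u
  have step : ∀ a b : V →ₗ[F] F,
      (∀ u, g₁ u * h₂ u - h₁ u * f₂ u = κ₃ * (a u * b u)) →
      (∀ u, g₂ u * h₃ u - h₂ u * f₃ u = κ₁ * (a u * b u)) →
      (∀ u, g₃ u * h₁ u - h₃ u * f₁ u = κ₂ * (a u * b u)) →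
      ((∃ c : F, h₁ = c • a) ∨ (∃ c : F, h₂ = c • a) ∨ ∃ c : F, h₃ = c • a) →
      ∃ c₁ c₂ c₃ : F, h₁ = c₁ • a ∧ h₂ = c₂ • a ∧ h₃ = c₃ • a := by
    intro a b H₃ H₁ H₂ h
    have t12 := fun h => exists_eq_smul_of_quadric S₁ H₃ h
    have t23 := fun h => exists_eq_smul_of_quadric S₂ H₁ h
    have t31 := fun h => exists_eq_smul_of_quadric S₃ H₂ h
    have all : (∃ c : F, h₁ = c • a) ∧ (∃ c : F, h₂ = c • a) ∧ ∃ c : F, h₃ = c • a := by tauto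
    obtain ⟨⟨c₁, e1⟩, ⟨c₂, e2⟩, c₃, e3⟩ := all
    exact ⟨c₁, c₂, c₃, e1, e2, e3⟩
  by_contra! hc
  obtain ⟨hca, hcb⟩ := hc
  have na : ¬((∃ c : F, h₁ = c • a) ∨ (∃ c : F, h₂ = c • a) ∨ ∃ c : F, h₃ = c • a) := fun h => by
    obtain ⟨c₁, c₂, c₃, e1, e2, e3⟩ := step a b H₃ H₁ H₂ h
    exact hca c₁ c₂ c₃ e1 e2 e3
  have nb : ¬((∃ c : F, h₁ = c • b) ∨ (∃ c : F, h₂ = c • b) ∨ ∃ c : F, h₃ = c • b) := fun h => by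
    obtain ⟨c₁, c₂, c₃, e1, e2, e3⟩ := step b a
      (fun u => by rw [H₃ u, mul_comm (a u)]) (fun u => by rw [H₁ u, mul_comm (a u)])
      (fun u => by rw [H₂ u, mul_comm (a u)]) h
    exact hcb c₁ c₂ c₃ e1 e2 e3
  rw [not_or, not_or] at na nb
  have ha0 : a ≠ 0 := hab.ne_zero 0
  have hb0 : b ≠ 0 := hab.ne_zero 1
  have v1 := pencils_of_quadrics S₁ hκ₃ (neg_ne_zero.2 hκ₂) (exists_ker_ne_zero ha0 na.1)
    (exists_ker_ne_zero hb0 nb.1) H₃ H₂'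
  have v2 := pencils_of_quadrics S₂ hκ₁ (neg_ne_zero.2 hκ₃) (exists_ker_ne_zero ha0 na.2.1)
    (exists_ker_ne_zero hb0 nb.2.1) H₁ H₃'
  have v3 := pencils_of_quadrics S₃ hκ₂ (neg_ne_zero.2 hκ₁) (exists_ker_ne_zero ha0 na.2.2)
    (exists_ker_ne_zero hb0 nb.2.2) H₂ H₁'
  have s1 := fun c => (⟨IsCombination.symm, IsCombination.symm⟩ :
    IsCombination c h₁ h₂ ↔ IsCombination c h₂ h₁)
  have s2 := fun c => (⟨IsCombination.symm, IsCombination.symm⟩ :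
    IsCombination c h₂ h₃ ↔ IsCombination c h₃ h₂)
  have s3 := fun c => (⟨IsCombination.symm, IsCombination.symm⟩ :
    IsCombination c h₃ h₁ ↔ IsCombination c h₁ h₃)
  -- No pencil spanned by two of the `hᵢ` contains both planes. Yet at each index the two incident
  -- pencils contain different planes, so following the triangle of pencils once around returns to
  -- its start with the wrong plane.
  have p1 := fun x y => v1.2 (isCombination_of_pencil (h' := h₂) hab x y)
  have p2 := fun x y => v2.2 (isCombination_of_pencil (h' := h₃) hab x y)
  have p3 := fun x y => v3.2 (isCombination_of_pencil (h' := h₁) hab x y)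
  rw [← s1, ← s1] at v2
  rw [← s2, ← s2] at v3
  rw [← s3, ← s3] at v1
  tauto

end linearForms

/-! ### Adapted coordinates of the image planes -/

/-- In suitable common coordinates of the image plane the cameras `P` and `Q` are given by the
linear forms `p j` and `d j`, respectively. -/
def Adapted (P Q : Camera) (p d : Fin 3 → Fin 4 → ℝ) : Prop :=
  ∃ (e : (Fin 3 → ℂ) ≃ₗ[ℂ] (Fin 3 → ℂ)) (c : ℂ), c ≠ 0 ∧
    (∀ u, P.toLin u = e fun j => complexify (p j) ⬝ᵥ u) ∧
    ∀ v, Q.toLin v = c • e fun j => complexify (d j) ⬝ᵥ v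

/-- The forms `d` determine a point up to the center `k` of `Q`, with section `M`. So `Q` factors as
`Q M` times `d`, where `Q M` is an invertible change of image coordinates that is then undone in
`P`. -/
theorem exists_adapted (P Q : Camera) (d : Fin 3 → Fin 4 → ℝ) (M : Matrix (Fin 4) (Fin 3) ℝ)
    {k : Fin 4 → ℝ} (hk : Q.mat *ᵥ k = 0)
    (h : ∀ v : Fin 4 → ℝ, ∃ c : ℝ, v = c • k + M *ᵥ fun j => d j ⬝ᵥ v) :
    ∃ p, Adapted P Q p d := by
  set G := Q.mat * M with hG
  have hQ : Q.mat = G * Matrix.of d := by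
    refine Matrix.ext_of_mulVec_single fun j => ?_
    obtain ⟨c, hc⟩ := h (Pi.single j 1)
    have h1 := congrArg (Q.mat *ᵥ ·) hc
    simp only [Matrix.mulVec_add, Matrix.mulVec_smul, hk, smul_zero, zero_add] at h1
    rw [h1, ← Matrix.mulVec_mulVec, hG, Matrix.mulVec_mulVec]
    rfl
  have hQc : ∀ v, Q.toLin v =
      G.map (algebraMap ℝ ℂ) *ᵥ fun j => complexify (d j) ⬝ᵥ v := fun v => by
    rw [Q.toLin_apply, hQ, Matrix.map_mul, ← Matrix.mulVec_mulVec]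
    congr 1
  have hGc : IsUnit (G.map (algebraMap ℝ ℂ)) := by
    rw [← Matrix.mulVec_surjective_iff_isUnit]
    intro z
    obtain ⟨v, hv⟩ := Q.toLin_surjective z
    exact ⟨_, (hQc v).symm.trans hv⟩
  have hGu : IsUnit G.det := by
    rw [Matrix.isUnit_iff_isUnit_det, det_map_algebraMap, isUnit_iff_ne_zero] at hGc
    rw [isUnit_iff_ne_zero]
    exact_mod_cast hGc
  have hGi : Function.Bijective (G.map (algebraMap ℝ ℂ)).mulVecLin :=
    ⟨Matrix.mulVec_injective_iff_isUnit.2 hGc, Matrix.mulVec_surjective_iff_isUnit.2 hGc⟩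
  refine ⟨G⁻¹ * P.mat, LinearEquiv.ofBijective _ hGi, 1, one_ne_zero, fun u => ?_, fun v => ?_⟩
  · have h1 : P.mat = G * (G⁻¹ * P.mat) := by
      rw [← Matrix.mul_assoc, Matrix.mul_nonsing_inv _ hGu, Matrix.one_mul]
    rw [P.toLin_apply]
    conv_lhs => rw [h1, Matrix.map_mul, ← Matrix.mulVec_mulVec]
    simp only [LinearEquiv.ofBijective_apply, Matrix.mulVecLin_apply]
    congr 1
  · rw [hQc, one_smul]
    rfl

/-- The `l j` rescale the common image coordinates; `μ` rescales the matrix of `P` alone, which does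
not change the projective camera. -/
theorem Adapted.scale {P Q : Camera} {p d : Fin 3 → Fin 4 → ℝ} (H : Adapted P Q p d)
    {μ : ℝ} (hμ : μ ≠ 0) {l : Fin 3 → ℝ} (hl : ∀ j, l j ≠ 0) :
    Adapted P Q (fun j => (l j * μ) • p j) fun j => l j • d j := by
  obtain ⟨e, c, hc, h1, h2⟩ := H
  have hμc : (μ : ℂ) ≠ 0 := by exact_mod_cast hμ
  have hlc : ∀ j, (l j : ℂ) ≠ 0 := fun j => by exact_mod_cast hl j
  refine ⟨(LinearEquiv.piCongrRight fun j =>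
      LinearEquiv.smulOfNeZero ℂ ℂ ((l j : ℂ) * μ)⁻¹ (inv_ne_zero (mul_ne_zero (hlc j) hμc))).trans e,
    c * μ, mul_ne_zero hc hμc, fun u => ?_, fun v => ?_⟩
  · rw [h1, LinearEquiv.trans_apply]
    congr 1
    ext j
    simp only [LinearEquiv.piCongrRight_apply, LinearEquiv.smulOfNeZero_apply, complexify_smul,
      smul_dotProduct, smul_eq_mul]
    push_cast
    rw [inv_mul_cancel_left₀ (mul_ne_zero (hlc j) hμc)]
  · rw [h2, LinearEquiv.trans_apply, mul_smul]
    congr 1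
    rw [← map_smul e]
    congr 1
    ext j
    simp only [LinearEquiv.piCongrRight_apply, LinearEquiv.smulOfNeZero_apply, complexify_smul,
      smul_dotProduct, smul_eq_mul, Pi.smul_apply]
    field_simp [hlc j]

theorem Adapted.isSurjectiveTriple {P Q : Camera} {f g h : Fin 4 → ℝ}
    {d : Fin 3 → Fin 4 → ℝ} (H : Adapted P Q ![f, g, h] d) :
    IsSurjectiveTriple (dotProductEquiv ℂ (Fin 4) (complexify f))
      (dotProductEquiv ℂ (Fin 4) (complexify g)) (dotProductEquiv ℂ (Fin 4) (complexify h)) := by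
  obtain ⟨e, c, hc, h1, h2⟩ := H
  intro x y z
  obtain ⟨u, hu⟩ := P.toLin_surjective (e ![x, y, z])
  rw [h1] at hu
  have := e.injective hu
  exact ⟨u, by simpa using congrFun this 0, by simpa using congrFun this 1,
    by simpa using congrFun this 2⟩

theorem Adapted.toLin_eq_zero_iff {P Q : Camera} {f g h : Fin 4 → ℝ}
    {d : Fin 3 → Fin 4 → ℝ} (H : Adapted P Q ![f, g, h] d) (u : Fin 4 → ℂ) :
    P.toLin u = 0 ↔ complexify f ⬝ᵥ u = 0 ∧ complexify g ⬝ᵥ u = 0 ∧ complexify h ⬝ᵥ u = 0 := by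
  obtain ⟨e, c, hc, h1, h2⟩ := H
  rw [h1, LinearEquiv.map_eq_zero_iff, funext_iff]
  simp [Fin.forall_fin_succ]

/-- Dependence of two images, in the adapted coordinates. -/
theorem Adapted.dependent_iff {P Q : Camera} {f g h f' g' h' : Fin 4 → ℝ}
    (H : Adapted P Q ![f, g, h] ![f', g', h']) (u v : Fin 4 → ℂ) :
    (∃ s t : ℂ, (s ≠ 0 ∨ t ≠ 0) ∧ s • P.toLin u = t • Q.toLin v) ↔
      (complexify g ⬝ᵥ u) * (complexify h' ⬝ᵥ v) = (complexify h ⬝ᵥ u) * (complexify g' ⬝ᵥ v) ∧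
      (complexify h ⬝ᵥ u) * (complexify f' ⬝ᵥ v) = (complexify f ⬝ᵥ u) * (complexify h' ⬝ᵥ v) ∧
      (complexify f ⬝ᵥ u) * (complexify g' ⬝ᵥ v) =
        (complexify g ⬝ᵥ u) * (complexify f' ⬝ᵥ v) := by
  obtain ⟨e, c, hc, h1, h2⟩ := H
  have key : (∃ s t : ℂ, (s ≠ 0 ∨ t ≠ 0) ∧ s • P.toLin u = t • Q.toLin v) ↔
      ∃ s t : ℂ, (s ≠ 0 ∨ t ≠ 0) ∧
        s • (fun j => complexify (![f, g, h] j) ⬝ᵥ u) =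
          t • (fun j => complexify (![f', g', h'] j) ⬝ᵥ v) := by
    constructor
    · rintro ⟨s, t, hst, h⟩
      refine ⟨s, t * c, by simpa [hc] using hst, e.injective ?_⟩
      rw [map_smul, map_smul, ← h1, mul_smul, ← h2, h]
    · rintro ⟨s, t, hst, h⟩
      refine ⟨s, t * c⁻¹, by simpa [hc] using hst, ?_⟩
      rw [h1, h2, mul_smul, inv_smul_smul₀ hc, ← map_smul, ← map_smul, h]
  rw [key]
  have hcross : ∀ x y : Fin 3 → ℂ, (∃ s t : ℂ, (s ≠ 0 ∨ t ≠ 0) ∧ s • x = t • y) ↔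
      x ⨯₃ y = 0 := fun x y => by
    constructor
    · rintro ⟨s, t, hst, h⟩
      have e1 := congrArg (x ⨯₃ ·) h
      have e2 := congrArg (· ⨯₃ y) h
      simp only [map_smul, cross_self, smul_zero, LinearMap.smul_apply] at e1 e2
      rcases hst with hs | ht
      · exact (smul_eq_zero.1 e2).resolve_left hs
      · exact (smul_eq_zero.1 e1.symm).resolve_left ht
    · intro h
      by_cases hx : x = 0
      · exact ⟨1, 0, Or.inl one_ne_zero, by simp [hx]⟩
      · obtain ⟨c, hc⟩ := exists_eq_smul_of_crossProduct_eq_zero hx h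
        exact ⟨c, 1, Or.inr one_ne_zero, by rw [hc, one_smul]⟩
  rw [hcross, cross_apply, funext_iff]
  simp [Fin.forall_fin_succ, sub_eq_zero]

/-- The epipolar constraint, in the adapted coordinates. -/
theorem mk_mem_viewQuadric_iff_of_adapted {n : ℕ} {P Q : Fin n → Camera} {i j : Fin n}
    {p d p' d' : Fin 3 → Fin 4 → ℝ} (hi : Adapted (P i) (Q i) p d)
    (hj : Adapted (P j) (Q j) p' d') {u : Fin 4 → ℂ} (hu : u ≠ 0) :
    Projectivization.mk ℂ u hu ∈ viewQuadric P Q i j ↔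
      ∃ (w : Fin 4 → ℂ) (s t : ℂ), (w ≠ 0 ∨ s ≠ 0 ∨ t ≠ 0) ∧
        (∀ k, complexify (d k) ⬝ᵥ w = s * (complexify (p k) ⬝ᵥ u)) ∧
        ∀ k, complexify (d' k) ⬝ᵥ w = t * (complexify (p' k) ⬝ᵥ u) := by
  obtain ⟨e, c, hc, h1, h2⟩ := hi
  obtain ⟨e', c', hc', h1', h2'⟩ := hj
  rw [mk_mem_viewQuadric]
  constructor
  · rintro ⟨w, s, t, hne, hs, ht⟩
    refine ⟨w, c⁻¹ * s, c'⁻¹ * t, by simpa [hc, hc'] using hne, congrFun ?_, congrFun ?_⟩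
    · apply e.injective
      have : (fun k => c⁻¹ * s * (complexify (p k) ⬝ᵥ u)) =
        (c⁻¹ * s) • (fun k => complexify (p k) ⬝ᵥ u) := rfl
      rw [this, map_smul, ← h1, mul_smul, ← hs, h2, inv_smul_smul₀ hc]
    · apply e'.injective
      have : (fun k => c'⁻¹ * t * (complexify (p' k) ⬝ᵥ u)) =
        (c'⁻¹ * t) • (fun k => complexify (p' k) ⬝ᵥ u) := rfl
      rw [this, map_smul, ← h1', mul_smul, ← ht, h2', inv_smul_smul₀ hc']
  · rintro ⟨w, s, t, hne, hs, ht⟩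
    refine ⟨w, c * s, c' * t, by simpa [hc, hc'] using hne, ?_, ?_⟩
    · rw [h2, h1, mul_smul, ← map_smul e s]
      congr 2
      exact funext hs
    · rw [h2', h1', mul_smul, ← map_smul e' t]
      congr 2
      exact funext ht

theorem Adapted.flip {P Q : Camera} {p d : Fin 3 → Fin 4 → ℝ} (H : Adapted P Q p d) :
    Adapted Q P d p := by
  obtain ⟨e, c, hc, h1, h2⟩ := H
  refine ⟨(LinearEquiv.smulOfNeZero ℂ _ c hc).trans e, c⁻¹, inv_ne_zero hc, fun v => ?_,
    fun u => ?_⟩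
  · rw [h2, LinearEquiv.trans_apply, LinearEquiv.smulOfNeZero_apply, map_smul]
  · rw [h1, LinearEquiv.trans_apply, LinearEquiv.smulOfNeZero_apply, map_smul,
      inv_smul_smul₀ hc]

theorem exists_real_smul {r s : Fin 4 → ℝ} (hs : s ≠ 0) {z : ℂ}
    (h : complexify r = z • complexify s) : ∃ x : ℝ, r = x • s := by
  obtain ⟨j, hj⟩ := Function.ne_iff.1 hs
  have hj' : (s j : ℂ) ≠ 0 := by exact_mod_cast hj
  have hz : z = ((r j / s j : ℝ) : ℂ) := by
    have := congrFun h j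
    simp only [complexify, Pi.smul_apply, smul_eq_mul] at this
    push_cast
    rw [eq_div_iff hj', this]
  refine ⟨r j / s j, ?_⟩
  ext k
  have := congrFun h k
  simp only [complexify, Pi.smul_apply, smul_eq_mul, hz] at this
  exact_mod_cast this

/-- The common factor `h` is cancelled. This step transfers reality to the plane equation `a`, which
is a priori complex. -/
theorem complexify_eq_smul_of_mul_eq {x h : Fin 4 → ℝ} {a : Fin 4 → ℂ} {c : ℂ} (hh : h ≠ 0)
    (H : ∀ u, (complexify h ⬝ᵥ u) * (complexify x ⬝ᵥ u) = c * ((a ⬝ᵥ u) * (complexify h ⬝ᵥ u))) :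
    complexify x = c • a := by
  rcases forall_eq_zero_or_of_mul_eq_zero ⊤ (dotProductEquiv ℂ (Fin 4) (complexify h))
    (dotProductEquiv ℂ (Fin 4) (complexify x - c • a)) (fun u _ => by
      simp only [dotProductEquiv_apply_apply, sub_dotProduct, smul_dotProduct, smul_eq_mul]
      linear_combination H u) with h1 | h1
  · refine absurd (complexify_eq_zero.1 ?_) hh
    apply (dotProductEquiv ℂ (Fin 4)).injective
    rw [map_zero]
    exact LinearMap.ext fun u => h1 u trivial
  · rw [← sub_eq_zero]
    apply (dotProductEquiv ℂ (Fin 4)).injective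
    rw [map_zero]
    exact LinearMap.ext fun u => h1 u trivial

theorem exists_mul_eq_mul_of_det_eq_zero {F : Type*} [Field F] {a b c d : F}
    (h : a * d - b * c = 0) :
    ∃ s t : F, (s ≠ 0 ∨ t ≠ 0) ∧ s * a = t * c ∧ s * b = t * d := by
  by_cases hc : c = 0
  · by_cases hd : d = 0
    · exact ⟨0, 1, Or.inr one_ne_zero, by simp [hc], by simp [hd]⟩
    · exact ⟨d, b, Or.inl hd, by linear_combination h, by ring⟩
  · exact ⟨c, a, Or.inl hc, by ring, by linear_combination -h⟩

/-- Two consecutive views of three views in adapted coordinates: the quadric of the epipolar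
constraint. -/
theorem mk_mem_viewQuadric_iff_of_adapted_pair {P Q : Fin 3 → Camera} {i j : Fin 3}
    {f g h f' g' h' d₁ d₂ d₃ d₄ : Fin 4 → ℝ}
    (hsurj : ∀ y₁ y₂ y₃ y₄ : ℂ, ∃ w : Fin 4 → ℂ, complexify d₁ ⬝ᵥ w = y₁ ∧
      complexify d₂ ⬝ᵥ w = y₂ ∧ complexify d₃ ⬝ᵥ w = y₃ ∧ complexify d₄ ⬝ᵥ w = y₄)
    (hinj : ∀ w : Fin 4 → ℂ, complexify d₁ ⬝ᵥ w = 0 → complexify d₂ ⬝ᵥ w = 0 →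
      complexify d₃ ⬝ᵥ w = 0 → complexify d₄ ⬝ᵥ w = 0 → w = 0)
    (hi : Adapted (P i) (Q i) ![f, g, h] ![d₂, d₃, d₄])
    (hj : Adapted (P j) (Q j) ![f', g', h'] ![d₃, d₁, d₄]) {u : Fin 4 → ℂ} (hu : u ≠ 0) :
    Projectivization.mk ℂ u hu ∈ viewQuadric P Q i j ↔
      (complexify g ⬝ᵥ u) * (complexify h' ⬝ᵥ u) -
        (complexify h ⬝ᵥ u) * (complexify f' ⬝ᵥ u) = 0 := by
  rw [mk_mem_viewQuadric_iff_of_adapted hi hj]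
  simp only [Fin.forall_fin_succ, Matrix.cons_val_zero, Matrix.cons_val_succ,
    IsEmpty.forall_iff, and_true]
  -- The two views share only the coordinates `d₃` and `d₄`. Meeting rays amount to `s (g, h) = t
  -- (f', h')`, a 2×2 determinant; the other two coordinates impose no condition.
  constructor
  · rintro ⟨w, s, t, hne, ⟨e1, e2, e3⟩, e4, e5, e6⟩
    by_cases hs : s = 0
    · by_cases ht : t = 0
      · subst hs ht
        rw [zero_mul] at e1 e2 e3 e4 e5 e6
        simp [hinj w e5 e1 e2 e3] at hne
      · have : t * ((complexify g ⬝ᵥ u) * (complexify h' ⬝ᵥ u) -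
            (complexify h ⬝ᵥ u) * (complexify f' ⬝ᵥ u)) = 0 := by
          linear_combination (complexify g ⬝ᵥ u) * (e3 - e6) - (complexify h ⬝ᵥ u) * (e2 - e4)
        exact (mul_eq_zero.1 this).resolve_left ht
    · have : s * ((complexify g ⬝ᵥ u) * (complexify h' ⬝ᵥ u) -
            (complexify h ⬝ᵥ u) * (complexify f' ⬝ᵥ u)) = 0 := by
          linear_combination (complexify f' ⬝ᵥ u) * (e3 - e6) - (complexify h' ⬝ᵥ u) * (e2 - e4)
      exact (mul_eq_zero.1 this).resolve_left hs
  · intro H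
    obtain ⟨s, t, hst, e1, e2⟩ := exists_mul_eq_mul_of_det_eq_zero H
    obtain ⟨w, w1, w2, w3, w4⟩ := hsurj (t * (complexify g' ⬝ᵥ u)) (s * (complexify f ⬝ᵥ u))
      (s * (complexify g ⬝ᵥ u)) (s * (complexify h ⬝ᵥ u))
    exact ⟨w, s, t, Or.inr hst, ⟨w2, w3, w4⟩, w3.trans e1, w1, w4.trans e2⟩

/-! ### The normal form of three views -/

/-- Normal form for three views whose three quadrics are the same pair of planes, once it is known
that the trifocal plane corresponds to the plane `b = 0`. -/
theorem exists_normal_form_aux {P Q : Fin 3 → Camera} {f₀ g₀ h₀ f₁ g₁ h₁ f₂ g₂ h₂ d₁ d₂ d₃ d₄ :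
    Fin 4 → ℝ} (H₀ : Adapted (P 0) (Q 0) ![f₀, g₀, h₀] ![d₂, d₃, d₄])
    (H₁ : Adapted (P 1) (Q 1) ![f₁, g₁, h₁] ![d₃, d₁, d₄])
    (H₂ : Adapted (P 2) (Q 2) ![f₂, g₂, h₂] ![d₁, d₂, d₄])
    {a b : Fin 4 → ℂ} (ha0 : a ≠ 0) {κ₀₁ κ₁₂ κ₂₀ : ℂ} (hκ₀₁ : κ₀₁ ≠ 0) (hκ₁₂ : κ₁₂ ≠ 0) (hκ₂₀ : κ₂₀ ≠ 0)
    (E₀₁ : ∀ u, (complexify g₀ ⬝ᵥ u) * (complexify h₁ ⬝ᵥ u) -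
      (complexify h₀ ⬝ᵥ u) * (complexify f₁ ⬝ᵥ u) = κ₀₁ * ((a ⬝ᵥ u) * (b ⬝ᵥ u)))
    (E₁₂ : ∀ u, (complexify g₁ ⬝ᵥ u) * (complexify h₂ ⬝ᵥ u) -
      (complexify h₁ ⬝ᵥ u) * (complexify f₂ ⬝ᵥ u) = κ₁₂ * ((a ⬝ᵥ u) * (b ⬝ᵥ u)))
    (E₂₀ : ∀ u, (complexify g₂ ⬝ᵥ u) * (complexify h₀ ⬝ᵥ u) -
      (complexify h₂ ⬝ᵥ u) * (complexify f₀ ⬝ᵥ u) = κ₂₀ * ((a ⬝ᵥ u) * (b ⬝ᵥ u)))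
    {c₀ c₁ c₂ : ℂ} (hc₀ : complexify h₀ = c₀ • b) (hc₁ : complexify h₁ = c₁ • b)
    (hc₂ : complexify h₂ = c₂ • b) :
    ∃ (r₁ r₂ r₃ A B : Fin 4 → ℝ) (ν₁ ν₂ : ℝ), ν₁ ≠ 0 ∧ ν₂ ≠ 0 ∧
      Adapted (P 0) (Q 0) ![r₂, r₃ + A, B] ![ν₂ • d₂, d₃, d₄] ∧
      Adapted (P 1) (Q 1) ![r₃, r₁ + A, B] ![d₃, ν₁ • d₁, d₄] ∧
      Adapted (P 2) (Q 2) ![r₁, r₂ + A, B] ![ν₁ • d₁, ν₂ • d₂, d₄] ∧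
      ∃ x y : ℂ, x ≠ 0 ∧ y ≠ 0 ∧ complexify A = x • a ∧ complexify B = y • b := by
  have hne : ∀ {P Q : Camera} {f g h : Fin 4 → ℝ} {d : Fin 3 → Fin 4 → ℝ},
      Adapted P Q ![f, g, h] d → h ≠ 0 := by
    rintro P Q f g h d H rfl
    obtain ⟨u, -, -, h1⟩ := H.isSurjectiveTriple 0 0 1
    simp [complexify_eq_zero.2 rfl] at h1
  have hh₀ := hne H₀
  have hh₁ := hne H₁
  have hh₂ := hne H₂
  have hc₀0 : c₀ ≠ 0 := by
    rintro rfl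
    exact hh₀ (complexify_eq_zero.1 (by rw [hc₀, zero_smul]))
  have hcb : b = c₀⁻¹ • complexify h₀ := by rw [hc₀, inv_smul_smul₀ hc₀0]
  obtain ⟨μ₁, rfl⟩ := exists_real_smul (r := h₁) hh₀ (z := c₁ * c₀⁻¹) (by
    rw [hc₁, mul_smul, ← hcb])
  obtain ⟨μ₂, rfl⟩ := exists_real_smul (r := h₂) hh₀ (z := c₂ * c₀⁻¹) (by
    rw [hc₂, mul_smul, ← hcb])
  have hμ₁ : μ₁ ≠ 0 := left_ne_zero_of_smul hh₁
  have hμ₂ : μ₂ ≠ 0 := left_ne_zero_of_smul hh₂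
  have hμ₁c : (μ₁ : ℂ) ≠ 0 := by exact_mod_cast hμ₁
  have hμ₂c : (μ₂ : ℂ) ≠ 0 := by exact_mod_cast hμ₂
  simp only [complexify_smul, smul_dotProduct, smul_eq_mul, hcb] at E₀₁ E₁₂ E₂₀
  -- Once the `hᵢ` are multiples of `h₀`, that factor cancels from each quadric, leaving three real
  -- forms that are multiples of `a`.
  have A₀ : complexify (g₀ - μ₁⁻¹ • f₁) = (κ₀₁ * c₀⁻¹ * (μ₁ : ℂ)⁻¹) • a :=
    complexify_eq_smul_of_mul_eq hh₀ fun u => by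
      simp only [complexify_sub, complexify_smul, sub_dotProduct, smul_dotProduct, smul_eq_mul,
        Complex.ofReal_inv]
      linear_combination (μ₁ : ℂ)⁻¹ * E₀₁ u - (complexify g₀ ⬝ᵥ u) * (complexify h₀ ⬝ᵥ u) *
        (inv_mul_cancel₀ hμ₁c)
  have A₁ : complexify (μ₁⁻¹ • g₁ - μ₂⁻¹ • f₂) =
      (κ₁₂ * c₀⁻¹ * (μ₁ : ℂ)⁻¹ * (μ₂ : ℂ)⁻¹) • a :=
    complexify_eq_smul_of_mul_eq hh₀ fun u => by
      simp only [complexify_sub, complexify_smul, sub_dotProduct, smul_dotProduct, smul_eq_mul,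
        Complex.ofReal_inv]
      linear_combination (μ₁ : ℂ)⁻¹ * (μ₂ : ℂ)⁻¹ * E₁₂ u -
        (complexify g₁ ⬝ᵥ u) * (complexify h₀ ⬝ᵥ u) * (μ₁ : ℂ)⁻¹ * (inv_mul_cancel₀ hμ₂c) +
        (complexify f₂ ⬝ᵥ u) * (complexify h₀ ⬝ᵥ u) * (μ₂ : ℂ)⁻¹ * (inv_mul_cancel₀ hμ₁c)
  have A₂ : complexify (μ₂⁻¹ • g₂ - f₀) = (κ₂₀ * c₀⁻¹ * (μ₂ : ℂ)⁻¹) • a :=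
    complexify_eq_smul_of_mul_eq hh₀ fun u => by
      simp only [complexify_sub, complexify_smul, sub_dotProduct, smul_dotProduct, smul_eq_mul,
        Complex.ofReal_inv]
      linear_combination (μ₂ : ℂ)⁻¹ * E₂₀ u + (complexify f₀ ⬝ᵥ u) * (complexify h₀ ⬝ᵥ u) *
        (inv_mul_cancel₀ hμ₂c)
  set A := g₀ - μ₁⁻¹ • f₁ with hA
  have hx : κ₀₁ * c₀⁻¹ * (μ₁ : ℂ)⁻¹ ≠ 0 := by simp [hκ₀₁, hc₀0, hμ₁]
  have hA0 : A ≠ 0 := fun h => by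
    rw [h, complexify_eq_zero.2 rfl, eq_comm, smul_eq_zero] at A₀
    exact A₀.elim hx ha0
  have haA : a = (κ₀₁ * c₀⁻¹ * (μ₁ : ℂ)⁻¹)⁻¹ • complexify A := by rw [A₀, inv_smul_smul₀ hx]
  obtain ⟨ν₁, hν₁⟩ := exists_real_smul (r := μ₁⁻¹ • g₁ - μ₂⁻¹ • f₂) hA0
    (by rw [A₁, haA, smul_smul])
  obtain ⟨ν₂, hν₂⟩ := exists_real_smul (r := μ₂⁻¹ • g₂ - f₀) hA0
    (by rw [A₂, haA, smul_smul])
  have hν₁0 : ν₁ ≠ 0 := by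
    rintro rfl
    rw [hν₁, zero_smul, complexify_eq_zero.2 rfl, eq_comm, smul_eq_zero] at A₁
    simp [ha0, hκ₁₂, hc₀0, hμ₁, hμ₂] at A₁
  have hν₂0 : ν₂ ≠ 0 := by
    rintro rfl
    rw [hν₂, zero_smul, complexify_eq_zero.2 rfl, eq_comm, smul_eq_zero] at A₂
    simp [ha0, hκ₂₀, hc₀0, hμ₂] at A₂
  have hl : ∀ {x y z : ℝ}, x ≠ 0 → y ≠ 0 → z ≠ 0 → ∀ j : Fin 3, ![x, y, z] j ≠ 0 := by
    intro x y z hx hy hz j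
    fin_cases j <;> assumption
  -- The `μ`'s make the third forms equal to `h₀`; the `ν`'s make all three differences equal to one
  -- form `A`, at the cost of rescaling `d₁` and `d₂`.
  have R₀ := H₀.scale one_ne_zero (hl (inv_ne_zero hν₂0) one_ne_zero one_ne_zero)
  have R₁ := H₁.scale (inv_ne_zero hμ₁) (hl one_ne_zero (inv_ne_zero hν₁0) one_ne_zero)
  have R₂ := H₂.scale (inv_ne_zero hμ₂)
    (hl (inv_ne_zero hν₁0) (inv_ne_zero hν₂0) one_ne_zero)
  refine ⟨(ν₁⁻¹ * μ₂⁻¹) • f₂, ν₂⁻¹ • f₀, μ₁⁻¹ • f₁, A, h₀, ν₁⁻¹, ν₂⁻¹, inv_ne_zero hν₁0,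
    inv_ne_zero hν₂0, ?_, ?_, ?_, _, _, hx, hc₀0, A₀, hc₀⟩
  · convert R₀ using 1
    · ext j k
      fin_cases j <;> simp [hA]
    · ext j k
      fin_cases j <;> simp
  · have e1 : (ν₁⁻¹ * μ₂⁻¹) • f₂ + A = (ν₁⁻¹ * μ₁⁻¹) • g₁ := by
      rw [(eq_inv_smul_iff₀ hν₁0).2 hν₁.symm]
      module
    convert R₁ using 1
    · ext j k
      fin_cases j <;> simp [e1, hμ₁]
    · ext j k
      fin_cases j <;> simp
  · have e1 : ν₂⁻¹ • f₀ + A = (ν₂⁻¹ * μ₂⁻¹) • g₂ := by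
      rw [(eq_inv_smul_iff₀ hν₂0).2 hν₂.symm]
      module
    convert R₂ using 1
    · ext j k
      fin_cases j <;> simp [e1, hμ₂]
    · ext j k
      fin_cases j <;> simp

/-- Vectors representing independent points are independent. -/
theorem linearIndependent_of_independent_mk {ι : Type*} {v : ι → Fin 4 → ℂ} (hv : ∀ i, v i ≠ 0)
    (h : Projectivization.Independent fun i => Projectivization.mk ℂ (v i) (hv i)) :
    LinearIndependent ℂ v := by
  rw [Projectivization.independent_iff] at h
  choose a ha using fun i => Projectivization.exists_smul_eq_mk_rep ℂ (v i) (hv i)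
  rw [← LinearIndependent.units_smul_iff v a]
  have e : a • v = Projectivization.rep ∘ fun i => Projectivization.mk ℂ (v i) (hv i) := funext ha
  rw [e]
  exact h

theorem linearIndependent_of_complexify {n k : ℕ} {v : Fin n → Fin k → ℝ}
    (h : LinearIndependent ℂ fun i => complexify (v i)) : LinearIndependent ℝ v := by
  rw [Fintype.linearIndependent_iff] at h ⊢
  intro g hg i
  have h1 : ∑ i, (g i : ℂ) • complexify (v i) = 0 := by
    have := complexify_eq_zero.2 hg
    rw [← this]
    ext j
    simp [complexify, Finset.sum_apply]
  exact_mod_cast h _ h1 i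

/-- Real vectors spanning the kernels of a tuple of cameras with independent centers. -/
theorem exists_real_centers {n : ℕ} (P : Fin n → Camera) :
    ∃ k : Fin n → Fin 4 → ℝ, (∀ i, k i ≠ 0) ∧ (∀ i, (P i).mat *ᵥ k i = 0) ∧
      (Projectivization.Independent (centers P) → LinearIndependent ℝ k) := by
  choose k hk hPk using fun i => (P i).exists_real_center
  have hkc : ∀ i, complexify (k i) ≠ 0 := fun i h => hk i (complexify_eq_zero.1 h)
  refine ⟨k, hk, hPk, fun h => linearIndependent_of_complexify
    (linearIndependent_of_independent_mk hkc ?_)⟩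
  convert h using 1
  ext1 i
  refine (((P i).center_eq_mk_iff (hkc i)).2 ?_).symm
  rw [Camera.toLin_complexify, hPk, complexify_eq_zero.2 rfl]

/-- Coordinates in which three given independent vectors are the first three basis vectors. -/
theorem exists_dual_coordinates {k : Fin 3 → Fin 4 → ℝ} (hk : LinearIndependent ℝ k) :
    ∃ (N : Matrix (Fin 4) (Fin 4) ℝ) (e : Fin 4 → ℝ), IsUnit N ∧
      ∀ v, v = (N 0 ⬝ᵥ v) • k 0 + (N 1 ⬝ᵥ v) • k 1 + (N 2 ⬝ᵥ v) • k 2 + (N 3 ⬝ᵥ v) • e := by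
  obtain ⟨e, he⟩ := exists_linearIndependent_snoc_of_lt_finrank hk (by simp)
  have hW : IsUnit (Matrix.of (Fin.snoc k e : Fin 4 → Fin 4 → ℝ)) :=
    Matrix.linearIndependent_rows_iff_isUnit.1 he
  set W := Matrix.of (Fin.snoc k e : Fin 4 → Fin 4 → ℝ) with hWdef
  have hWt : IsUnit Wᵀ := (Matrix.isUnit_transpose W).2 hW
  refine ⟨(Wᵀ)⁻¹, e, Matrix.isUnit_nonsing_inv_iff.2 hWt, fun v => ?_⟩
  have h1 : Wᵀ *ᵥ ((Wᵀ)⁻¹ *ᵥ v) = v := by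
    rw [Matrix.mulVec_mulVec, Matrix.mul_nonsing_inv _ ((Matrix.isUnit_iff_isUnit_det _).1 hWt),
      Matrix.one_mulVec]
  rw [Matrix.mulVec_transpose, Matrix.vecMul_eq_sum, Fin.sum_univ_four] at h1
  exact h1.symm

theorem of_transpose_mulVec (x y z : Fin 4 → ℝ) (c : Fin 3 → ℝ) :
    (Matrix.of ![x, y, z])ᵀ *ᵥ c = c 0 • x + c 1 • y + c 2 • z := by
  rw [Matrix.mulVec_transpose, Matrix.vecMul_eq_sum, Fin.sum_univ_three]
  rfl

theorem isUnit_map_algebraMap {k : ℕ} {N : Matrix (Fin k) (Fin k) ℝ} (hN : IsUnit N) :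
    IsUnit (N.map (algebraMap ℝ ℂ)) := by
  rw [Matrix.isUnit_iff_isUnit_det, isUnit_iff_ne_zero] at hN ⊢
  rw [det_map_algebraMap]
  exact_mod_cast hN

theorem coordinates_surjective {N : Matrix (Fin 4) (Fin 4) ℝ} (hN : IsUnit N)
    (y₁ y₂ y₃ y₄ : ℂ) : ∃ w : Fin 4 → ℂ, complexify (N 0) ⬝ᵥ w = y₁ ∧
      complexify (N 1) ⬝ᵥ w = y₂ ∧ complexify (N 2) ⬝ᵥ w = y₃ ∧ complexify (N 3) ⬝ᵥ w = y₄ := by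
  obtain ⟨w, hw⟩ := Matrix.mulVec_surjective_iff_isUnit.2 (isUnit_map_algebraMap hN)
    ![y₁, y₂, y₃, y₄]
  refine ⟨w, ?_, ?_, ?_, ?_⟩ <;> rw [← map_mulVec_apply, hw] <;> rfl

theorem coordinates_injective {N : Matrix (Fin 4) (Fin 4) ℝ} (hN : IsUnit N) (w : Fin 4 → ℂ)
    (h0 : complexify (N 0) ⬝ᵥ w = 0) (h1 : complexify (N 1) ⬝ᵥ w = 0)
    (h2 : complexify (N 2) ⬝ᵥ w = 0) (h3 : complexify (N 3) ⬝ᵥ w = 0) : w = 0 := by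
  apply Matrix.mulVec_injective_iff_isUnit.2 (isUnit_map_algebraMap hN)
  rw [Matrix.mulVec_zero]
  ext j
  rw [map_mulVec_apply]
  fin_cases j <;> assumption

/-- Three views whose three quadrics are the same pair of planes have adapted coordinates in which
the planes are `A = 0` and `B = 0`. -/
theorem exists_normal_form {P Q : Fin 3 → Camera} (hQ : Projectivization.Independent (centers Q))
    {a b : Fin 4 → ℂ} (hab : LinearIndependent ℂ ![a, b])
    (H : ∀ i j, i ≠ j → viewQuadric P Q i j = planeLocus a ∪ planeLocus b) :
    ∃ (r₁ r₂ r₃ A B : Fin 4 → ℝ) (N : Matrix (Fin 4) (Fin 4) ℝ), IsUnit N ∧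
      Adapted (P 0) (Q 0) ![r₂, r₃ + A, B] ![N 1, N 2, N 3] ∧
      Adapted (P 1) (Q 1) ![r₃, r₁ + A, B] ![N 2, N 0, N 3] ∧
      Adapted (P 2) (Q 2) ![r₁, r₂ + A, B] ![N 0, N 1, N 3] ∧
      ∃ x y : ℂ, x ≠ 0 ∧ y ≠ 0 ∧ ((complexify A = x • a ∧ complexify B = y • b) ∨
        (complexify A = x • b ∧ complexify B = y • a)) := by
  obtain ⟨k, hk0, hQk, hk⟩ := exists_real_centers Q
  obtain ⟨N, e, hN, hNv⟩ := exists_dual_coordinates (hk hQ)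
  obtain ⟨p₀, H₀⟩ := exists_adapted (P 0) (Q 0) ![N 1, N 2, N 3] (Matrix.of ![k 1, k 2, e])ᵀ
    (hQk 0) fun v => ⟨N 0 ⬝ᵥ v, by
      rw [of_transpose_mulVec]
      conv_lhs => rw [hNv v]
      simp only [Matrix.cons_val]
      abel⟩
  obtain ⟨p₁, H₁⟩ := exists_adapted (P 1) (Q 1) ![N 2, N 0, N 3] (Matrix.of ![k 2, k 0, e])ᵀ
    (hQk 1) fun v => ⟨N 1 ⬝ᵥ v, by
      rw [of_transpose_mulVec]
      conv_lhs => rw [hNv v]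
      simp only [Matrix.cons_val]
      abel⟩
  obtain ⟨p₂, H₂⟩ := exists_adapted (P 2) (Q 2) ![N 0, N 1, N 3] (Matrix.of ![k 0, k 1, e])ᵀ
    (hQk 2) fun v => ⟨N 2 ⬝ᵥ v, by
      rw [of_transpose_mulVec]
      conv_lhs => rw [hNv v]
      simp only [Matrix.cons_val]
      abel⟩
  have hvec : ∀ p : Fin 3 → Fin 4 → ℝ, p = ![p 0, p 1, p 2] := fun p => by
    ext j : 1
    fin_cases j <;> rfl
  rw [hvec p₀] at H₀
  rw [hvec p₁] at H₁
  rw [hvec p₂] at H₂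
  have hsurj := coordinates_surjective hN
  have hinj := coordinates_injective hN
  have hlin : ∀ a b : Fin 4 → ℂ, LinearIndependent ℂ ![a, b] → LinearIndependent ℂ
      ![dotProductEquiv ℂ (Fin 4) a, dotProductEquiv ℂ (Fin 4) b] := by
    intro a b hab
    have := hab.map' (dotProductEquiv ℂ (Fin 4)).toLinearMap (LinearEquiv.ker _)
    have e : ![dotProductEquiv ℂ (Fin 4) a, dotProductEquiv ℂ (Fin 4) b] =
        (dotProductEquiv ℂ (Fin 4)).toLinearMap ∘ ![a, b] := by
      ext1 j
      fin_cases j <;> rfl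
    rw [e]
    exact this
  have hzero : ∀ {i j : Fin 3} {f g h k : Fin 4 → ℝ}, i ≠ j →
      (∀ {u} (hu : u ≠ 0), Projectivization.mk ℂ u hu ∈ viewQuadric P Q i j ↔
      (complexify f ⬝ᵥ u) * (complexify g ⬝ᵥ u) -
        (complexify h ⬝ᵥ u) * (complexify k ⬝ᵥ u) = 0) →
      ∃ κ : ℂ, κ ≠ 0 ∧ ∀ u, (complexify f ⬝ᵥ u) * (complexify g ⬝ᵥ u) -
        (complexify h ⬝ᵥ u) * (complexify k ⬝ᵥ u) = κ * ((a ⬝ᵥ u) * (b ⬝ᵥ u)) := by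
    intro i j f g h k hij hm
    exact exists_eq_mul_of_zero_iff (f := dotProductEquiv ℂ (Fin 4) (complexify f))
      (g := dotProductEquiv ℂ (Fin 4) (complexify g))
      (h := dotProductEquiv ℂ (Fin 4) (complexify h))
      (k := dotProductEquiv ℂ (Fin 4) (complexify k)) (hlin a b hab) fun u => by
        by_cases hu : u = 0
        · simp [hu]
        · refine (hm hu).symm.trans ?_
          rw [H i j hij, Set.mem_union, mk_mem_planeLocus, mk_mem_planeLocus]
          rfl
  -- The views are taken in the cyclic order 01, 12, 20, for which the same pair lemma applies after
  -- permuting the coordinates.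
  obtain ⟨κ₀₁, hκ₀₁, E₀₁⟩ := hzero (i := 0) (j := 1) (by decide) fun hu =>
    mk_mem_viewQuadric_iff_of_adapted_pair hsurj hinj H₀ H₁ hu
  obtain ⟨κ₁₂, hκ₁₂, E₁₂⟩ := hzero (i := 1) (j := 2) (by decide) fun hu =>
    mk_mem_viewQuadric_iff_of_adapted_pair (d₁ := N 1) (d₂ := N 2) (d₃ := N 0) (d₄ := N 3)
      (fun y₁ y₂ y₃ y₄ => by
        obtain ⟨w, h1, h2, h3, h4⟩ := hsurj y₃ y₁ y₂ y₄
        exact ⟨w, h2, h3, h1, h4⟩) (fun w h1 h2 h0 h3 => hinj w h0 h1 h2 h3) H₁ H₂ hu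
  obtain ⟨κ₂₀, hκ₂₀, E₂₀⟩ := hzero (i := 2) (j := 0) (by decide) fun hu =>
    mk_mem_viewQuadric_iff_of_adapted_pair (d₁ := N 2) (d₂ := N 0) (d₃ := N 1) (d₄ := N 3)
      (fun y₁ y₂ y₃ y₄ => by
        obtain ⟨w, h1, h2, h3, h4⟩ := hsurj y₂ y₃ y₁ y₄
        exact ⟨w, h3, h1, h2, h4⟩) (fun w h2 h0 h1 h3 => hinj w h0 h1 h2 h3) H₂ H₀ hu
  have key : ∀ a b : Fin 4 → ℂ, a ≠ 0 →
      (∀ u, (complexify (p₀ 1) ⬝ᵥ u) * (complexify (p₁ 2) ⬝ᵥ u) -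
        (complexify (p₀ 2) ⬝ᵥ u) * (complexify (p₁ 0) ⬝ᵥ u) = κ₀₁ * ((a ⬝ᵥ u) * (b ⬝ᵥ u))) →
      (∀ u, (complexify (p₁ 1) ⬝ᵥ u) * (complexify (p₂ 2) ⬝ᵥ u) -
        (complexify (p₁ 2) ⬝ᵥ u) * (complexify (p₂ 0) ⬝ᵥ u) = κ₁₂ * ((a ⬝ᵥ u) * (b ⬝ᵥ u))) →
      (∀ u, (complexify (p₂ 1) ⬝ᵥ u) * (complexify (p₀ 2) ⬝ᵥ u) -
        (complexify (p₂ 2) ⬝ᵥ u) * (complexify (p₀ 0) ⬝ᵥ u) = κ₂₀ * ((a ⬝ᵥ u) * (b ⬝ᵥ u))) →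
      (∃ c₁ c₂ c₃ : ℂ,
        dotProductEquiv ℂ (Fin 4) (complexify (p₀ 2)) = c₁ • dotProductEquiv ℂ (Fin 4) b ∧
        dotProductEquiv ℂ (Fin 4) (complexify (p₁ 2)) = c₂ • dotProductEquiv ℂ (Fin 4) b ∧
        dotProductEquiv ℂ (Fin 4) (complexify (p₂ 2)) = c₃ • dotProductEquiv ℂ (Fin 4) b) →
      ∃ (r₁ r₂ r₃ A B : Fin 4 → ℝ) (N : Matrix (Fin 4) (Fin 4) ℝ), IsUnit N ∧
        Adapted (P 0) (Q 0) ![r₂, r₃ + A, B] ![N 1, N 2, N 3] ∧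
        Adapted (P 1) (Q 1) ![r₃, r₁ + A, B] ![N 2, N 0, N 3] ∧
        Adapted (P 2) (Q 2) ![r₁, r₂ + A, B] ![N 0, N 1, N 3] ∧
        ∃ x y : ℂ, x ≠ 0 ∧ y ≠ 0 ∧ complexify A = x • a ∧ complexify B = y • b := by
    rintro a b ha0 E₀₁ E₁₂ E₂₀ ⟨c₁, c₂, c₃, e1, e2, e3⟩
    simp only [← map_smul, (dotProductEquiv ℂ (Fin 4)).injective.eq_iff] at e1 e2 e3
    obtain ⟨r₁, r₂, r₃, A, B, ν₁, ν₂, hν₁, hν₂, G₀, G₁, G₂, hAB⟩ :=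
      exists_normal_form_aux H₀ H₁ H₂ ha0 hκ₀₁ hκ₁₂ hκ₂₀ E₀₁ E₁₂ E₂₀ e1 e2 e3
    refine ⟨r₁, r₂, r₃, A, B, Matrix.of ![ν₁ • N 0, ν₂ • N 1, N 2, N 3], ?_, G₀, G₁, G₂, hAB⟩
    have e : Matrix.of ![ν₁ • N 0, ν₂ • N 1, N 2, N 3] =
        Matrix.diagonal ![ν₁, ν₂, 1, 1] * N := by
      ext j k
      rw [Matrix.diagonal_mul]
      fin_cases j <;> simp
    rw [e]
    refine IsUnit.mul ?_ hN
    rw [Matrix.isUnit_iff_isUnit_det, Matrix.det_diagonal, Fin.prod_univ_four]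
    simp [hν₁, hν₂]
  -- The plane on which the third forms vanish receives the name `B`, the other one `A`.
  rcases trifocal_forms_proportional (a := dotProductEquiv ℂ (Fin 4) a)
    (b := dotProductEquiv ℂ (Fin 4) b) (hlin a b hab) H₀.isSurjectiveTriple H₁.isSurjectiveTriple
    H₂.isSurjectiveTriple hκ₁₂ hκ₂₀ hκ₀₁ E₀₁ E₁₂ E₂₀ with h | h
  · obtain ⟨r₁, r₂, r₃, A, B, M, hM, G₀, G₁, G₂, x, y, hx, hy, hA, hB⟩ :=
      key b a (hab.ne_zero 1) (fun u => by rw [E₀₁ u, mul_comm (a ⬝ᵥ u)])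
        (fun u => by rw [E₁₂ u, mul_comm (a ⬝ᵥ u)])
        (fun u => by rw [E₂₀ u, mul_comm (a ⬝ᵥ u)]) h
    exact ⟨r₁, r₂, r₃, A, B, M, hM, G₀, G₁, G₂, x, y, hx, hy, Or.inr ⟨hA, hB⟩⟩
  · obtain ⟨r₁, r₂, r₃, A, B, M, hM, G₀, G₁, G₂, x, y, hx, hy, hA, hB⟩ :=
      key a b (hab.ne_zero 0) E₀₁ E₁₂ E₂₀ h
    exact ⟨r₁, r₂, r₃, A, B, M, hM, G₀, G₁, G₂, x, y, hx, hy, Or.inl ⟨hA, hB⟩⟩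

/-! ### The algebra of matched points in normal form -/

/-- The points with coordinates `(x₁, x₂, x₃, A, b)` and `(y₁, y₂, y₃, y₄)` have common images in
three views in normal form. -/
def Matched (x₁ x₂ x₃ A b y₁ y₂ y₃ y₄ : ℂ) : Prop :=
  ((x₃ + A) * y₄ = b * y₃ ∧ b * y₂ = x₂ * y₄ ∧ x₂ * y₃ = (x₃ + A) * y₂) ∧
  ((x₁ + A) * y₄ = b * y₁ ∧ b * y₃ = x₃ * y₄ ∧ x₃ * y₁ = (x₁ + A) * y₃) ∧
  ((x₂ + A) * y₄ = b * y₂ ∧ b * y₁ = x₁ * y₄ ∧ x₁ * y₂ = (x₂ + A) * y₁)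

section Matched
variable {x₁ x₂ x₃ A b y₁ y₂ y₃ y₄ : ℂ}

/-- Two of the equations differ by `A y₄ = 0`. For `A ≠ 0` this forces `y₄ = 0`, then `b = 0` as `y
≠ 0`. The three remaining equations are a cyclic linear system in `y₁, y₂, y₃` that has a nonzero
solution only if `(x₁+A)(x₂+A)(x₃+A) = x₁x₂x₃`, and this is `A` times the conic. -/
theorem Matched.left (h : Matched x₁ x₂ x₃ A b y₁ y₂ y₃ y₄)
    (hy : ¬(y₁ = 0 ∧ y₂ = 0 ∧ y₃ = 0 ∧ y₄ = 0)) :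
    A = 0 ∨ (b = 0 ∧ x₁ * x₂ + x₂ * x₃ + x₃ * x₁ + A * (x₁ + x₂ + x₃) + A * A = 0) := by
  obtain ⟨⟨a1, a2, a3⟩, ⟨b1, b2, b3⟩, c1, c2, c3⟩ := h
  by_cases hA : A = 0
  · exact Or.inl hA
  refine Or.inr ?_
  have hy4 : y₄ = 0 := by
    have : A * y₄ = 0 := by linear_combination c1 + a2
    exact (mul_eq_zero.1 this).resolve_left hA
  have hb : b = 0 := by
    by_contra hb
    rw [hy4, mul_zero] at a1 b1 c1
    exact hy ⟨(mul_eq_zero.1 b1.symm).resolve_left hb, (mul_eq_zero.1 c1.symm).resolve_left hb,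
      (mul_eq_zero.1 a1.symm).resolve_left hb, hy4⟩
  refine ⟨hb, ?_⟩
  by_contra hK
  have hAK := mul_ne_zero hA hK
  refine hy ⟨?_, ?_, ?_, hy4⟩
  · refine (mul_eq_zero.1 (?_ : (A * _) * y₁ = 0)).resolve_left hAK
    linear_combination -(x₃ + A) * (x₁ + A) * c3 - x₁ * (x₁ + A) * a3 - x₁ * x₂ * b3
  · refine (mul_eq_zero.1 (?_ : (A * _) * y₂ = 0)).resolve_left hAK
    linear_combination -(x₁ + A) * (x₂ + A) * a3 - x₂ * (x₂ + A) * b3 - x₂ * x₃ * c3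
  · refine (mul_eq_zero.1 (?_ : (A * _) * y₃ = 0)).resolve_left hAK
    linear_combination -(x₂ + A) * (x₃ + A) * b3 - x₃ * (x₃ + A) * c3 - x₃ * x₁ * a3

theorem matched_self (x₁ x₂ x₃ b : ℂ) : Matched x₁ x₂ x₃ 0 b x₁ x₂ x₃ b :=
  ⟨⟨by ring, by ring, by ring⟩, ⟨by ring, by ring, by ring⟩, by ring, by ring, by ring⟩

/-- The conic equation makes the cyclic system for `y₁, y₂, y₃` singular, also when `A = 0`. -/
theorem exists_matched_of_conic
    (h : x₁ * x₂ + x₂ * x₃ + x₃ * x₁ + A * (x₁ + x₂ + x₃) + A * A = 0) :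
    ∃ y₁ y₂ y₃ : ℂ, ¬(y₁ = 0 ∧ y₂ = 0 ∧ y₃ = 0) ∧ Matched x₁ x₂ x₃ A 0 y₁ y₂ y₃ 0 := by
  obtain ⟨y, hy, h0⟩ := Matrix.exists_mulVec_eq_zero_iff.2
    (show (!![0, -(x₃ + A), x₂; x₃, 0, -(x₁ + A); -(x₂ + A), x₁, 0]).det = 0 by
      rw [Matrix.det_fin_three]
      simp
      linear_combination -A * h)
  have e1 := congrFun h0 0
  have e2 := congrFun h0 1
  have e3 := congrFun h0 2
  simp [Matrix.mulVec, dotProduct, Fin.sum_univ_three] at e1 e2 e3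
  refine ⟨y 0, y 1, y 2, fun hc => hy ?_, ⟨?_, ?_, ?_⟩, ⟨?_, ?_, ?_⟩, ?_, ?_, ?_⟩
  · ext j; fin_cases j <;> simp [hc]
  all_goals first | ring1 | linear_combination e1 | linear_combination e2 | linear_combination e3

/-- For `A = 0` the vectors `(x₁,x₂,x₃,b)` and `y` are dependent, so the relation passes to `y`. For
`A ≠ 0`, adding the cyclic equations with weights `y₁, y₂, y₃` eliminates the `xᵢ` and leaves `A`
times the conic. -/
theorem Matched.right (h : Matched x₁ x₂ x₃ A b y₁ y₂ y₃ y₄)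
    (hx : ¬(x₁ = 0 ∧ x₂ = 0 ∧ x₃ = 0 ∧ A = 0 ∧ b = 0)) {ρ₁ ρ₂ ρ₃ ρ₄ ρ₅ : ℂ}
    (hρ : ρ₁ * x₁ + ρ₂ * x₂ + ρ₃ * x₃ + ρ₄ * b + ρ₅ * A = 0) :
    ρ₁ * y₁ + ρ₂ * y₂ + ρ₃ * y₃ + ρ₄ * y₄ = 0 ∨ (y₄ = 0 ∧ y₁ * y₂ + y₂ * y₃ + y₃ * y₁ = 0) := by
  obtain ⟨⟨a1, a2, a3⟩, ⟨b1, b2, b3⟩, c1, c2, c3⟩ := h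
  by_cases hA : A = 0
  · left
    subst hA
    by_contra hne
    refine hx ⟨?_, ?_, ?_, rfl, ?_⟩
    · refine (mul_eq_zero.1 (?_ : (ρ₁ * y₁ + ρ₂ * y₂ + ρ₃ * y₃ + ρ₄ * y₄) * x₁ = 0)).resolve_left
        hne
      linear_combination y₁ * hρ + ρ₂ * c3 - ρ₃ * b3 - ρ₄ * c2
    · refine (mul_eq_zero.1 (?_ : (ρ₁ * y₁ + ρ₂ * y₂ + ρ₃ * y₃ + ρ₄ * y₄) * x₂ = 0)).resolve_left
        hne
      linear_combination y₂ * hρ - ρ₁ * c3 + ρ₃ * a3 - ρ₄ * a2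
    · refine (mul_eq_zero.1 (?_ : (ρ₁ * y₁ + ρ₂ * y₂ + ρ₃ * y₃ + ρ₄ * y₄) * x₃ = 0)).resolve_left
        hne
      linear_combination y₃ * hρ + ρ₁ * b3 - ρ₂ * a3 - ρ₄ * b2
    · refine (mul_eq_zero.1 (?_ : (ρ₁ * y₁ + ρ₂ * y₂ + ρ₃ * y₃ + ρ₄ * y₄) * b = 0)).resolve_left
        hne
      linear_combination y₄ * hρ + ρ₁ * c2 + ρ₂ * a2 + ρ₃ * b2
  · right
    have hy4 : y₄ = 0 := by
      have : A * y₄ = 0 := by linear_combination c1 + a2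
      exact (mul_eq_zero.1 this).resolve_left hA
    refine ⟨hy4, (mul_eq_zero.1 (?_ : A * _ = 0)).resolve_left hA⟩
    linear_combination -y₁ * a3 - y₂ * b3 - y₃ * c3

/-- For given `y` the matching equations are linear in `(x₁,x₂,x₃,A)`. The relation is added as a
fourth row, so that the solution comes from a space point; the determinant is a multiple of the
conic. -/
theorem exists_matched_of_dual_conic (h : y₁ * y₂ + y₂ * y₃ + y₃ * y₁ = 0)
    (ρ₁ ρ₂ ρ₃ ρ₅ : ℂ) :
    ∃ x₁ x₂ x₃ A : ℂ, ¬(x₁ = 0 ∧ x₂ = 0 ∧ x₃ = 0 ∧ A = 0) ∧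
      ρ₁ * x₁ + ρ₂ * x₂ + ρ₃ * x₃ + ρ₅ * A = 0 ∧ Matched x₁ x₂ x₃ A 0 y₁ y₂ y₃ 0 := by
  obtain ⟨x, hx, h0⟩ := Matrix.exists_mulVec_eq_zero_iff.2
    (show (!![0, y₃, -y₂, -y₂; -y₃, 0, y₁, -y₃; y₂, -y₁, 0, -y₁; ρ₁, ρ₂, ρ₃, ρ₅]).det = 0 by
      simp [Matrix.det_succ_row_zero, Fin.sum_univ_succ, Fin.succAbove]
      linear_combination (ρ₁ * y₁ + ρ₂ * y₂ + ρ₃ * y₃) * h)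
  have e1 := congrFun h0 0
  have e2 := congrFun h0 1
  have e3 := congrFun h0 2
  have e4 := congrFun h0 3
  simp [Matrix.mulVec, dotProduct, Fin.sum_univ_four] at e1 e2 e3 e4
  refine ⟨x 0, x 1, x 2, x 3, fun hc => hx ?_, ?_, ⟨?_, ?_, ?_⟩, ⟨?_, ?_, ?_⟩, ?_, ?_, ?_⟩
  · ext j; fin_cases j <;> simp [hc]
  all_goals first | ring1 | linear_combination e1 | linear_combination e2 | linear_combination e3 |
    linear_combination e4

end Matched

/-! ### Systems of forms, isotropic bases and the conjugate quadrics -/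

theorem re_complexify_dotProduct {k : ℕ} (r : Fin k → ℝ) (u : Fin k → ℂ) :
    (complexify r ⬝ᵥ u).re = r ⬝ᵥ fun j => (u j).re := by
  simp [complexify, dotProduct]

/-- Injective systems of five linear forms on `ℂ⁴` attain all values compatible with a relation. -/
theorem exists_dotProduct_eq_of_relation {R : Fin 5 → Fin 4 → ℝ}
    (hinj : ∀ u : Fin 4 → ℂ, (∀ j, complexify (R j) ⬝ᵥ u = 0) → u = 0) {ρ : Fin 5 → ℝ}
    (hρ : ρ ≠ 0) (hrel : ∑ j, ρ j • R j = 0) {x : Fin 5 → ℂ} (hx : complexify ρ ⬝ᵥ x = 0) :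
    ∃ u : Fin 4 → ℂ, ∀ j, complexify (R j) ⬝ᵥ u = x j := by
  set L : (Fin 4 → ℂ) →ₗ[ℂ] (Fin 5 → ℂ) := ((Matrix.of R).map (algebraMap ℝ ℂ)).mulVecLin with hL
  have hLa : ∀ u j, L u j = complexify (R j) ⬝ᵥ u := fun u j => map_mulVec_apply (Matrix.of R) u j
  have hLi : LinearMap.ker L = ⊥ := by
    rw [LinearMap.ker_eq_bot']
    intro u hu
    exact hinj u fun j => by rw [← hLa, hu]; rfl
  have h1 := L.finrank_range_add_finrank_ker
  rw [hLi, finrank_bot, Module.finrank_fintype_fun_eq_card, Fintype.card_fin] at h1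
  have hφ : dotProductEquiv ℂ (Fin 5) (complexify ρ) ≠ 0 := by
    rwa [Ne, LinearEquiv.map_eq_zero_iff, complexify_eq_zero]
  have h2 := Module.Dual.finrank_ker_add_one_of_ne_zero hφ
  rw [Module.finrank_fintype_fun_eq_card, Fintype.card_fin] at h2
  have hle : LinearMap.range L ≤ LinearMap.ker (dotProductEquiv ℂ (Fin 5) (complexify ρ)) := by
    rintro _ ⟨u, rfl⟩
    rw [LinearMap.mem_ker, dotProductEquiv_apply_apply]
    have : complexify ρ ⬝ᵥ L u = complexify (∑ j, ρ j • R j) ⬝ᵥ u := by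
      rw [show complexify ρ ⬝ᵥ L u = ∑ j, (ρ j : ℂ) * L u j from rfl]
      simp only [Fin.sum_univ_five, complexify_add, complexify_smul, add_dotProduct,
        smul_dotProduct, ← hLa, smul_eq_mul]
    rw [this, hrel, complexify_eq_zero.2 rfl, zero_dotProduct]
  -- The image has dimension four and lies in the hyperplane of the relation in five-space, hence
  -- fills it.
  have heq := Submodule.eq_of_le_of_finrank_eq hle (by omega)
  obtain ⟨u, hu⟩ : x ∈ LinearMap.range L := by
    rw [heq, LinearMap.mem_ker, dotProductEquiv_apply_apply, hx]
  exact ⟨u, fun j => by rw [← hLa, hu]⟩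

/-- The symmetric matrix of the quadratic form `2rs`, for linear forms `r` and `s`. -/
def symProd (r s : Fin 4 → ℝ) : Matrix (Fin 4) (Fin 4) ℝ :=
  Matrix.vecMulVec r s + Matrix.vecMulVec s r

theorem symProd_isSymm (r s : Fin 4 → ℝ) : (symProd r s).IsSymm := by
  rw [Matrix.IsSymm, symProd, Matrix.transpose_add, Matrix.transpose_vecMulVec,
    Matrix.transpose_vecMulVec, add_comm]

theorem dotProduct_symProd_mulVec (r s v w : Fin 4 → ℝ) :
    v ⬝ᵥ (symProd r s *ᵥ w) = (r ⬝ᵥ v) * (s ⬝ᵥ w) + (s ⬝ᵥ v) * (r ⬝ᵥ w) := by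
  simp only [symProd, Matrix.add_mulVec, Matrix.vecMulVec_mulVec, dotProduct_add]
  simp [dotProduct_comm v, mul_comm]

theorem dotProduct_map_symProd_mulVec (r s : Fin 4 → ℝ) (v w : Fin 4 → ℂ) :
    v ⬝ᵥ ((symProd r s).map (algebraMap ℝ ℂ) *ᵥ w) =
      (complexify r ⬝ᵥ v) * (complexify s ⬝ᵥ w) + (complexify s ⬝ᵥ v) * (complexify r ⬝ᵥ w) := by
  have : (symProd r s).map (algebraMap ℝ ℂ) =
      Matrix.vecMulVec (complexify r) (complexify s) +
        Matrix.vecMulVec (complexify s) (complexify r) := by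
    ext i j
    simp [symProd, complexify, Matrix.vecMulVec_apply]
  rw [this]
  simp only [Matrix.add_mulVec, Matrix.vecMulVec_mulVec, dotProduct_add]
  simp [dotProduct_comm v, mul_comm]

/-- A symmetric form on a plane with three independent isotropic vectors that are pairwise not
orthogonal is nondegenerate. -/
theorem eq_zero_of_isotropic_basis {l : Fin 4 → ℝ} (hl : l ≠ 0) {K : Matrix (Fin 4) (Fin 4) ℝ}
    {k : Fin 3 → Fin 4 → ℝ} (hk : LinearIndependent ℝ k) (hlk : ∀ i, l ⬝ᵥ k i = 0)
    (hK : ∀ i, k i ⬝ᵥ (K *ᵥ k i) = 0) (hsymm : K.IsSymm) (h01 : k 0 ⬝ᵥ (K *ᵥ k 1) ≠ 0)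
    (h12 : k 1 ⬝ᵥ (K *ᵥ k 2) ≠ 0) (h20 : k 2 ⬝ᵥ (K *ᵥ k 0) ≠ 0) {v : Fin 4 → ℝ}
    (hv : l ⬝ᵥ v = 0) (h : ∀ w, l ⬝ᵥ w = 0 → w ⬝ᵥ (K *ᵥ v) = 0) : v = 0 := by
  have hc : ∀ x y : Fin 4 → ℝ, x ⬝ᵥ (K *ᵥ y) = y ⬝ᵥ (K *ᵥ x) := fun x y => by
    rw [Matrix.dotProduct_mulVec, ← Matrix.mulVec_transpose, hsymm.eq, dotProduct_comm]
  have hφ : dotProductEquiv ℝ (Fin 4) l ≠ 0 := by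
    rwa [Ne, LinearEquiv.map_eq_zero_iff]
  have h2 := Module.Dual.finrank_ker_add_one_of_ne_zero hφ
  rw [Module.finrank_fintype_fun_eq_card, Fintype.card_fin] at h2
  have hle : Submodule.span ℝ (Set.range k) ≤ LinearMap.ker (dotProductEquiv ℝ (Fin 4) l) := by
    rw [Submodule.span_le]
    rintro _ ⟨i, rfl⟩
    exact hlk i
  have heq := Submodule.eq_of_le_of_finrank_eq hle (by
    rw [finrank_span_eq_card hk, Fintype.card_fin]; omega)
  have hmem : v ∈ Submodule.span ℝ (Set.range k) := by
    rw [heq]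
    exact hv
  obtain ⟨c, rfl⟩ := (Submodule.mem_span_range_iff_exists_fun ℝ).1 hmem
  have e0 := h _ (hlk 0)
  have e1 := h _ (hlk 1)
  have e2 := h _ (hlk 2)
  simp only [Fin.sum_univ_three, Matrix.mulVec_add, Matrix.mulVec_smul, dotProduct_add,
    dotProduct_smul, smul_eq_mul, hK] at e0 e1 e2
  rw [hc (k 0) (k 2)] at e0
  rw [hc (k 1) (k 0)] at e1
  rw [hc (k 2) (k 1)] at e2
  generalize k 0 ⬝ᵥ (K *ᵥ k 1) = p at *
  generalize k 1 ⬝ᵥ (K *ᵥ k 2) = q at *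
  generalize k 2 ⬝ᵥ (K *ᵥ k 0) = r at *
  -- In this basis the Gram matrix has zero diagonal and off-diagonal entries `p, q, r`, so its
  -- determinant is `2pqr`.
  have c0 : c 0 = 0 := by
    have : (2 * (p * r)) * c 0 = 0 := by linear_combination r * e1 + p * e2 - q * e0
    exact (mul_eq_zero.1 this).resolve_left (by simp [h01, h20])
  have c1 : c 1 = 0 := by
    have : (2 * (p * q)) * c 1 = 0 := by linear_combination q * e0 + p * e2 - r * e1
    exact (mul_eq_zero.1 this).resolve_left (by simp [h01, h12])
  have c2 : c 2 = 0 := by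
    have : (2 * (q * r)) * c 2 = 0 := by linear_combination q * e0 + r * e1 - p * e2
    exact (mul_eq_zero.1 this).resolve_left (by simp [h20, h12])
  simp [Fin.sum_univ_three, c0, c1, c2]

theorem Adapted.real_ker {P Q : Camera} {f g h : Fin 4 → ℝ} {d : Fin 3 → Fin 4 → ℝ}
    (H : Adapted P Q ![f, g, h] d) (k : Fin 4 → ℝ) :
    P.mat *ᵥ k = 0 ↔ f ⬝ᵥ k = 0 ∧ g ⬝ᵥ k = 0 ∧ h ⬝ᵥ k = 0 := by
  have := H.toLin_eq_zero_iff (complexify k)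
  simpa only [P.toLin_complexify, complexify_eq_zero, complexify_dotProduct,
    Complex.ofReal_eq_zero] using this

theorem Adapted.exists_real {P Q : Camera} {f g h : Fin 4 → ℝ} {d : Fin 3 → Fin 4 → ℝ}
    (H : Adapted P Q ![f, g, h] d) (x y z : ℝ) :
    ∃ w : Fin 4 → ℝ, f ⬝ᵥ w = x ∧ g ⬝ᵥ w = y ∧ h ⬝ᵥ w = z := by
  obtain ⟨u, h1, h2, h3⟩ := H.isSurjectiveTriple x y z
  simp only [dotProductEquiv_apply_apply] at h1 h2 h3
  exact ⟨fun j => (u j).re, by rw [← re_complexify_dotProduct, h1, Complex.ofReal_re],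
    by rw [← re_complexify_dotProduct, h2, Complex.ofReal_re],
    by rw [← re_complexify_dotProduct, h3, Complex.ofReal_re]⟩

/-- The images of two points of the plane `h = 0` are different if the points span a line that
does not contain the center. -/
theorem Adapted.det_ne_zero {P Q : Camera} {f g h : Fin 4 → ℝ} {d : Fin 3 → Fin 4 → ℝ}
    (H : Adapted P Q ![f, g, h] d) {k k₁ k₂ : Fin 4 → ℝ} (hk : k ≠ 0) (hPk : P.mat *ᵥ k = 0)
    (h1 : h ⬝ᵥ k₁ = 0) (h2 : h ⬝ᵥ k₂ = 0)
    (hind : ∀ s t c : ℝ, s • k₁ + t • k₂ + c • k = 0 → s = 0 ∧ t = 0) :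
    (f ⬝ᵥ k₁) * (g ⬝ᵥ k₂) - (g ⬝ᵥ k₁) * (f ⬝ᵥ k₂) ≠ 0 := by
  intro h0
  obtain ⟨s, t, hst, e1, e2⟩ := exists_mul_eq_mul_of_det_eq_zero h0
  have hw : P.mat *ᵥ (s • k₁ - t • k₂) = 0 := by
    rw [H.real_ker]
    simp only [dotProduct_sub, dotProduct_smul, smul_eq_mul, e1, e2, h1, h2]
    simp
  have hkc : complexify k ≠ 0 := mt complexify_eq_zero.1 hk
  obtain ⟨c, hc⟩ := P.exists_smul_of_toLin_eq_zero (u := complexify k)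
    (v := complexify (s • k₁ - t • k₂)) hkc (by rw [P.toLin_complexify, hPk, complexify_eq_zero])
    (by rw [P.toLin_complexify, hw, complexify_eq_zero])
  obtain ⟨x, hx⟩ := exists_real_smul hk hc
  obtain ⟨hs, ht⟩ := hind s (-t) (-x) (by rw [neg_smul, neg_smul, ← hx]; abel)
  rw [neg_eq_zero] at ht
  simp [hs, ht] at hst

/-- The quadrics on the conjugate side, for two consecutive views in normal form. -/
theorem mk_mem_viewQuadric_swap_iff_of_normal_pair {P Q : Fin 3 → Camera} {i j : Fin 3}
    {r₁ r₂ r₃ A B d₁ d₂ d₃ d₄ : Fin 4 → ℝ}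
    (hinj : ∀ w : Fin 4 → ℂ, complexify r₁ ⬝ᵥ w = 0 → complexify r₂ ⬝ᵥ w = 0 →
      complexify r₃ ⬝ᵥ w = 0 → complexify B ⬝ᵥ w = 0 → complexify A ⬝ᵥ w = 0 → w = 0)
    {ρ₁ ρ₂ ρ₃ ρ₄ ρ₅ : ℂ}
    (hrel : ∀ w : Fin 4 → ℂ, ρ₁ * (complexify r₁ ⬝ᵥ w) + ρ₂ * (complexify r₂ ⬝ᵥ w) +
      ρ₃ * (complexify r₃ ⬝ᵥ w) + ρ₄ * (complexify B ⬝ᵥ w) + ρ₅ * (complexify A ⬝ᵥ w) = 0)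
    (hsurj : ∀ x₁ x₂ x₃ b a : ℂ, ρ₁ * x₁ + ρ₂ * x₂ + ρ₃ * x₃ + ρ₄ * b + ρ₅ * a = 0 →
      ∃ w : Fin 4 → ℂ, complexify r₁ ⬝ᵥ w = x₁ ∧ complexify r₂ ⬝ᵥ w = x₂ ∧
        complexify r₃ ⬝ᵥ w = x₃ ∧ complexify B ⬝ᵥ w = b ∧ complexify A ⬝ᵥ w = a)
    (hi : Adapted (P i) (Q i) ![r₂, r₃ + A, B] ![d₂, d₃, d₄])
    (hj : Adapted (P j) (Q j) ![r₃, r₁ + A, B] ![d₃, d₁, d₄]) {u : Fin 4 → ℂ} (hu : u ≠ 0) :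
    Projectivization.mk ℂ u hu ∈ viewQuadric Q P i j ↔
      ρ₁ * (complexify d₁ ⬝ᵥ u) + ρ₂ * (complexify d₂ ⬝ᵥ u) + ρ₃ * (complexify d₃ ⬝ᵥ u) +
        ρ₄ * (complexify d₄ ⬝ᵥ u) = 0 ∨ complexify d₄ ⬝ᵥ u = 0 := by
  rw [mk_mem_viewQuadric_iff_of_adapted hi.flip hj.flip]
  simp only [Fin.forall_fin_succ, Matrix.cons_val_zero, Matrix.cons_val_succ,
    IsEmpty.forall_iff, and_true, complexify_add, add_dotProduct]
  generalize complexify d₁ ⬝ᵥ u = y₁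
  generalize complexify d₂ ⬝ᵥ u = y₂
  generalize complexify d₃ ⬝ᵥ u = y₃
  generalize complexify d₄ ⬝ᵥ u = y₄
  constructor
  · rintro ⟨w, s, t, hne, ⟨e1, e2, e3⟩, e4, e5, e6⟩
    by_contra! hc
    -- Off `y₄ = 0` the shared form `B` forces `s = t`; comparing the two values of the shared
    -- coordinate then gives `A = 0`, and the relation among the five forms forces `s = 0`.
    have hst : s = t := mul_right_cancel₀ hc.2 (e3.symm.trans e6)
    subst hst
    have hA : complexify A ⬝ᵥ w = 0 := by linear_combination e2 - e4
    have hs : s = 0 := by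
      refine (mul_eq_zero.1 (?_ : s * (ρ₁ * y₁ + ρ₂ * y₂ + ρ₃ * y₃ + ρ₄ * y₄) = 0)).resolve_right
        hc.1
      linear_combination hrel w - ρ₁ * (e5 - hA) - ρ₂ * e1 - ρ₃ * e4 - ρ₄ * e3 - ρ₅ * hA
    subst hs
    have := hinj w (by linear_combination e5 - hA) (by linear_combination e1)
      (by linear_combination e4) (by linear_combination e3) hA
    simp [this] at hne
  · rintro (h | rfl)
    · obtain ⟨w, w1, w2, w3, w4, w5⟩ := hsurj y₁ y₂ y₃ y₄ 0 (by linear_combination h)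
      refine ⟨w, 1, 1, Or.inr (Or.inl one_ne_zero), ?_⟩
      simp [w1, w2, w3, w4, w5]
    · obtain ⟨s, t, hst, e, -⟩ := exists_mul_eq_mul_of_det_eq_zero
        (show (-ρ₁ * y₃ + ρ₂ * y₂ + ρ₅ * y₃) * 0 - 0 *
          (-(ρ₁ * y₁ + ρ₁ * y₃ + ρ₃ * y₃ - ρ₅ * y₃)) = 0 by ring)
      obtain ⟨w, w1, w2, w3, w4, w5⟩ := hsurj (t * y₁ - (s - t) * y₃) (s * y₂) (t * y₃) 0
        ((s - t) * y₃) (by linear_combination e)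
      refine ⟨w, s, t, Or.inr hst, ?_⟩
      rw [w1, w2, w3, w4, w5]
      refine ⟨⟨rfl, ?_, ?_⟩, rfl, ?_, ?_⟩ <;> ring

theorem viewQuadric_comm {n : ℕ} {P Q : Fin n → Camera} (i j : Fin n) :
    viewQuadric P Q i j = viewQuadric P Q j i := by
  ext x
  induction x using Projectivization.ind with
  | h u hu =>
    rw [mk_mem_viewQuadric, mk_mem_viewQuadric]
    constructor <;>
    · rintro ⟨w, s, t, h, h1, h2⟩
      exact ⟨w, t, s, h.imp_right Or.symm, h2, h1⟩

/-! ### The critical sets of both sides -/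

/-- Three views `P` and `Q` in normal form: the cameras `Q` are the coordinate projections in the
basis of forms `N`, and the cameras `P` are given by five forms. -/
structure NormalForm (P Q : Fin 3 → Camera) where
  r₁ : Fin 4 → ℝ
  r₂ : Fin 4 → ℝ
  r₃ : Fin 4 → ℝ
  A : Fin 4 → ℝ
  B : Fin 4 → ℝ
  N : Matrix (Fin 4) (Fin 4) ℝ
  isUnit_N : IsUnit N
  view₀ : Adapted (P 0) (Q 0) ![r₂, r₃ + A, B] ![N 1, N 2, N 3]
  view₁ : Adapted (P 1) (Q 1) ![r₃, r₁ + A, B] ![N 2, N 0, N 3]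
  view₂ : Adapted (P 2) (Q 2) ![r₁, r₂ + A, B] ![N 0, N 1, N 3]

/-- The polar form of the conic at two centers is the determinant of their images in the third view;
this ties smoothness to the centers not being collinear. -/
theorem polar_eq_det_of_centers {x₁ x₂ x₃ a y₁ y₂ y₃ b : ℝ} (h1 : x₂ = 0) (h2 : x₃ + a = 0)
    (h3 : y₃ = 0) (h4 : y₁ + b = 0) :
    x₁ * y₂ + x₂ * y₁ + (x₂ * y₃ + x₃ * y₂) + (x₃ * y₁ + x₁ * y₃) +
      (a * (y₁ + y₂ + y₃) + (x₁ + x₂ + x₃) * b) + (a * b + a * b) =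
      x₁ * (y₂ + b) - (x₂ + a) * y₁ := by
  obtain rfl : a = -x₃ := by linarith
  obtain rfl : b = -y₁ := by linarith
  rw [h1, h3]
  ring

namespace NormalForm

variable {P Q : Fin 3 → Camera} (T : NormalForm P Q)

theorem matched_iff (u v : Fin 4 → ℂ) :
    (∀ i, ∃ s t : ℂ, (s ≠ 0 ∨ t ≠ 0) ∧ s • (P i).toLin u = t • (Q i).toLin v) ↔
      Matched (complexify T.r₁ ⬝ᵥ u) (complexify T.r₂ ⬝ᵥ u) (complexify T.r₃ ⬝ᵥ u)
        (complexify T.A ⬝ᵥ u) (complexify T.B ⬝ᵥ u) (complexify (T.N 0) ⬝ᵥ v)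
        (complexify (T.N 1) ⬝ᵥ v) (complexify (T.N 2) ⬝ᵥ v) (complexify (T.N 3) ⬝ᵥ v) := by
  have h0 := T.view₀.dependent_iff u v
  have h1 := T.view₁.dependent_iff u v
  have h2 := T.view₂.dependent_iff u v
  simp only [complexify_add, add_dotProduct] at h0 h1 h2
  rw [Matched, ← h0, ← h1, ← h2]
  simp only [Fin.forall_fin_succ, IsEmpty.forall_iff, and_true]
  rfl

theorem mem_criticalPoints {u : Fin 4 → ℂ} (hu : u ≠ 0) :
    Projectivization.mk ℂ u hu ∈ criticalPoints P Q ↔ ∃ v : Fin 4 → ℂ, v ≠ 0 ∧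
      Matched (complexify T.r₁ ⬝ᵥ u) (complexify T.r₂ ⬝ᵥ u) (complexify T.r₃ ⬝ᵥ u)
        (complexify T.A ⬝ᵥ u) (complexify T.B ⬝ᵥ u) (complexify (T.N 0) ⬝ᵥ v)
        (complexify (T.N 1) ⬝ᵥ v) (complexify (T.N 2) ⬝ᵥ v) (complexify (T.N 3) ⬝ᵥ v) := by
  simp only [mk_mem_criticalPoints, T.matched_iff]

theorem mem_criticalPoints_swap {v : Fin 4 → ℂ} (hv : v ≠ 0) :
    Projectivization.mk ℂ v hv ∈ criticalPoints Q P ↔ ∃ u : Fin 4 → ℂ, u ≠ 0 ∧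
      Matched (complexify T.r₁ ⬝ᵥ u) (complexify T.r₂ ⬝ᵥ u) (complexify T.r₃ ⬝ᵥ u)
        (complexify T.A ⬝ᵥ u) (complexify T.B ⬝ᵥ u) (complexify (T.N 0) ⬝ᵥ v)
        (complexify (T.N 1) ⬝ᵥ v) (complexify (T.N 2) ⬝ᵥ v) (complexify (T.N 3) ⬝ᵥ v) := by
  simp only [mk_mem_criticalPoints, ← T.matched_iff]
  refine exists_congr fun u => and_congr_right fun _ => forall_congr' fun i => ?_
  rw [exists_comm]
  simp only [or_comm, eq_comm]

/-- A common zero of the five forms would be the center of view 0 and of view 1. -/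
theorem eq_zero (hP : Function.Injective (centers P)) (w : Fin 4 → ℂ)
    (h1 : complexify T.r₁ ⬝ᵥ w = 0) (h2 : complexify T.r₂ ⬝ᵥ w = 0)
    (h3 : complexify T.r₃ ⬝ᵥ w = 0) (h4 : complexify T.B ⬝ᵥ w = 0)
    (h5 : complexify T.A ⬝ᵥ w = 0) : w = 0 := by
  by_contra hw
  have e0 : (P 0).center = Projectivization.mk ℂ w hw := by
    rw [Camera.center_eq_mk_iff, T.view₀.toLin_eq_zero_iff]
    simp [complexify_add, h2, h3, h4, h5]
  have e1 : (P 1).center = Projectivization.mk ℂ w hw := by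
    rw [Camera.center_eq_mk_iff, T.view₁.toLin_eq_zero_iff]
    simp [complexify_add, h1, h3, h4, h5]
  exact absurd (hP (e0.trans e1.symm)) (by decide)

/-- Five forms on a four-dimensional space are dependent. Since they have no common zero, the
relation found is the only constraint on their values. -/
theorem exists_relation (hP : Function.Injective (centers P)) :
    ∃ ρ₁ ρ₂ ρ₃ ρ₄ ρ₅ : ℝ, ¬(ρ₁ = 0 ∧ ρ₂ = 0 ∧ ρ₃ = 0 ∧ ρ₄ = 0 ∧ ρ₅ = 0) ∧
      ρ₁ • T.r₁ + ρ₂ • T.r₂ + ρ₃ • T.r₃ + ρ₄ • T.B + ρ₅ • T.A = 0 ∧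
      (∀ x₁ x₂ x₃ b a : ℂ, ρ₁ * x₁ + ρ₂ * x₂ + ρ₃ * x₃ + ρ₄ * b + ρ₅ * a = 0 →
        ∃ w : Fin 4 → ℂ, complexify T.r₁ ⬝ᵥ w = x₁ ∧ complexify T.r₂ ⬝ᵥ w = x₂ ∧
          complexify T.r₃ ⬝ᵥ w = x₃ ∧ complexify T.B ⬝ᵥ w = b ∧ complexify T.A ⬝ᵥ w = a) := by
  obtain ⟨ρ, hρ, hρ0⟩ := Submodule.exists_mem_ne_zero_of_ne_bot
    (LinearMap.ker_ne_bot_of_finrank_lt (f := Fintype.linearCombination ℝ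
      ![T.r₁, T.r₂, T.r₃, T.B, T.A]) (by simp))
  rw [LinearMap.mem_ker, Fintype.linearCombination_apply] at hρ
  refine ⟨ρ 0, ρ 1, ρ 2, ρ 3, ρ 4, fun h => hρ0 ?_, by simpa [Fin.sum_univ_five] using hρ,
    fun x₁ x₂ x₃ b a h => ?_⟩
  · ext j
    fin_cases j <;> simp [h]
  · obtain ⟨u, hu⟩ := exists_dotProduct_eq_of_relation (R := ![T.r₁, T.r₂, T.r₃, T.B, T.A])
      (x := ![x₁, x₂, x₃, b, a]) (fun u hu => T.eq_zero hP u (hu 0) (hu 1) (hu 2) (hu 3) (hu 4))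
      hρ0 hρ (by simpa [dotProduct, Fin.sum_univ_five, complexify] using h)
    exact ⟨u, hu 0, hu 1, hu 2, hu 3, hu 4⟩

/-- The conic in the plane `B = 0` that consists of critical points. -/
def conicMatrix : Matrix (Fin 4) (Fin 4) ℝ :=
  symProd T.r₁ T.r₂ + symProd T.r₂ T.r₃ + symProd T.r₃ T.r₁ +
    symProd T.A (T.r₁ + T.r₂ + T.r₃) + symProd T.A T.A

theorem conicMatrix_isSymm : T.conicMatrix.IsSymm :=
  ((((symProd_isSymm _ _).add (symProd_isSymm _ _)).add (symProd_isSymm _ _)).add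
    (symProd_isSymm _ _)).add (symProd_isSymm _ _)

theorem conicMatrix_apply (v w : Fin 4 → ℝ) : v ⬝ᵥ (T.conicMatrix *ᵥ w) =
    (T.r₁ ⬝ᵥ v) * (T.r₂ ⬝ᵥ w) + (T.r₂ ⬝ᵥ v) * (T.r₁ ⬝ᵥ w) +
    ((T.r₂ ⬝ᵥ v) * (T.r₃ ⬝ᵥ w) + (T.r₃ ⬝ᵥ v) * (T.r₂ ⬝ᵥ w)) +
    ((T.r₃ ⬝ᵥ v) * (T.r₁ ⬝ᵥ w) + (T.r₁ ⬝ᵥ v) * (T.r₃ ⬝ᵥ w)) +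
    ((T.A ⬝ᵥ v) * (T.r₁ ⬝ᵥ w + T.r₂ ⬝ᵥ w + T.r₃ ⬝ᵥ w) +
      (T.r₁ ⬝ᵥ v + T.r₂ ⬝ᵥ v + T.r₃ ⬝ᵥ v) * (T.A ⬝ᵥ w)) +
    ((T.A ⬝ᵥ v) * (T.A ⬝ᵥ w) + (T.A ⬝ᵥ v) * (T.A ⬝ᵥ w)) := by
  simp only [conicMatrix, Matrix.add_mulVec, dotProduct_add, dotProduct_symProd_mulVec,
    add_dotProduct]

theorem conicMatrix_eq_zero_iff (u : Fin 4 → ℂ) :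
    u ⬝ᵥ (T.conicMatrix.map (algebraMap ℝ ℂ) *ᵥ u) = 0 ↔
      (complexify T.r₁ ⬝ᵥ u) * (complexify T.r₂ ⬝ᵥ u) +
      (complexify T.r₂ ⬝ᵥ u) * (complexify T.r₃ ⬝ᵥ u) +
      (complexify T.r₃ ⬝ᵥ u) * (complexify T.r₁ ⬝ᵥ u) +
      (complexify T.A ⬝ᵥ u) * (complexify T.r₁ ⬝ᵥ u + complexify T.r₂ ⬝ᵥ u +
        complexify T.r₃ ⬝ᵥ u) + (complexify T.A ⬝ᵥ u) * (complexify T.A ⬝ᵥ u) = 0 := by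
  have hm : ∀ M M' : Matrix (Fin 4) (Fin 4) ℝ, (M + M').map (algebraMap ℝ ℂ) =
      M.map (algebraMap ℝ ℂ) + M'.map (algebraMap ℝ ℂ) := fun M M' =>
    Matrix.map_add _ (map_add _) M M'
  simp only [conicMatrix, hm, Matrix.add_mulVec, dotProduct_add, dotProduct_map_symProd_mulVec,
    complexify_add, add_dotProduct]
  constructor <;> intro h
  · linear_combination h / 2
  · linear_combination 2 * h

/-- The conic in the plane `N 3 = 0` on the conjugate side. -/
def dualConicMatrix : Matrix (Fin 4) (Fin 4) ℝ :=
  symProd (T.N 0) (T.N 1) + symProd (T.N 1) (T.N 2) + symProd (T.N 2) (T.N 0)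

theorem dualConicMatrix_isSymm : T.dualConicMatrix.IsSymm :=
  ((symProd_isSymm _ _).add (symProd_isSymm _ _)).add (symProd_isSymm _ _)

theorem dualConicMatrix_apply (v w : Fin 4 → ℝ) : v ⬝ᵥ (T.dualConicMatrix *ᵥ w) =
    (T.N 0 ⬝ᵥ v) * (T.N 1 ⬝ᵥ w) + (T.N 1 ⬝ᵥ v) * (T.N 0 ⬝ᵥ w) +
    ((T.N 1 ⬝ᵥ v) * (T.N 2 ⬝ᵥ w) + (T.N 2 ⬝ᵥ v) * (T.N 1 ⬝ᵥ w)) +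
    ((T.N 2 ⬝ᵥ v) * (T.N 0 ⬝ᵥ w) + (T.N 0 ⬝ᵥ v) * (T.N 2 ⬝ᵥ w)) := by
  simp only [dualConicMatrix, Matrix.add_mulVec, dotProduct_add, dotProduct_symProd_mulVec]

theorem dualConicMatrix_eq_zero_iff (u : Fin 4 → ℂ) :
    u ⬝ᵥ (T.dualConicMatrix.map (algebraMap ℝ ℂ) *ᵥ u) = 0 ↔
      (complexify (T.N 0) ⬝ᵥ u) * (complexify (T.N 1) ⬝ᵥ u) +
      (complexify (T.N 1) ⬝ᵥ u) * (complexify (T.N 2) ⬝ᵥ u) +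
      (complexify (T.N 2) ⬝ᵥ u) * (complexify (T.N 0) ⬝ᵥ u) = 0 := by
  have hm : ∀ M M' : Matrix (Fin 4) (Fin 4) ℝ, (M + M').map (algebraMap ℝ ℂ) =
      M.map (algebraMap ℝ ℂ) + M'.map (algebraMap ℝ ℂ) := fun M M' =>
    Matrix.map_add _ (map_add _) M M'
  simp only [dualConicMatrix, hm, Matrix.add_mulVec, dotProduct_add,
    dotProduct_map_symProd_mulVec]
  constructor <;> intro h
  · linear_combination h / 2
  · linear_combination 2 * h

theorem conicMatrix_self_eq_zero {i : Fin 3} {k : Fin 4 → ℝ} (hk : (P i).mat *ᵥ k = 0) :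
    T.B ⬝ᵥ k = 0 ∧ k ⬝ᵥ (T.conicMatrix *ᵥ k) = 0 := by
  rw [conicMatrix_apply]
  fin_cases i
  · obtain ⟨h1, h2, h3⟩ := (T.view₀.real_ker k).1 hk
    rw [add_dotProduct] at h2
    refine ⟨h3, ?_⟩
    linear_combination 2 * (T.r₁ ⬝ᵥ k + T.r₃ ⬝ᵥ k + T.A ⬝ᵥ k) * h1 +
      2 * (T.r₁ ⬝ᵥ k + T.A ⬝ᵥ k) * h2
  · obtain ⟨h1, h2, h3⟩ := (T.view₁.real_ker k).1 hk
    rw [add_dotProduct] at h2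
    refine ⟨h3, ?_⟩
    linear_combination 2 * (T.r₂ ⬝ᵥ k + T.r₁ ⬝ᵥ k + T.A ⬝ᵥ k) * h1 +
      2 * (T.r₂ ⬝ᵥ k + T.A ⬝ᵥ k) * h2
  · obtain ⟨h1, h2, h3⟩ := (T.view₂.real_ker k).1 hk
    rw [add_dotProduct] at h2
    refine ⟨h3, ?_⟩
    linear_combination 2 * (T.r₃ ⬝ᵥ k + T.r₂ ⬝ᵥ k + T.A ⬝ᵥ k) * h1 +
      2 * (T.r₃ ⬝ᵥ k + T.A ⬝ᵥ k) * h2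

theorem dualConicMatrix_self_eq_zero {i : Fin 3} {k : Fin 4 → ℝ} (hk : (Q i).mat *ᵥ k = 0) :
    T.N 3 ⬝ᵥ k = 0 ∧ k ⬝ᵥ (T.dualConicMatrix *ᵥ k) = 0 := by
  rw [dualConicMatrix_apply]
  fin_cases i
  · obtain ⟨h1, h2, h3⟩ := (T.view₀.flip.real_ker k).1 hk
    exact ⟨h3, by rw [h1, h2]; ring⟩
  · obtain ⟨h1, h2, h3⟩ := (T.view₁.flip.real_ker k).1 hk
    exact ⟨h3, by rw [h1, h2]; ring⟩
  · obtain ⟨h1, h2, h3⟩ := (T.view₂.flip.real_ker k).1 hk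
    exact ⟨h3, by rw [h1, h2]; ring⟩

/-- If the form vanished on the plane `B = 0`, the center of view 0 would lie in its radical.
Testing against vectors dual to the forms of that view makes `r₁` and `A` vanish at the center,
hence all five forms. -/
theorem exists_conicMatrix_ne_zero (hP : Function.Injective (centers P)) :
    ∃ v, T.B ⬝ᵥ v = 0 ∧ v ⬝ᵥ (T.conicMatrix *ᵥ v) ≠ 0 := by
  obtain ⟨k, hk0, hk⟩ := (P 0).exists_real_center
  obtain ⟨h1, h2, h3⟩ := (T.view₀.real_ker k).1 hk
  rw [add_dotProduct] at h2
  by_contra! hc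
  have key : ∀ w, T.B ⬝ᵥ w = 0 → w ⬝ᵥ (T.conicMatrix *ᵥ k) = 0 := fun w hw => by
    by_contra h0
    obtain ⟨v, hv, hv0⟩ := exists_dotProduct_mulVec_ne_zero T.conicMatrix_isSymm h3 hw h0
    exact hv0 (hc v hv)
  obtain ⟨w, w1, w2, w3⟩ := T.view₀.exists_real 1 0 0
  obtain ⟨w', w1', w2', w3'⟩ := T.view₀.exists_real 0 1 0
  have e := key w w3
  have e' := key w' w3'
  rw [conicMatrix_apply] at e e'
  rw [add_dotProduct] at w2 w2'
  have hs : T.r₁ ⬝ᵥ k = 0 := by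
    linear_combination e - (T.r₁ ⬝ᵥ w + T.r₃ ⬝ᵥ w + T.A ⬝ᵥ w) * h1 -
      (T.r₁ ⬝ᵥ w + T.r₂ ⬝ᵥ w + T.A ⬝ᵥ w) * h2 -
      (T.r₁ ⬝ᵥ k) * w1 - (T.r₁ ⬝ᵥ k + T.A ⬝ᵥ k) * w2
  have ht : T.A ⬝ᵥ k = 0 := by
    linear_combination e' - (T.r₁ ⬝ᵥ w' + T.r₃ ⬝ᵥ w' + T.A ⬝ᵥ w') * h1 -
      (T.r₁ ⬝ᵥ w' + T.r₂ ⬝ᵥ w' + T.A ⬝ᵥ w') * h2 -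
      (T.r₁ ⬝ᵥ k) * w1' - (T.r₁ ⬝ᵥ k + T.A ⬝ᵥ k) * w2' - hs
  refine hk0 (complexify_eq_zero.1 (T.eq_zero hP _ ?_ ?_ ?_ ?_ ?_)) <;>
    rw [complexify_dotProduct, Complex.ofReal_eq_zero]
  · exact hs
  · exact h1
  · linarith
  · exact h3
  · exact ht

/-- The three centers are isotropic and span the plane; their polar values are determinants of
images in the third view, nonzero because no center lies on the line through the other two. -/
theorem conicMatrix_isSmooth (hind : Projectivization.Independent (centers P)) (hB : T.B ≠ 0)
    {v : Fin 4 → ℝ} (hv : T.B ⬝ᵥ v = 0)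
    (h : ∀ w, T.B ⬝ᵥ w = 0 → w ⬝ᵥ (T.conicMatrix *ᵥ v) = 0) : v = 0 := by
  obtain ⟨k, hk0, hk, hlin⟩ := exists_real_centers P
  have hli := hlin hind
  rw [Fintype.linearIndependent_iff] at hli
  have hs : ∀ x y z : ℝ, x • k 0 + y • k 1 + z • k 2 = 0 → x = 0 ∧ y = 0 ∧ z = 0 :=
    fun x y z e => by
      have := hli ![x, y, z] (by simpa [Fin.sum_univ_three] using e)
      exact ⟨this 0, this 1, this 2⟩
  have hc := fun i => T.conicMatrix_self_eq_zero (hk i)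
  obtain ⟨a1, a2, a3⟩ := (T.view₀.real_ker _).1 (hk 0)
  obtain ⟨b1, b2, b3⟩ := (T.view₁.real_ker _).1 (hk 1)
  obtain ⟨c1, c2, c3⟩ := (T.view₂.real_ker _).1 (hk 2)
  have d01 := T.view₂.det_ne_zero (hk0 2) (hk 2) a3 b3 fun x y z e =>
    (hs x y z e).imp_right And.left
  have d12 := T.view₀.det_ne_zero (hk0 0) (hk 0) b3 c3 fun x y z e =>
    (hs z x y (by rw [← e]; abel)).2
  have d20 := T.view₁.det_ne_zero (hk0 1) (hk 1) c3 a3 fun x y z e =>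
    (hs y z x (by rw [← e]; abel)).symm.imp_left And.right
  simp only [add_dotProduct] at a2 b2 c2 d01 d12 d20
  refine eq_zero_of_isotropic_basis hB (hlin hind) (fun i => (hc i).1) (fun i => (hc i).2)
    T.conicMatrix_isSymm (fun e => d01 ?_) (fun e => d12 ?_) (fun e => d20 ?_) hv h
  · rw [conicMatrix_apply] at e
    rw [← polar_eq_det_of_centers a1 a2 b1 b2]
    linear_combination e
  · rw [conicMatrix_apply] at e
    rw [← polar_eq_det_of_centers b1 b2 c1 c2]
    linear_combination e
  · rw [conicMatrix_apply] at e
    rw [← polar_eq_det_of_centers c1 c2 a1 a2]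
    linear_combination e

/-- The union of a plane and a conic that is the critical set of `P` with respect to `Q`. -/
def planeConic (hP : Function.Injective (centers P)) (hA : T.A ≠ 0) (hB : T.B ≠ 0) : PlaneConic where
  m := T.A
  l := T.B
  K := T.conicMatrix
  m_ne := hA
  l_ne := hB
  K_symm := T.conicMatrix_isSymm
  K_ne := T.exists_conicMatrix_ne_zero hP

theorem planeConic_center_mem (hP : Function.Injective (centers P)) (hA : T.A ≠ 0) (hB : T.B ≠ 0)
    (i : Fin 3) : centers P i ∈ (T.planeConic hP hA hB).conic := by
  obtain ⟨k, hk0, hk⟩ := (P i).exists_real_center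
  obtain ⟨h1, h2⟩ := T.conicMatrix_self_eq_zero hk
  have hkc : complexify k ≠ 0 := mt complexify_eq_zero.1 hk0
  rw [centers, ((P i).center_eq_mk_iff hkc).2 (by
    rw [Camera.toLin_complexify, hk, complexify_eq_zero]), mk_mem_conic]
  simp only [planeConic, map_mulVec_complexify, complexify_dotProduct, h1, h2]
  simp

theorem criticalPoints_eq (hP : Function.Injective (centers P)) (hA : T.A ≠ 0) (hB : T.B ≠ 0) :
    criticalPoints P Q = (T.planeConic hP hA hB).carrier := by
  ext x
  induction x using Projectivization.ind with
  | h u hu =>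
    rw [T.mem_criticalPoints, mk_mem_carrier]
    simp only [planeConic, conicMatrix_eq_zero_iff]
    constructor
    · rintro ⟨v, hv, h⟩
      exact h.left fun h0 => hv (coordinates_injective T.isUnit_N v h0.1 h0.2.1 h0.2.2.1 h0.2.2.2)
    · rintro (h | ⟨h1, h2⟩)
      · obtain ⟨v, v1, v2, v3, v4⟩ := coordinates_surjective T.isUnit_N (complexify T.r₁ ⬝ᵥ u)
          (complexify T.r₂ ⬝ᵥ u) (complexify T.r₃ ⬝ᵥ u) (complexify T.B ⬝ᵥ u)
        refine ⟨v, ?_, by rw [h, v1, v2, v3, v4]; exact matched_self _ _ _ _⟩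
        rintro rfl
        simp only [dotProduct_zero] at v1 v2 v3 v4
        exact hu (T.eq_zero hP u v1.symm v2.symm v3.symm v4.symm h)
      · obtain ⟨y₁, y₂, y₃, hy, hm⟩ := exists_matched_of_conic h2
        obtain ⟨v, v1, v2, v3, v4⟩ := coordinates_surjective T.isUnit_N y₁ y₂ y₃ 0
        refine ⟨v, ?_, by rw [h1, v1, v2, v3, v4]; exact hm⟩
        rintro rfl
        simp only [dotProduct_zero] at v1 v2 v3
        exact hy ⟨v1.symm, v2.symm, v3.symm⟩

/-- The centers of `Q` are coordinate points, so each polar value is a product of two nonzero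
coordinates. -/
theorem dualConicMatrix_isSmooth (hQ : Projectivization.Independent (centers Q))
    {v : Fin 4 → ℝ} (hv : T.N 3 ⬝ᵥ v = 0)
    (h : ∀ w, T.N 3 ⬝ᵥ w = 0 → w ⬝ᵥ (T.dualConicMatrix *ᵥ v) = 0) : v = 0 := by
  obtain ⟨k, hk0, hk, hlin⟩ := exists_real_centers Q
  have hc := fun i => T.dualConicMatrix_self_eq_zero (hk i)
  obtain ⟨a1, a2, a3⟩ := (T.view₀.flip.real_ker _).1 (hk 0)
  obtain ⟨b1, b2, b3⟩ := (T.view₁.flip.real_ker _).1 (hk 1)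
  obtain ⟨c1, c2, c3⟩ := (T.view₂.flip.real_ker _).1 (hk 2)
  have hinj : ∀ i, ¬(T.N 0 ⬝ᵥ k i = 0 ∧ T.N 1 ⬝ᵥ k i = 0 ∧ T.N 2 ⬝ᵥ k i = 0) :=
    fun i h0 => hk0 i (complexify_eq_zero.1 (coordinates_injective T.isUnit_N _
      (by rw [complexify_dotProduct, h0.1, Complex.ofReal_zero])
      (by rw [complexify_dotProduct, h0.2.1, Complex.ofReal_zero])
      (by rw [complexify_dotProduct, h0.2.2, Complex.ofReal_zero])
      (by rw [complexify_dotProduct, (hc i).1, Complex.ofReal_zero])))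
  have a0 : T.N 0 ⬝ᵥ k 0 ≠ 0 := fun e => hinj 0 ⟨e, a1, a2⟩
  have b0 : T.N 1 ⬝ᵥ k 1 ≠ 0 := fun e => hinj 1 ⟨b2, e, b1⟩
  have c0 : T.N 2 ⬝ᵥ k 2 ≠ 0 := fun e => hinj 2 ⟨c1, c2, e⟩
  have hl : T.N 3 ≠ 0 := by
    intro h3
    obtain ⟨w, -, -, -, h4⟩ := coordinates_surjective T.isUnit_N 0 0 0 1
    simp [h3, complexify_eq_zero.2 rfl] at h4
  refine eq_zero_of_isotropic_basis hl (hlin hQ) (fun i => (hc i).1) (fun i => (hc i).2)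
    T.dualConicMatrix_isSymm ?_ ?_ ?_ hv h <;> rw [dualConicMatrix_apply]
  · simp [a1, a2, b1, b2, a0, b0]
  · simp [b1, b2, c1, c2, b0, c0]
  · simp [a1, a2, c1, c2, a0, c0]

/-- The data on the conjugate side: the plane conic with plane `ρ₁N₀ + ρ₂N₁ + ρ₃N₂ + ρ₄N₃`. -/
theorem exists_dual_planeConic (hP : Function.Injective (centers P))
    (hQ : Projectivization.Independent (centers Q)) (hAB : LinearIndependent ℝ ![T.A, T.B]) :
    ∃ T' : PlaneConic, T'.IsProper ∧
      (∀ i j, i ≠ j → viewQuadric Q P i j = T'.plane ∪ T'.conicPlane) ∧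
      (∀ i, centers Q i ∈ T'.conic) ∧ T'.IsSmooth ∧ criticalPoints Q P = T'.carrier := by
  obtain ⟨ρ₁, ρ₂, ρ₃, ρ₄, ρ₅, hρ, hrel, hsurj⟩ := T.exists_relation hP
  -- Otherwise the relation would involve only `A` and `B`, which are independent. This is what
  -- separates the new plane from the plane of the new conic.
  have hρ3 : ¬(ρ₁ = 0 ∧ ρ₂ = 0 ∧ ρ₃ = 0) := by
    rintro ⟨rfl, rfl, rfl⟩
    simp only [zero_smul, zero_add] at hrel
    obtain ⟨h5, h4⟩ := LinearIndependent.pair_iff.1 hAB ρ₅ ρ₄ (by rw [add_comm, hrel])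
    exact hρ ⟨rfl, rfl, rfl, h4, h5⟩
  have hrel' : ∀ w : Fin 4 → ℂ, ρ₁ * (complexify T.r₁ ⬝ᵥ w) + ρ₂ * (complexify T.r₂ ⬝ᵥ w) +
      ρ₃ * (complexify T.r₃ ⬝ᵥ w) + ρ₄ * (complexify T.B ⬝ᵥ w) +
      ρ₅ * (complexify T.A ⬝ᵥ w) = 0 := fun w => by
    have := congrArg (fun r => complexify r ⬝ᵥ w) hrel
    simpa only [complexify_add, complexify_smul, add_dotProduct, smul_dotProduct, smul_eq_mul,
      complexify_eq_zero.2 rfl, zero_dotProduct] using this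
  set m : Fin 4 → ℝ := ρ₁ • T.N 0 + ρ₂ • T.N 1 + ρ₃ • T.N 2 + ρ₄ • T.N 3 with hm
  have hme : ∀ w : Fin 4 → ℂ, complexify m ⬝ᵥ w = ρ₁ * (complexify (T.N 0) ⬝ᵥ w) +
      ρ₂ * (complexify (T.N 1) ⬝ᵥ w) + ρ₃ * (complexify (T.N 2) ⬝ᵥ w) +
      ρ₄ * (complexify (T.N 3) ⬝ᵥ w) := fun w => by
    simp only [hm, complexify_add, complexify_smul, add_dotProduct, smul_dotProduct, smul_eq_mul]
  have hproper : LinearIndependent ℝ ![m, T.N 3] := by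
    rw [LinearIndependent.pair_iff]
    intro s t hst
    have hst' : ∀ w : Fin 4 → ℂ, s * (complexify m ⬝ᵥ w) + t * (complexify (T.N 3) ⬝ᵥ w) = 0 :=
      fun w => by
        have := congrArg (fun r => complexify r ⬝ᵥ w) hst
        simpa only [complexify_add, complexify_smul, add_dotProduct, smul_dotProduct, smul_eq_mul,
          complexify_eq_zero.2 rfl, zero_dotProduct] using this
    have hs : s = 0 := by
      by_contra hs
      -- At the point with coordinates `(ρ₁,ρ₂,ρ₃,0)` the form `m` is a sum of real squares.
      obtain ⟨w, w1, w2, w3, w4⟩ := coordinates_surjective T.isUnit_N ρ₁ ρ₂ ρ₃ 0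
      have e := hst' w
      rw [hme, w1, w2, w3, w4] at e
      have e' : s * (ρ₁ * ρ₁ + ρ₂ * ρ₂ + ρ₃ * ρ₃) = 0 := by
        have : ((s * (ρ₁ * ρ₁ + ρ₂ * ρ₂ + ρ₃ * ρ₃) : ℝ) : ℂ) = 0 := by
          push_cast
          linear_combination e
        exact_mod_cast this
      have e2 := (mul_eq_zero.1 e').resolve_left hs
      exact hρ3 ⟨by nlinarith, by nlinarith, by nlinarith⟩
    subst hs
    obtain ⟨w, -, -, -, w4⟩ := coordinates_surjective T.isUnit_N 0 0 0 1
    have e := hst' w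
    rw [w4] at e
    exact ⟨rfl, by simpa using e⟩
  have hsm : ∀ v, T.N 3 ⬝ᵥ v = 0 →
      (∀ w, T.N 3 ⬝ᵥ w = 0 → w ⬝ᵥ (T.dualConicMatrix *ᵥ v) = 0) → v = 0 :=
    fun v => T.dualConicMatrix_isSmooth hQ
  refine ⟨⟨m, T.N 3, T.dualConicMatrix, hproper.ne_zero 0, hproper.ne_zero 1,
    T.dualConicMatrix_isSymm, ?_⟩, hproper, ?_, ?_, hsm, ?_⟩
  · obtain ⟨k, hk0, hk⟩ := (Q 0).exists_real_center
    by_contra! hc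
    refine hk0 (hsm k (T.dualConicMatrix_self_eq_zero hk).1 fun w hw => ?_)
    by_contra h0
    obtain ⟨v, hv, hv0⟩ := exists_dotProduct_mulVec_ne_zero T.dualConicMatrix_isSymm
      (T.dualConicMatrix_self_eq_zero hk).1 hw h0
    exact hv0 (hc v hv)
  · have hmem : ∀ {u : Fin 4 → ℂ} (hu : u ≠ 0),
        Projectivization.mk ℂ u hu ∈ planeLocus (complexify m) ∪ planeLocus (complexify (T.N 3)) ↔
        complexify m ⬝ᵥ u = 0 ∨ complexify (T.N 3) ⬝ᵥ u = 0 := fun hu => by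
      rw [Set.mem_union, mk_mem_planeLocus, mk_mem_planeLocus]
    have h01 : viewQuadric Q P 0 1 = planeLocus (complexify m) ∪ planeLocus (complexify (T.N 3)) := by
      ext x
      induction x using Projectivization.ind with
      | h u hu =>
        rw [hmem, hme, mk_mem_viewQuadric_swap_iff_of_normal_pair (T.eq_zero hP) hrel' hsurj
          T.view₀ T.view₁]
    have h12 : viewQuadric Q P 1 2 = planeLocus (complexify m) ∪ planeLocus (complexify (T.N 3)) := by
      ext x
      induction x using Projectivization.ind with
      | h u hu =>
        rw [hmem, hme, mk_mem_viewQuadric_swap_iff_of_normal_pair (ρ₁ := ρ₂) (ρ₂ := ρ₃)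
          (ρ₃ := ρ₁) (ρ₄ := ρ₄) (ρ₅ := ρ₅) (fun w h2 h3 h1 => T.eq_zero hP w h1 h2 h3)
          (fun w => by linear_combination hrel' w) (fun x₂ x₃ x₁ b a h => by
            obtain ⟨w, h1, h2, h3, h4⟩ := hsurj x₁ x₂ x₃ b a (by linear_combination h)
            exact ⟨w, h2, h3, h1, h4⟩) T.view₁ T.view₂]
        refine or_congr_left ?_
        constructor <;> intro h <;> linear_combination h
    have h20 : viewQuadric Q P 2 0 = planeLocus (complexify m) ∪ planeLocus (complexify (T.N 3)) := by
      ext x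
      induction x using Projectivization.ind with
      | h u hu =>
        rw [hmem, hme, mk_mem_viewQuadric_swap_iff_of_normal_pair (ρ₁ := ρ₃) (ρ₂ := ρ₁)
          (ρ₃ := ρ₂) (ρ₄ := ρ₄) (ρ₅ := ρ₅) (fun w h3 h1 h2 => T.eq_zero hP w h1 h2 h3)
          (fun w => by linear_combination hrel' w) (fun x₃ x₁ x₂ b a h => by
            obtain ⟨w, h1, h2, h3, h4⟩ := hsurj x₁ x₂ x₃ b a (by linear_combination h)
            exact ⟨w, h3, h1, h2, h4⟩) T.view₂ T.view₀]
        refine or_congr_left ?_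
        constructor <;> intro h <;> linear_combination h
    intro i j hij
    change _ = planeLocus (complexify m) ∪ planeLocus (complexify (T.N 3))
    fin_cases i <;> fin_cases j
    · exact absurd rfl hij
    · exact h01
    · exact (viewQuadric_comm _ _).trans h20
    · exact (viewQuadric_comm _ _).trans h01
    · exact absurd rfl hij
    · exact h12
    · exact h20
    · exact (viewQuadric_comm _ _).trans h12
    · exact absurd rfl hij
  · intro i
    obtain ⟨k, hk0, hk⟩ := (Q i).exists_real_center
    obtain ⟨h1, h2⟩ := T.dualConicMatrix_self_eq_zero hk
    have hkc : complexify k ≠ 0 := mt complexify_eq_zero.1 hk0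
    rw [centers, ((Q i).center_eq_mk_iff hkc).2 (by
      rw [Camera.toLin_complexify, hk, complexify_eq_zero]), mk_mem_conic]
    simp only [map_mulVec_complexify, complexify_dotProduct, h1, h2]
    simp
  · ext x
    induction x using Projectivization.ind with
    | h v hv =>
      rw [T.mem_criticalPoints_swap, mk_mem_carrier]
      simp only [dualConicMatrix_eq_zero_iff, hme]
      constructor
      · rintro ⟨u, hu, h⟩
        exact h.right (fun h0 => hu (T.eq_zero hP u h0.1 h0.2.1 h0.2.2.1 h0.2.2.2.2 h0.2.2.2.1))
          (hrel' u)
      · rintro (h | ⟨h1, h2⟩)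
        · obtain ⟨u, u1, u2, u3, u4, u5⟩ := hsurj (complexify (T.N 0) ⬝ᵥ v)
            (complexify (T.N 1) ⬝ᵥ v) (complexify (T.N 2) ⬝ᵥ v) (complexify (T.N 3) ⬝ᵥ v) 0
            (by linear_combination h)
          refine ⟨u, ?_, by rw [u1, u2, u3, u4, u5]; exact matched_self _ _ _ _⟩
          rintro rfl
          simp only [dotProduct_zero] at u1 u2 u3 u4
          exact hv (coordinates_injective T.isUnit_N v u1.symm u2.symm u3.symm u4.symm)
        · obtain ⟨x₁, x₂, x₃, a, hx, hxr, hmat⟩ := exists_matched_of_dual_conic h2 ρ₁ ρ₂ ρ₃ ρ₅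
          obtain ⟨u, u1, u2, u3, u4, u5⟩ := hsurj x₁ x₂ x₃ 0 a (by linear_combination hxr)
          refine ⟨u, ?_, by rw [h1, u1, u2, u3, u4, u5]; exact hmat⟩
          rintro rfl
          simp only [dotProduct_zero] at u1 u2 u3 u5
          exact hx ⟨u1.symm, u2.symm, u3.symm, u5.symm⟩

end NormalForm

/-! ### Assembling the theorem -/

theorem planeLocus_smul {a : Fin 4 → ℂ} {x : ℂ} (hx : x ≠ 0) :
    planeLocus (x • a) = planeLocus a := by
  ext p
  simp only [planeLocus, Set.mem_ofPred_eq, smul_dotProduct, smul_eq_zero, hx, false_or]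

theorem exists_normalForm {P Q : Fin 3 → Camera}
    (hQ : Projectivization.Independent (centers Q)) {a b : Fin 4 → ℂ}
    (hab : LinearIndependent ℂ ![a, b])
    (H : ∀ i j, i ≠ j → viewQuadric P Q i j = planeLocus a ∪ planeLocus b) :
    ∃ T : NormalForm P Q, LinearIndependent ℝ ![T.A, T.B] ∧
      planeLocus (complexify T.A) ∪ planeLocus (complexify T.B) =
        planeLocus a ∪ planeLocus b := by
  obtain ⟨r₁, r₂, r₃, A, B, N, hN, h₀, h₁, h₂, x, y, hx, hy, h⟩ := exists_normal_form hQ hab H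
  refine ⟨⟨r₁, r₂, r₃, A, B, N, hN, h₀, h₁, h₂⟩, ?_, ?_⟩
  · rw [LinearIndependent.pair_iff] at hab ⊢
    intro s t hst
    have e := congrArg complexify hst
    rw [complexify_add, complexify_smul, complexify_smul, complexify_eq_zero.2 rfl] at e
    rcases h with ⟨hA, hB⟩ | ⟨hA, hB⟩ <;> simp only [hA, hB, smul_smul] at e
    · have := hab _ _ e
      simpa [hx, hy] using this
    · have := hab _ _ ((add_comm _ _).trans e)
      simpa [hx, hy, and_comm] using this
  · rcases h with ⟨hA, hB⟩ | ⟨hA, hB⟩ <;>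
      simp only [hA, hB, planeLocus_smul hx, planeLocus_smul hy]
    exact Set.union_comm _ _

theorem mainTheorem6 :
    -- three views, all three quadrics equal to the same two planes
    (∀ P Q : Fin 3 → Camera,
      Function.Injective (centers P) → Function.Injective (centers Q) →
      Projectivization.Independent (centers Q) →
      ∀ a b : Fin 4 → ℂ, LinearIndependent ℂ ![a, b] →
      (∀ i j, i ≠ j → viewQuadric P Q i j = planeLocus a ∪ planeLocus b) →
      (∃ T : PlaneConic, T.IsProper ∧
        T.plane ∪ T.conicPlane = planeLocus a ∪ planeLocus b ∧
        (∀ i, centers P i ∈ T.conic) ∧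
        (Projectivization.Independent (centers P) → T.IsSmooth) ∧
        criticalPoints P Q = T.carrier) ∧
      (∃ T' : PlaneConic, T'.IsProper ∧
        (∀ i j, i ≠ j → viewQuadric Q P i j = T'.plane ∪ T'.conicPlane) ∧
        (∀ i, centers Q i ∈ T'.conic) ∧
        T'.IsSmooth ∧
        criticalPoints Q P = T'.carrier)) ∧
    -- the converse, for any number of views
    (∀ n : ℕ, 2 ≤ n → ∀ P : Fin n → Camera, Function.Injective (centers P) →
      ∀ T : PlaneConic, T.IsSmooth → (∀ i, centers P i ∈ T.conic) →
      (∀ X : Set P3, X ⊆ T.carrier → IsCritical P X) ∧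
      ∃ (Q : Fin n → Camera) (T' : PlaneConic),
        Function.Injective (centers Q) ∧
        T'.IsSmooth ∧ (T'.IsProper ↔ T.IsProper) ∧
        (∀ i, centers Q i ∈ T'.conic) ∧
        IsConjugate P T.carrier Q T'.carrier ∧
        ∀ X : Set P3, X ⊆ T.carrier →
          ∃ Y : Set P3, Y ⊆ T'.carrier ∧ IsConjugate P X Q Y) := by
  refine ⟨fun P Q hP _ hind a b hab H => ?_, fun n hn P hP T hT hc => ?_⟩
  · obtain ⟨T, hAB, hplanes⟩ := exists_normalForm hind hab H
    have hA : T.A ≠ 0 := hAB.ne_zero 0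
    have hB : T.B ≠ 0 := hAB.ne_zero 1
    exact ⟨⟨T.planeConic hP hA hB, hAB, hplanes, T.planeConic_center_mem hP hA hB,
      fun h v hv hw => T.conicMatrix_isSmooth h hB hv hw, T.criticalPoints_eq hP hA hB⟩,
      T.exists_dual_planeConic hP hind hAB⟩
  · obtain ⟨Q, T', hQ, hT', hiff, hcQ, hconj, h⟩ := exists_conjugate_of_isSmooth hn P hP T hT hc
    refine ⟨fun X hX => ?_, Q, T', hQ, hT', hiff, hcQ, hconj, h⟩
    obtain ⟨Y, -, hY⟩ := h X hX
    exact ⟨Q, Y, hQ, hY⟩
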